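/- **Setting.** Fix integers $L\ge 2$, $N\ge 1$. For $\boldsymbol\nu=(\nu_1,\dots,\nu_L)\in\mathbb Z^L$ put $|\boldsymbol\nu|=\nu_1+\cdots+\nu_L$, and let $\lambda(\boldsymbol\nu)$ be the ($L$-core) partition of the Maya diagram $\bigcup_{k=1}^{L}(L\mathbb Z_{<\nu_k}+k)=\{m_1>m_2>\cdots\}$, i.e. $m_i-m_{i+1}=\lambda_i-\lambda_{i+1}+1$. Let $\boldsymbol\nu(m)=\boldsymbol\nu+(1^m,0^{L-m})$ for $0\le m\le L$, extended to $m\in\mathbb Z$ by $\boldsymbol\nu(m+L)=\boldsymbol\nu(m)+(1,\dots,1)$, and extend $\nu_m$ to $m\in\mathbb Z$ by $\nu_{m+L}=\nu_m$. Define $h_n$ by $\exp\sum_{k\ge1}x_kz^k=\sum_{n\in\mathbb Z} h_n(\boldsymbol x)z^n$. For partitions $\lambda,\mu$ of lengths $\ell,\ell'$ the universal character is $S_{[\lambda,\mu]}(\boldsymbol x,\boldsymbol y)=\det(a_{ij})_{1\le i,j\le \ell+\ell'}$ with $a_{ij}=h_{\mu_{\ell'-i+1}+i-j}(\boldsymbol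 y)$ for $i\le\ell'$ and $a_{ij}=h_{\lambda_{i-\ell'}-i+j}(\boldsymbol x)$ for $i\ge\ell'+1$. For $\boldsymbol\nu,\boldsymbol\nu'\in\mathbb Z^L$, $m,n\in\mathbb Z$, $\boldsymbol\theta\in\mathbb C^{N+1}$ and $\boldsymbol t=(t_0,\dots,t_N)$ with all $t_i\neq0$ let $$\sigma_{m,n}(\boldsymbol\theta,\boldsymbol t)=S_{[\lambda(\boldsymbol\nu(m)),\lambda(\boldsymbol\nu'(n))]}(\boldsymbol x,\boldsymbol y),\qquad x_k=\tfrac1k\sum_{i=0}^N\theta_it_i^k,\quad y_k=\tfrac1k\sum_{i=0}^N\theta_it_i^{-k}.$$ Write $\sigma_{m,n}(\theta_i\pm1)$ when only $\theta_i$ is shifted (likewise for other functions of $\boldsymbol\theta$), $\partial_i=\partial/\partial t_i$, and $D_iF\cdot G=(\partial_iF)G-F\,\partial_iG$. For $0\le i,j\le N$ put $$f^{(i)}_{m,n}=\frac{\sigma_{m,n-1}(\theta_i+1)\,\sigma_{m-1,n-1}}{\sigma_{m-1,n}(\theta_i+1)\,\sigma_{m,n-2}},\qquad g^{(i)}_{m,n}=\frac{t_iD_i\,\sigma_{m,n-1}\cdot\sigma_{m-1,n}}{\sigma_{m,n-1}\sigma_{m-1,n}}+\theta_i,$$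 and, for $i\ne j$, $$U^{(i,j)}_{m,n}=\frac{\theta_it_j}{t_i-t_j}\,\frac{\sigma_{m,n-1}(\theta_i-1,\theta_j+1)\,\sigma_{m,n}(\theta_i+1)}{\sigma_{m,n-1}\,\sigma_{m,n}(\theta_j+1)},\qquad V^{(i,j)}_{m,n}=\frac{\theta_it_i}{t_i-t_j}\,\frac{\sigma_{m-1,n}(\theta_i-1,\theta_j+1)\,\sigma_{m,n}(\theta_i+1)}{\sigma_{m-1,n}\,\sigma_{m,n}(\theta_j+1)}.$$ **Theorem.** (1) The $\sigma_{m,n}$ are $L$-periodic in $m$ and in $n$, differentiable in $\boldsymbol t$ where all $t_k\ne0$, and there satisfy, for all $m,n\in\mathbb Z$ and $0\le i,j\le N$, $$(t_i-t_j)\,\sigma_{m,n}\,\sigma_{m+1,n+1}(\theta_i+1,\theta_j+1)=t_i\,\sigma_{m+1,n}(\theta_i+1)\,\sigma_{m,n+1}(\theta_j+1)-t_j\,\sigma_{m+1,n}(\theta_j+1)\,\sigma_{m,n+1}(\theta_i+1),$$ $$(t_iD_i+\theta_i)\,\sigma_{m+1,n}\cdot\sigma_{m,n+1}=\theta_i\,\sigma_{m,n}(\theta_i-1)\,\sigma_{m+1,n+1}(\theta_i+1),$$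 $$\bigl((t_j-t_i)D_i+\theta_i\bigr)\,\sigma_{m,n}(\theta_j-1)\cdot\sigma_{m+1,n}=\theta_i\,\sigma_{m,n}(\theta_i-1)\,\sigma_{m+1,n}(\theta_i+1,\theta_j-1),$$ $$\sum_{i=0}^Nt_i\,\partial_i\sigma_{m,n}=d_{m,n}\,\sigma_{m,n},\qquad d_{m,n}=|\lambda(\boldsymbol\nu(m))|-|\lambda(\boldsymbol\nu'(n))|,$$ where $d_{m,n}-d_{m-1,n}=L\nu_m-|\boldsymbol\nu|$ and $d_{m,n}-d_{m,n-1}=-L\nu'_n+|\boldsymbol\nu'|$. (2) For $c\in\mathbb Z$ let $R_c$ be the set of $(\boldsymbol\theta,\boldsymbol t)$ with $t_i$ nonzero and pairwise distinct, $\sigma_{m,n}\neq0$ whenever $m+n=c-1$, and $\sigma_{m,n}(\theta_i+1)\ne0$ for all $i$ whenever $m+n=c$. Then $R_c$ is dense in $\mathbb C^{N+1}\times\mathbb C^{N+1}$. For $m+n=c$ and all $i$, the functions $f^{(i)}_{m,n+1}$ and $g^{(i)}_{m,n}$ are on $R_c$ quotients of polynomials in $(\boldsymbol\theta,\boldsymbol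 t)$ with denominators that do not vanish on $R_c$, and $$g^{(i)}_{m,n}=\theta_i\,\frac{\sigma_{m-1,n-1}(\theta_i-1)\,\sigma_{m,n}(\theta_i+1)}{\sigma_{m,n-1}\,\sigma_{m-1,n}}.$$ (3) They give a rational solution of the system $\mathcal G_{L,N}$: put $$\kappa_{m,n}=L(\nu_m+\nu'_n)-|\boldsymbol\nu|-|\boldsymbol\nu'|+\sum_{i=0}^N\theta_i .$$ Then, for every $c$ and every $\boldsymbol\theta$, at all $\boldsymbol t$ with $(\boldsymbol\theta,\boldsymbol t)\in R_c$ these functions are differentiable in $\boldsymbol t$ and satisfy, for $m+n=c+1$ in the first two lines, $m+n=c$ in the last three, all $i$, and all $j\ne i$ in the second and fourth lines, $$t_i\,\partial_if^{(i)}_{m,n}=\Bigl(\kappa_{m,n}-g^{(i)}_{m,n-1}+\sum_{j\ne i}\bigl(U^{(j,i)}_{m-1,n}-V^{(j,i)}_{m,n-1}\bigr)\Bigr)f^{(i)}_{m,n},$$ $$t_j\,\partial_jf^{(i)}_{m,n}=\bigl(-g^{(j)}_{m,n-1}-U^{(j,i)}_{m-1,n}+V^{(j,i)}_{m,n-1}\bigr)f^{(i)}_{m,n},$$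 $$t_i\,\partial_ig^{(i)}_{m,n}=-\sum_{j\ne i}\bigl(U^{(i,j)}_{m,n}g^{(j)}_{m,n}+V^{(j,i)}_{m,n}g^{(i)}_{m,n}\bigr),$$ $$t_j\,\partial_jg^{(i)}_{m,n}=U^{(i,j)}_{m,n}g^{(j)}_{m,n}+V^{(j,i)}_{m,n}g^{(i)}_{m,n},$$ $$\sum_{i=0}^Ng^{(i)}_{m,n}=\kappa_{m,n}.$$ This is a closed system: on $R_c$, for $m+n=c$ and whenever $t_i^L\neq t_j^L$, $$U^{(i,j)}_{m,n}=\frac1{(t_i/t_j)^L-1}\sum_{b=1}^Lg^{(i)}_{m-b+1,n+b-1}\prod_{a=1}^{b-1}\frac{t_if^{(i)}_{m-a+1,n+a}}{t_jf^{(j)}_{m-a+1,n+a}},$$ $$V^{(i,j)}_{m,n}=\frac1{(t_i/t_j)^L-1}\sum_{b=1}^Lg^{(i)}_{m-b,n+b}\prod_{a=0}^{b-1}\frac{t_if^{(i)}_{m-a,n+a+1}}{t_jf^{(j)}_{m-a,n+a+1}}.$$ Consequently, at the points of $R_c$ where moreover $t_i^L\ne t_j^L$ for all $i\neq j$, the equations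 displayed above hold also with these expressions in place of $U$ and $V$. -/

import Mathlib

/-! ### Maya diagrams and their partitions -/

/-- A Maya diagram: a set of integers that contains every sufficiently small integer and
no sufficiently large one. -/
structure MayaDiagram where
  carrier : Set ℤ
  mem_of_small : ∃ a : ℤ, ∀ k ≤ a, k ∈ carrier
  notMem_of_large : ∃ b : ℤ, ∀ k ≥ b, k ∉ carrier

namespace MayaDiagram

/-- The elements `m₁ > m₂ > ⋯` of a Maya diagram in decreasing order (`m.elt i` is the
`(i+1)`-st largest element). -/
noncomputable def elt (m : MayaDiagram) : ℕ → ℤ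
  | 0 => sSup m.carrier
  | i + 1 => sSup {k : ℤ | k ∈ m.carrier ∧ k < m.elt i}

/-- The integers missing from `m` below its `(i+1)`-st largest element. -/
def holes (m : MayaDiagram) (i : ℕ) : Set ℤ := {k : ℤ | k ∉ m.carrier ∧ k < m.elt i}

/-- The `(i+1)`-st part of the partition of `m`: the number of missing integers below the
`(i+1)`-st largest element. -/
noncomputable def part (m : MayaDiagram) (i : ℕ) : ℕ := (m.holes i).ncard

theorem bddAbove (m : MayaDiagram) : BddAbove m.carrier := by
  obtain ⟨b, hb⟩ := m.notMem_of_large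
  exact ⟨b, fun k hk => le_of_not_ge fun h => hb k h hk⟩

theorem elt_zero_mem (m : MayaDiagram) : m.elt 0 ∈ m.carrier := by
  obtain ⟨a, ha⟩ := m.mem_of_small
  exact Int.csSup_mem ⟨a, ha a le_rfl⟩ m.bddAbove

theorem elt_succ_mem (m : MayaDiagram) (i : ℕ) :
    m.elt (i + 1) ∈ {k : ℤ | k ∈ m.carrier ∧ k < m.elt i} := by
  obtain ⟨a, ha⟩ := m.mem_of_small
  refine Int.csSup_mem ⟨min a (m.elt i - 1), ha _ (min_le_left _ _), ?_⟩
    (m.bddAbove.mono fun k hk => hk.1)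
  have := min_le_right a (m.elt i - 1)
  omega

theorem elt_mem (m : MayaDiagram) (i : ℕ) : m.elt i ∈ m.carrier := by
  cases i with
  | zero => exact m.elt_zero_mem
  | succ i => exact (m.elt_succ_mem i).1

theorem elt_strictAnti (m : MayaDiagram) : StrictAnti m.elt :=
  strictAnti_nat_of_succ_lt fun i => (m.elt_succ_mem i).2

theorem notMem_of_between (m : MayaDiagram) {i : ℕ} {k : ℤ} (h1 : m.elt (i + 1) < k)
    (h2 : k < m.elt i) : k ∉ m.carrier := fun hk =>
  absurd (le_csSup (m.bddAbove.mono fun _ h => h.1 :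
    BddAbove {k : ℤ | k ∈ m.carrier ∧ k < m.elt i}) ⟨hk, h2⟩) (not_le.2 h1)

theorem elt_le (m : MayaDiagram) (i : ℕ) : m.elt i ≤ m.elt 0 - i := by
  induction i with
  | zero => simp
  | succ i ih =>
    have := (m.elt_succ_mem i).2
    push_cast
    omega

/-- Every element of the diagram occurs in the enumeration. -/
theorem exists_elt_eq (m : MayaDiagram) {k : ℤ} (hk : k ∈ m.carrier) : ∃ i, m.elt i = k := by
  by_contra! hne
  have key : ∀ i, k < m.elt i := by
    intro i
    induction i with
    | zero => exact lt_of_le_of_ne (le_csSup m.bddAbove hk) (hne 0).symm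
    | succ i ih =>
      exact lt_of_le_of_ne (le_csSup (m.bddAbove.mono fun _ h => h.1 :
        BddAbove {k : ℤ | k ∈ m.carrier ∧ k < m.elt i}) ⟨hk, ih⟩) (hne (i + 1)).symm
  have h1 := key (m.elt 0 - k).toNat
  have h2 := m.elt_le (m.elt 0 - k).toNat
  have h3 := key 0
  omega

theorem holes_finite (m : MayaDiagram) (i : ℕ) : (m.holes i).Finite := by
  obtain ⟨a, ha⟩ := m.mem_of_small
  refine (Set.finite_Ioo a (m.elt i)).subset fun k hk => ⟨?_, hk.2⟩
  by_contra h
  exact hk.1 (ha k (not_lt.1 h))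

theorem part_antitone (m : MayaDiagram) : Antitone m.part := fun _ _ hij =>
  Set.ncard_le_ncard (fun _ hk => ⟨hk.1, hk.2.trans_le (m.elt_strictAnti.antitone hij)⟩)
    (m.holes_finite _)

theorem part_eventually_zero (m : MayaDiagram) : ∃ r, ∀ i ≥ r, m.part i = 0 := by
  obtain ⟨a, ha⟩ := m.mem_of_small
  refine ⟨(m.elt 0 - a).toNat, fun i hi => ?_⟩
  have h : m.holes i = ∅ := by
    ext k
    simp only [holes, Set.mem_ofPred_eq, Set.mem_empty_iff_false, iff_false, not_and, not_lt]
    intro hk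
    have h1 : a < k := by
      by_contra h
      exact hk (ha k (not_lt.1 h))
    have := m.elt_le i
    omega
  rw [part, h, Set.ncard_empty]

/-- The defining relation `m_i - m_{i+1} = λ_i - λ_{i+1} + 1` between a Maya diagram and its
partition. -/
theorem elt_sub_elt (m : MayaDiagram) (i : ℕ) :
    m.elt i - m.elt (i + 1) = (m.part i : ℤ) - m.part (i + 1) + 1 := by
  have hlt := (m.elt_succ_mem i).2
  have hU : m.holes i = m.holes (i + 1) ∪ Set.Ioo (m.elt (i + 1)) (m.elt i) := by
    ext k
    simp only [holes, Set.mem_ofPred_eq, Set.mem_union, Set.mem_Ioo]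
    constructor
    · rintro ⟨hk, h⟩
      rcases lt_trichotomy k (m.elt (i + 1)) with h' | h' | h'
      · exact Or.inl ⟨hk, h'⟩
      · exact absurd (h' ▸ m.elt_mem (i + 1)) hk
      · exact Or.inr ⟨h', h⟩
    · rintro (⟨hk, h⟩ | ⟨h1, h2⟩)
      · exact ⟨hk, h.trans hlt⟩
      · exact ⟨m.notMem_of_between h1 h2, h2⟩
  have hd : Disjoint (m.holes (i + 1)) (Set.Ioo (m.elt (i + 1)) (m.elt i)) :=
    Set.disjoint_left.2 fun k h1 h2 => absurd h1.2 (not_lt.2 h2.1.le)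
  have hc : m.part i = m.part (i + 1) + (m.elt i - m.elt (i + 1) - 1).toNat := by
    rw [part, hU, Set.ncard_union_eq hd (m.holes_finite _) (Set.finite_Ioo _ _), part]
    congr 1
    rw [← Finset.coe_Ioo, Set.ncard_coe_finset, Int.card_Ioo]
  have : m.elt (i + 1) < m.elt i := hlt
  omega

theorem cells_finite (m : MayaDiagram) : {c : ℕ × ℕ | c.2 < m.part c.1}.Finite := by
  obtain ⟨r, hr⟩ := m.part_eventually_zero
  refine ((Set.finite_Iio r).prod (Set.finite_Iio (m.part 0))).subset fun c hc => ⟨?_, ?_⟩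
  · by_contra h
    have h0 := hr c.1 (not_lt.1 h)
    have hc' : c.2 < m.part c.1 := hc
    omega
  · exact lt_of_lt_of_le hc (m.part_antitone (Nat.zero_le _))

/-- The partition of a Maya diagram, as a Young diagram with row lengths `m.part`. -/
noncomputable def toYoungDiagram (m : MayaDiagram) : YoungDiagram where
  cells := m.cells_finite.toFinset
  isLowerSet := by
    intro c d hdc hc
    simp only [Set.Finite.coe_toFinset, Set.mem_ofPred_eq] at hc ⊢
    exact lt_of_le_of_lt hdc.2 (lt_of_lt_of_le hc (m.part_antitone hdc.1))

theorem rowLen_toYoungDiagram (m : MayaDiagram) (i : ℕ) :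
    m.toYoungDiagram.rowLen i = m.part i := by
  refine eq_of_forall_lt_iff fun j => ?_
  rw [← YoungDiagram.mem_iff_lt_rowLen, ← YoungDiagram.mem_cells]
  simp [toYoungDiagram]

end MayaDiagram

/-- The Maya diagram `m(ν) = ⋃_{k = 1, …, L} (L ℤ_{< ν_k} + k)`; the entry `ν_k` is `ν (k - 1)`. -/
def coreMaya {L : ℕ} (hL : 2 ≤ L) (ν : Fin L → ℤ) : MayaDiagram where
  carrier := {p : ℤ | ∃ (k : Fin L) (q : ℤ), q < ν k ∧ p = L * q + ((k : ℕ) + 1)}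
  mem_of_small := by
    obtain ⟨B, hB⟩ : ∃ B : ℤ, ∀ k, B ≤ ν k := by
      obtain ⟨B, hB⟩ := (Set.finite_range ν).bddBelow
      exact ⟨B, fun k => hB ⟨k, rfl⟩⟩
    have hL0 : (0 : ℤ) < L := by omega
    refine ⟨L * B, fun p hp => ?_⟩
    have h1 := Int.emod_nonneg (p - 1) hL0.ne'
    have h2 := Int.emod_lt_of_pos (p - 1) hL0
    have h3 := Int.mul_ediv_add_emod (p - 1) L
    refine ⟨⟨((p - 1) % L).toNat, by omega⟩, (p - 1) / L, lt_of_lt_of_le ?_ (hB _), ?_⟩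
    · exact Int.ediv_lt_of_lt_mul hL0 (by rw [mul_comm]; omega)
    · simp only [Int.toNat_of_nonneg h1]
      omega
  notMem_of_large := by
    obtain ⟨B, hB⟩ : ∃ B : ℤ, ∀ k, ν k ≤ B := by
      obtain ⟨B, hB⟩ := (Set.finite_range ν).bddAbove
      exact ⟨B, fun k => hB ⟨k, rfl⟩⟩
    refine ⟨L * B + 1, ?_⟩
    rintro p hp ⟨k, q, hq, rfl⟩
    have hk := k.2
    have hqB : q ≤ B - 1 := by have := hB k; omega
    have h4 : (L : ℤ) * q ≤ L * (B - 1) := mul_le_mul_of_nonneg_left hqB (by positivity)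
    rw [mul_sub, mul_one] at h4
    omega

/-- The `L`-core partition `λ(ν)`. -/
noncomputable def corePartition {L : ℕ} (hL : 2 ≤ L) (ν : Fin L → ℤ) : YoungDiagram :=
  (coreMaya hL ν).toYoungDiagram

/-- `ν(m) = ν + (1, …, 1, 0, …, 0)` with `m` ones for `0 ≤ m ≤ L`, continued to all `m ∈ ℤ` by
`ν(m + L) = ν(m) + (1, …, 1)`. -/
def shiftSeq {L : ℕ} (ν : Fin L → ℤ) (m : ℤ) : Fin L → ℤ :=
  fun k => ν k + m / L + if ((k : ℕ) : ℤ) < m % L then 1 else 0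

/-- The entry `ν_m`, `m = 1, …, L`, continued to all `m ∈ ℤ` by `ν_{m+L} = ν_m`. -/
def cyclicEntry {L : ℕ} (hL : 2 ≤ L) (ν : Fin L → ℤ) (m : ℤ) : ℤ :=
  ν ⟨((m - 1) % L).toNat, by
    have h1 := Int.emod_nonneg (m - 1) (b := (L : ℤ)) (by omega)
    have h2 := Int.emod_lt_of_pos (m - 1) (b := (L : ℤ)) (by omega)
    omega⟩

/-! ### Universal characters -/

/-- `h_n(x)`, `n ∈ ℤ`: the coefficients of `exp (∑_{k ≥ 1} x_k z^k) = ∑_n h_n z^n`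
(the value `x 0` is not used). -/
noncomputable def completeH (x : ℕ → ℂ) (n : ℤ) : ℂ :=
  if n < 0 then 0
  else PowerSeries.coeff n.toNat
    ((PowerSeries.exp ℂ).subst (PowerSeries.mk fun k => if k = 0 then 0 else x k))

/-- The universal character `S_{[lam, mu]}(x, y)`: the twisted Jacobi-Trudi determinant of size
`ℓ' + ℓ`, where `ℓ` and `ℓ'` are the lengths of `lam` and `mu`. Rows and columns are numbered
from `0`, so row `i < ℓ'` has entries `h_{mu_{ℓ'-i} + i - j}(y)`, and row `i ≥ ℓ'` has entries
`h_{lam_{i+1-ℓ'} - i + j}(x)` (with parts of partitions numbered from `1`). -/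
noncomputable def universalCharacter (lam mu : YoungDiagram) (x y : ℕ → ℂ) : ℂ :=
  Matrix.det (Matrix.of fun i j : Fin (mu.colLen 0 + lam.colLen 0) =>
    if (i : ℕ) < mu.colLen 0 then
      completeH y ((mu.rowLen (mu.colLen 0 - 1 - i) : ℤ) + (i : ℕ) - (j : ℕ))
    else
      completeH x ((lam.rowLen (i - mu.colLen 0) : ℤ) - (i : ℕ) + (j : ℕ)))

/-- `x_n = (1/n) ∑_i θ_i t_i^n`. -/
noncomputable def powerSumX {N : ℕ} (θ t : Fin (N + 1) → ℂ) (n : ℕ) : ℂ :=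
  (1 / (n : ℂ)) * ∑ i, θ i * t i ^ n

/-- `y_n = (1/n) ∑_i θ_i t_i^{-n}`. -/
noncomputable def powerSumY {N : ℕ} (θ t : Fin (N + 1) → ℂ) (n : ℕ) : ℂ :=
  (1 / (n : ℂ)) * ∑ i, θ i * (t i)⁻¹ ^ n

/-- `σ_{m,n}(θ, t) = S_{[λ(ν(m)), λ(ν'(n))]}(x, y)` under the power-sum substitution. -/
noncomputable def sigmaUC {L : ℕ} (hL : 2 ≤ L) (ν ν' : Fin L → ℤ) {N : ℕ} (m n : ℤ)
    (θ t : Fin (N + 1) → ℂ) : ℂ :=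
  universalCharacter (corePartition hL (shiftSeq ν m)) (corePartition hL (shiftSeq ν' n))
    (powerSumX θ t) (powerSumY θ t)

/-- `d_{m,n} = |λ(ν(m))| - |λ(ν'(n))|`. -/
noncomputable def degreeUC {L : ℕ} (hL : 2 ≤ L) (ν ν' : Fin L → ℤ) (m n : ℤ) : ℤ :=
  ((corePartition hL (shiftSeq ν m)).card : ℤ) - (corePartition hL (shiftSeq ν' n)).card

/-! ### Derivatives, Hirota derivatives, and the dependent variables -/

/-- The partial derivative `∂F/∂t_i`. -/
noncomputable def partialD {N : ℕ} (i : Fin (N + 1)) (F : (Fin (N + 1) → ℂ) → ℂ)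
    (t : Fin (N + 1) → ℂ) : ℂ :=
  deriv (fun s => F (Function.update t i s)) (t i)

/-- The Hirota derivative `D_i F · G = (∂F/∂t_i) G - F (∂G/∂t_i)`. -/
noncomputable def hirotaD {N : ℕ} (i : Fin (N + 1)) (F G : (Fin (N + 1) → ℂ) → ℂ)
    (t : Fin (N + 1) → ℂ) : ℂ :=
  partialD i F t * G t - F t * partialD i G t

/-- The unit vector `e_i`: `θ + unitV i` is `θ` with `θ_i` replaced by `θ_i + 1`. -/
def unitV {N : ℕ} (i : Fin (N + 1)) : Fin (N + 1) → ℂ := Pi.single i 1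

section DependentVariables

/-- `f^{(i)}_{m,n}` in terms of a family `σ_{m,n}(θ, t)`. -/
noncomputable def fVar {N : ℕ} (σ : ℤ → ℤ → (Fin (N + 1) → ℂ) → (Fin (N + 1) → ℂ) → ℂ)
    (θ : Fin (N + 1) → ℂ) (i : Fin (N + 1)) (m n : ℤ) (t : Fin (N + 1) → ℂ) : ℂ :=
  (σ m (n - 1) (θ + unitV i) t * σ (m - 1) (n - 1) θ t) /
    (σ (m - 1) n (θ + unitV i) t * σ m (n - 2) θ t)

/-- `g^{(i)}_{m,n}` in terms of a family `σ_{m,n}(θ, t)`. -/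
noncomputable def gVar {N : ℕ} (σ : ℤ → ℤ → (Fin (N + 1) → ℂ) → (Fin (N + 1) → ℂ) → ℂ)
    (θ : Fin (N + 1) → ℂ) (i : Fin (N + 1)) (m n : ℤ) (t : Fin (N + 1) → ℂ) : ℂ :=
  t i * hirotaD i (σ m (n - 1) θ) (σ (m - 1) n θ) t / (σ m (n - 1) θ t * σ (m - 1) n θ t) + θ i

/-- `U^{(i,j)}_{m,n}` in terms of a family `σ_{m,n}(θ, t)`. -/
noncomputable def uVar {N : ℕ} (σ : ℤ → ℤ → (Fin (N + 1) → ℂ) → (Fin (N + 1) → ℂ) → ℂ)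
    (θ : Fin (N + 1) → ℂ) (i j : Fin (N + 1)) (m n : ℤ) (t : Fin (N + 1) → ℂ) : ℂ :=
  θ i * t j / (t i - t j) *
    ((σ m (n - 1) (θ - unitV i + unitV j) t * σ m n (θ + unitV i) t) /
      (σ m (n - 1) θ t * σ m n (θ + unitV j) t))

/-- `V^{(i,j)}_{m,n}` in terms of a family `σ_{m,n}(θ, t)`. -/
noncomputable def vVar {N : ℕ} (σ : ℤ → ℤ → (Fin (N + 1) → ℂ) → (Fin (N + 1) → ℂ) → ℂ)
    (θ : Fin (N + 1) → ℂ) (i j : Fin (N + 1)) (m n : ℤ) (t : Fin (N + 1) → ℂ) : ℂ :=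
  θ i * t i / (t i - t j) *
    ((σ (m - 1) n (θ - unitV i + unitV j) t * σ m n (θ + unitV i) t) /
      (σ (m - 1) n θ t * σ m n (θ + unitV j) t))

end DependentVariables

/-! ### The system `G_{L,N}` -/

/-- `U^{(i,j)}_{m,n}` as an expression in the dependent variables `f`, `g`. -/
noncomputable def closedU {N : ℕ} (L : ℕ) (f g : Fin (N + 1) → ℤ → ℤ → (Fin (N + 1) → ℂ) → ℂ)
    (i j : Fin (N + 1)) (m n : ℤ) (t : Fin (N + 1) → ℂ) : ℂ :=
  1 / ((t i / t j) ^ L - 1) *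
    ∑ b ∈ Finset.Icc 1 L, g i (m - b + 1) (n + b - 1) t *
      ∏ a ∈ Finset.Icc 1 (b - 1),
        (t i * f i (m - a + 1) (n + a) t) / (t j * f j (m - a + 1) (n + a) t)

/-- `V^{(i,j)}_{m,n}` as an expression in the dependent variables `f`, `g`. -/
noncomputable def closedV {N : ℕ} (L : ℕ) (f g : Fin (N + 1) → ℤ → ℤ → (Fin (N + 1) → ℂ) → ℂ)
    (i j : Fin (N + 1)) (m n : ℤ) (t : Fin (N + 1) → ℂ) : ℂ :=
  1 / ((t i / t j) ^ L - 1) *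
    ∑ b ∈ Finset.Icc 1 L, g i (m - b) (n + b) t *
      ∏ a ∈ Finset.range b,
        (t i * f i (m - a) (n + a + 1) t) / (t j * f j (m - a) (n + a + 1) t)

/-- The differential equations of `G_{L,N}` with parameters `κ_{m,n}` on a set `Ω` of points `t`,
for the auxiliary variables `U`, `V`. The equations couple the `f_{m,n+1}` and `g_{m,n}` with
`m + n = c` for a fixed `c` only, and are imposed for these. -/
structure SolvesG {N : ℕ} (κ : ℤ → ℤ → ℂ) (c : ℤ) (Ω : Set (Fin (N + 1) → ℂ))
    (f g : Fin (N + 1) → ℤ → ℤ → (Fin (N + 1) → ℂ) → ℂ)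
    (U V : Fin (N + 1) → Fin (N + 1) → ℤ → ℤ → (Fin (N + 1) → ℂ) → ℂ) : Prop where
  differentiable_f : ∀ i m n, m + n = c + 1 → ∀ t ∈ Ω, DifferentiableAt ℂ (f i m n) t
  differentiable_g : ∀ i m n, m + n = c → ∀ t ∈ Ω, DifferentiableAt ℂ (g i m n) t
  sum_g : ∀ m n, m + n = c → ∀ t ∈ Ω, ∑ i, g i m n t = κ m n
  eq_f_same : ∀ i m n, m + n = c + 1 → ∀ t ∈ Ω,
    t i * partialD i (f i m n) t =
      (κ m n - g i m (n - 1) t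
        + ∑ j ∈ Finset.univ.erase i, (U j i (m - 1) n t - V j i m (n - 1) t)) * f i m n t
  eq_f_other : ∀ i j m n, i ≠ j → m + n = c + 1 → ∀ t ∈ Ω,
    t j * partialD j (f i m n) t =
      (-g j m (n - 1) t - U j i (m - 1) n t + V j i m (n - 1) t) * f i m n t
  eq_g_same : ∀ i m n, m + n = c → ∀ t ∈ Ω,
    t i * partialD i (g i m n) t =
      -∑ j ∈ Finset.univ.erase i, (U i j m n t * g j m n t + V j i m n t * g i m n t)
  eq_g_other : ∀ i j m n, i ≠ j → m + n = c → ∀ t ∈ Ω,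
    t j * partialD j (g i m n) t = U i j m n t * g j m n t + V j i m n t * g i m n t

/-- The points `(θ, t)` with `t_i` nonzero and pairwise distinct at which no denominator of
`f^{(i)}_{m,n+1}`, `g^{(i)}_{m,n}` (all `i` and all `m + n = c`) vanishes. -/
def regularSet {N : ℕ} (σ : ℤ → ℤ → (Fin (N + 1) → ℂ) → (Fin (N + 1) → ℂ) → ℂ) (c : ℤ) :
    Set ((Fin (N + 1) → ℂ) × (Fin (N + 1) → ℂ)) :=
  {p | (∀ i, p.2 i ≠ 0) ∧ (∀ i j, i ≠ j → p.2 i ≠ p.2 j) ∧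
    (∀ m n, m + n = c - 1 → σ m n p.1 p.2 ≠ 0) ∧
    (∀ i m n, m + n = c → σ m n (p.1 + unitV i) p.2 ≠ 0)}

/-- `F(θ, t)` is given on `R` by a quotient of polynomials in the `2(N+1)` variables `(θ, t)`
whose denominator does not vanish on `R`. -/
def IsRationalOn {N : ℕ} (R : Set ((Fin (N + 1) → ℂ) × (Fin (N + 1) → ℂ)))
    (F : (Fin (N + 1) → ℂ) → (Fin (N + 1) → ℂ) → ℂ) : Prop :=
  ∃ P Q : MvPolynomial (Fin (N + 1) ⊕ Fin (N + 1)) ℂ, ∀ p ∈ R,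
    MvPolynomial.eval (Sum.elim p.1 p.2) Q ≠ 0 ∧
    F p.1 p.2 =
      MvPolynomial.eval (Sum.elim p.1 p.2) P / MvPolynomial.eval (Sum.elim p.1 p.2) Q

/-! ### Generating functions -/

/-! Under the power-sum substitution `exp (∑ x_k z^k)` becomes `∏ (1 - t_i z)^(-θ_i)`. Raising `θ_i`
by one therefore divides it by `1 - t_i z` (`hPow_add_unitV`), and differentiating in `t_i` gives
`θ_i z` times the series at `θ_i + 1` (`hasDerivAt_hPow`).

For determinants this reads as follows. The rows at `θ` are, up to scalars and a shift of index, the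
images of the rows at `θ + e_i` under `f ↦ f(j+1) - t_i f(j)`. By column operations, a determinant
with an extra row `t_i^j` equals the determinant of these twisted differences of the other rows
(`rowDet_geomRow_cons`). So lowering `θ_i` amounts to adjoining the row `t_i^j`, and the
`t_i`-derivative to adjoining the derivative of that row (`extDet_geomRow`, `hasDerivAt_sDet`).
Replacing `ν(m)` by `ν(m+1)` adds one element to the Maya diagram, hence one row
(`MayaDiagram.exists_charDet_frame`). All determinants in a bilinear equation then share all rows
but two, and each of the three equations is a three-term Plücker relation (`rowDet_plucker`): for
`t_i^j, t_j^j, k_b, h_a`; for its confluent form at `t_i`; and for `t_i^j`, its derivative, `t_j^j,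
h_a`. The degree equation is Euler's relation.

The differential system uses only the properties collected in `IsTauFamily`. The second bilinear
equation puts `g` in product form. The logarithmic derivative of `f` is a difference of values of
`g`, one of them at `θ + e_i`, which the first equation converts to `U` and `V`. The third equation
eliminates the derivatives of `σ` from `∂_j g` (`mul_partialD_gVar`). The diagonal equations follow
from the sum of the `g` and from their homogeneity of degree zero. The closed formulas come from `g
= V - U` and `V_{m,n} = (t_i f_i / t_j f_j) U_{m-1,n+1}`: the sum telescopes, and after `L` steps
periodicity returns `U` itself.

For density, `L`-periodicity leaves finitely many `σ`, each a rational function. None is identically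
zero: at `t = (1, …, 1)` with `∑ θ_i` not an integer, the determinant is of hypergeometric type and
can be shown nonzero (`hypergeometric_det_ne_zero`). -/

namespace PowerSeries

variable {R : Type*} [Field R] [CharZero R]

/-- A solution of a linear differential equation of first order is determined by its constant
coefficient. -/
theorem eq_zero_of_X_mul_derivative_eq {F P : PowerSeries R} (h : X * d⁄dX R F = P * F)
    (hP : constantCoeff P = 0) (h0 : constantCoeff F = 0) : F = 0 := by
  ext n
  induction n using Nat.strong_induction_on with
  | _ n ih =>
    rcases n with _ | n
    · simpa using h0
    -- In degree `n + 1` the right side vanishes, as `P` has no constant term and the lower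
    -- coefficients of `F` are zero by induction; what remains is `(n + 1) F_{n+1} = 0`.
    · have := congrArg (coeff (n + 1)) h
      rw [coeff_succ_X_mul, coeff_derivative, coeff_mul,
        Finset.sum_eq_zero] at this
      · have hn : ((n : R) + 1) ≠ 0 := by exact_mod_cast Nat.succ_ne_zero n
        simpa [hn] using this
      · rintro ⟨a, b⟩ hab
        rw [Finset.HasAntidiagonal.mem_antidiagonal] at hab
        rcases a with _ | a
        · simp [hP]
        · rw [ih b (by simp at hab; omega)]
          simp

theorem eq_of_X_mul_derivative_eq {F G P : PowerSeries R} (hF : X * d⁄dX R F = P * F)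
    (hG : X * d⁄dX R G = P * G) (hP : constantCoeff P = 0)
    (h0 : constantCoeff F = constantCoeff G) : F = G :=
  sub_eq_zero.1 (eq_zero_of_X_mul_derivative_eq (P := P)
    (by rw [map_sub, mul_sub, mul_sub, hF, hG]) hP (by simp [h0]))

end PowerSeries

open PowerSeries in
/-- The generating function `exp (∑ x_k z^k)`. -/
noncomputable def completeSeries (x : ℕ → ℂ) : PowerSeries ℂ :=
  (PowerSeries.exp ℂ).subst (PowerSeries.mk fun k => if k = 0 then 0 else x k)

section completeH

open PowerSeries

variable (x : ℕ → ℂ)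

theorem hasSubst_mk_ite : HasSubst (PowerSeries.mk fun k => if k = 0 then 0 else x k) :=
  HasSubst.of_constantCoeff_zero' (by simp)

theorem completeH_natCast (n : ℕ) : completeH x n = coeff n (completeSeries x) := by
  simp [completeH, completeSeries]

theorem completeH_of_neg {n : ℤ} (hn : n < 0) : completeH x n = 0 := by simp [completeH, hn]

theorem constantCoeff_completeSeries : constantCoeff (completeSeries x) = 1 := by
  rw [completeSeries, ← coeff_zero_eq_constantCoeff_apply, coeff_subst' (hasSubst_mk_ite x), finsum_eq_single _ 0]
  · simp
  · intro n hn
    simp [hn]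

theorem completeH_zero : completeH x 0 = 1 := by
  have := completeH_natCast x 0
  rw [Nat.cast_zero] at this
  rw [this, coeff_zero_eq_constantCoeff_apply, constantCoeff_completeSeries]

/-- The chain rule for `exp`. This first-order equation replaces the exponential in the later
arguments. -/
theorem X_mul_derivative_completeSeries :
    X * d⁄dX ℂ (completeSeries x) = PowerSeries.mk (fun k => k * x k) * completeSeries x := by
  rw [completeSeries, derivative_subst (hasSubst_mk_ite x), derivative_exp, mul_comm (subst _ _),
    ← mul_assoc]
  congr 1
  ext n
  rcases n with _ | n
  · simp
  · rw [coeff_succ_X_mul, coeff_derivative]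
    simp [mul_comm]

end completeH

/-! ### The power-sum substitution and shifts of `θ`. -/

section powerSums

open PowerSeries

variable {N : ℕ} (θ t : Fin (N + 1) → ℂ)

/-- `h_n` under the power-sum substitution. -/
noncomputable def hPow (n : ℤ) : ℂ := completeH (powerSumX θ t) n

noncomputable def hSeries : PowerSeries ℂ := completeSeries (powerSumX θ t)

/-- The coefficients are `k x_k`, so this is `z d/dz` of the logarithm of `hSeries`. -/
noncomputable def pSeries : PowerSeries ℂ :=
  PowerSeries.mk fun k => if k = 0 then 0 else ∑ i, θ i * t i ^ k

theorem powerSumY_eq : powerSumY θ t = powerSumX θ (fun i => (t i)⁻¹) := rfl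

theorem hPow_natCast (n : ℕ) : hPow θ t n = coeff n (hSeries θ t) := completeH_natCast _ n

theorem hPow_of_neg {n : ℤ} (hn : n < 0) : hPow θ t n = 0 := completeH_of_neg _ hn

theorem hPow_zero : hPow θ t 0 = 1 := completeH_zero _

theorem constantCoeff_hSeries : constantCoeff (hSeries θ t) = 1 := constantCoeff_completeSeries _

theorem constantCoeff_pSeries : constantCoeff (pSeries θ t) = 0 := by simp [pSeries]

theorem X_mul_derivative_hSeries : X * d⁄dX ℂ (hSeries θ t) = pSeries θ t * hSeries θ t := by
  rw [hSeries, X_mul_derivative_completeSeries]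
  congr 1
  ext k
  rcases k with _ | k
  · simp [pSeries]
  · have : ((k : ℂ) + 1) ≠ 0 := by exact_mod_cast Nat.succ_ne_zero k
    simp [pSeries, powerSumX]
    field_simp

/-- The shift adds `∑_{k ≥ 1} t_i^k z^k = t_i z / (1 - t_i z)`; multiplying by `1 - t_i z` avoids
inverting a series. -/
theorem pSeries_add_unitV (i : Fin (N + 1)) :
    (1 - C (t i) * X) * pSeries (θ + unitV i) t =
      (1 - C (t i) * X) * pSeries θ t + C (t i) * X := by
  have h : pSeries (θ + unitV i) t = pSeries θ t +
      PowerSeries.mk (fun k => if k = 0 then 0 else t i ^ k) := by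
    ext k
    rcases k with _ | k
    · simp [pSeries]
    · simp [pSeries, unitV, add_mul, Finset.sum_add_distrib, Pi.single_apply]
  rw [h, mul_add]
  congr 1
  ext k
  rcases k with _ | _ | k
  · simp [sub_mul, mul_assoc]
  · simp [sub_mul, mul_assoc, coeff_succ_X_mul]
  · simp [sub_mul, mul_assoc, coeff_succ_X_mul]
    ring

/-- Formally `exp (∑ t_i^k z^k / k) = 1 / (1 - t_i z)`. Both sides satisfy the same first-order
equation and have constant term 1. -/
theorem hSeries_add_unitV (i : Fin (N + 1)) :
    hSeries θ t = (1 - C (t i) * X) * hSeries (θ + unitV i) t := by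
  refine eq_of_X_mul_derivative_eq (P := pSeries θ t) (X_mul_derivative_hSeries θ t) ?_
    (constantCoeff_pSeries θ t) (by simp [constantCoeff_hSeries])
  have h1 := X_mul_derivative_hSeries (θ + unitV i) t
  have h2 := pSeries_add_unitV θ t i
  rw [Derivation.leibniz]
  simp only [map_sub, Derivation.leibniz, derivative_X, derivative_C, smul_eq_mul, mul_add,
    Derivation.map_one_eq_zero]
  linear_combination (1 - C (t i) * X) * h1 + hSeries (θ + unitV i) t * h2

theorem hPow_add_unitV (i : Fin (N + 1)) (n : ℤ) :
    hPow θ t n = hPow (θ + unitV i) t n - t i * hPow (θ + unitV i) t (n - 1) := by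
  rcases lt_or_ge n 0 with hn | hn
  · simp [hPow_of_neg _ _ hn, hPow_of_neg _ _ (show n - 1 < 0 by omega)]
  lift n to ℕ using hn
  rcases n with _ | n
  · have : ((0 : ℕ) : ℤ) - 1 < 0 := by simp
    rw [hPow_of_neg _ _ this, Nat.cast_zero, hPow_zero, hPow_zero]
    simp
  · have : (((n + 1 : ℕ) : ℤ) - 1) = n := by simp
    rw [this, hPow_natCast, hPow_natCast, hPow_natCast, hSeries_add_unitV θ t i, sub_mul, mul_assoc]
    simp [coeff_succ_X_mul]

/-- Newton's identity. -/
theorem hPow_recursion (n : ℕ) :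
    ((n : ℂ) + 1) * hPow θ t ((n + 1 : ℕ) : ℤ) =
      ∑ k ∈ Finset.range (n + 1), (∑ i, θ i * t i ^ (k + 1)) * hPow θ t ((n - k : ℕ) : ℤ) := by
  have := congrArg (coeff (n + 1)) (X_mul_derivative_hSeries θ t)
  rw [coeff_succ_X_mul, coeff_derivative, coeff_mul, Finset.Nat.sum_antidiagonal_succ] at this
  simp only [hPow_natCast]
  rw [mul_comm, this, Finset.Nat.sum_antidiagonal_eq_sum_range_succ_mk]
  simp [pSeries]

end powerSums

/-! ### Derivatives, homogeneity and the specialization `t = (1, …, 1)`. -/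

section powerSumsCalculus

open PowerSeries

variable {N : ℕ} (θ t : Fin (N + 1) → ℂ)

/-- Newton's identity builds every `h_n` from `0`, `1`, power sums and earlier `h_k`, so a property
preserved by that formula propagates to all `n`. -/
theorem induction_hPow {p : ((Fin (N + 1) → ℂ) → ℂ) → Prop} (h0 : p fun _ => 0) (h1 : p fun _ => 1)
    (hstep : ∀ n : ℕ, (∀ k ≤ n, p fun t => hPow θ t (k : ℕ)) →
      p fun t => ((n : ℂ) + 1)⁻¹ * ∑ k ∈ Finset.range (n + 1),
        (∑ i, θ i * t i ^ (k + 1)) * hPow θ t ((n - k : ℕ) : ℤ)) (n : ℤ) :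
    p fun t => hPow θ t n := by
  rcases lt_or_ge n 0 with hn | hn
  · simpa only [hPow_of_neg _ _ hn] using h0
  lift n to ℕ using hn
  induction n using Nat.strong_induction_on with
  | _ n ih =>
    rcases n with _ | n
    · simpa only [Nat.cast_zero, hPow_zero] using h1
    · convert hstep n fun k hk => ih k (by omega) using 2 with t
      rw [← hPow_recursion, inv_mul_cancel_left₀ (by exact_mod_cast Nat.succ_ne_zero n)]

theorem differentiable_hPow (n : ℤ) : Differentiable ℂ fun t => hPow θ t n := by
  refine induction_hPow θ (by fun_prop) (by fun_prop) (fun n ih => ?_) n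
  refine Differentiable.const_mul (Differentiable.fun_sum fun k hk => ?_) _
  exact Differentiable.mul (by fun_prop) (ih _ (by omega))

theorem hPow_smul (c : ℂ) (n : ℕ) : hPow θ (c • t) n = c ^ n * hPow θ t n := by
  induction n using Nat.strong_induction_on with
  | _ n ih =>
    rcases n with _ | n
    · simp [hPow_zero]
    · have hn : (n : ℂ) + 1 ≠ 0 := by exact_mod_cast Nat.succ_ne_zero n
      apply mul_left_cancel₀ hn
      rw [hPow_recursion, mul_left_comm, hPow_recursion, Finset.mul_sum]
      refine Finset.sum_congr rfl fun k hk => ?_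
      rw [Finset.mem_range] at hk
      rw [ih (n - k) (by omega), ← mul_assoc, ← mul_assoc, Finset.sum_mul, Finset.mul_sum]
      congr 1
      refine Finset.sum_congr rfl fun i _ => ?_
      rw [show n + 1 = (n - k) + (k + 1) by omega, pow_add]
      simp [mul_pow]
      ring

theorem hPow_smul_zpow {c : ℂ} (n : ℤ) : hPow θ (c • t) n = c ^ n * hPow θ t n := by
  rcases lt_or_ge n 0 with hn | hn
  · simp [hPow_of_neg _ _ hn]
  lift n to ℕ using hn
  rw [hPow_smul, zpow_natCast]

/-- At this point the generating function is `(1 - z)^(-Θ)` with `Θ = ∑ θ_i`. The recursion extends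
to negative `n` because at `n = -1`, the only delicate case, the factor `n + 1` kills `h_0`. -/
theorem hPow_one_recursion (n : ℤ) :
    ((n : ℂ) + 1) * hPow θ 1 (n + 1) = (∑ i, θ i + n) * hPow θ 1 n := by
  rcases lt_or_ge n 0 with hn | hn
  · rw [hPow_of_neg _ _ hn]
    rcases eq_or_ne n (-1) with rfl | hn'
    · simp
    · rw [hPow_of_neg _ _ (show n + 1 < 0 by omega)]
      simp
  lift n to ℕ using hn
  have hP : (1 - X) * pSeries θ 1 = C (∑ i, θ i) * X := by
    ext k
    rcases k with _ | _ | k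
    · simp [sub_mul, pSeries]
    · simp [sub_mul, coeff_succ_X_mul, pSeries]
    · simp [sub_mul, coeff_succ_X_mul, pSeries]
  have h := congrArg (coeff (n + 1)) (show X * d⁄dX ℂ (hSeries θ 1) - X * (X * d⁄dX ℂ (hSeries θ 1))
      = X * (C (∑ i, θ i) * hSeries θ 1) by
    linear_combination (1 - X) * X_mul_derivative_hSeries θ 1 + hSeries θ 1 * hP)
  rw [map_sub, coeff_succ_X_mul, coeff_succ_X_mul, coeff_succ_X_mul, coeff_derivative] at h
  have h2 : coeff n (X * d⁄dX ℂ (hSeries θ 1)) = n * coeff n (hSeries θ 1) := by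
    rcases n with _ | n
    · simp
    · rw [coeff_succ_X_mul, coeff_derivative]
      push_cast
      ring
  rw [h2, coeff_C_mul] at h
  rw [show ((n : ℤ) + 1) = ((n + 1 : ℕ) : ℤ) by simp, hPow_natCast, hPow_natCast]
  push_cast
  linear_combination h

/-- Formally `∂_i log H = θ_i z / (1 - t_i z)`, and `H / (1 - t_i z)` is the series at `θ + e_i`.
The argument avoids differentiating a power series in a parameter: the series `D` of coefficientwise
derivatives is identified through the equation it satisfies. -/
theorem hasDerivAt_hPow (i : Fin (N + 1)) (n : ℤ) :
    HasDerivAt (fun s => hPow θ (Function.update t i s) n)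
      (θ i * hPow (θ + unitV i) t (n - 1)) (t i) := by
  have hd : ∀ n : ℤ, DifferentiableAt ℂ (fun s => hPow θ (Function.update t i s) n) (t i) :=
    fun n => (differentiable_hPow θ n).differentiableAt.comp (t i)
      (hasDerivAt_update t i (t i)).differentiableAt
  rcases lt_or_ge n 0 with hn | hn
  · simpa [hPow_of_neg _ _ hn, hPow_of_neg _ _ (show n - 1 < 0 by omega)] using
      hasDerivAt_const (t i) (0 : ℂ)
  lift n to ℕ using hn
  set D : PowerSeries ℂ :=
    PowerSeries.mk fun n => deriv (fun s => hPow θ (Function.update t i s) n) (t i) with hD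
  have hDn : ∀ n : ℕ, HasDerivAt (fun s => hPow θ (Function.update t i s) n) (coeff n D) (t i) :=
    fun n => by simpa [hD] using (hd n).hasDerivAt
  set P' : PowerSeries ℂ := PowerSeries.mk fun k => θ i * (k * t i ^ (k - 1)) with hP'
  have hp : ∀ k : ℕ, HasDerivAt (fun s => ∑ l, θ l * Function.update t i s l ^ (k + 1))
      (coeff (k + 1) P') (t i) := by
    intro k
    have : HasDerivAt (fun s => ∑ l, θ l * Function.update t i s l ^ (k + 1))
        (∑ l, if l = i then θ l * (((k + 1 : ℕ) : ℂ) * t i ^ k) else 0) (t i) := by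
      refine HasDerivAt.fun_sum fun l _ => ?_
      split_ifs with h
      · subst h
        simpa using (hasDerivAt_pow (k + 1) (t l)).const_mul (θ l)
      · simpa [Function.update_of_ne h] using hasDerivAt_const (t i) (θ l * t l ^ (k + 1))
    simpa [hP'] using this
  -- Newton's identity differentiated in `t_i`; `P'` is the derivative of `pSeries`.
  have h1 : X * d⁄dX ℂ D = P' * hSeries θ t + pSeries θ t * D := by
    ext n
    rcases n with _ | n
    · simp [hP', pSeries]
    have e1 : HasDerivAt (fun s => ((n : ℂ) + 1) * hPow θ (Function.update t i s) ((n + 1 : ℕ) : ℤ))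
        (((n : ℂ) + 1) * coeff (n + 1) D) (t i) := (hDn (n + 1)).const_mul _
    have e2 : HasDerivAt (fun s => ((n : ℂ) + 1) * hPow θ (Function.update t i s) ((n + 1 : ℕ) : ℤ))
        (∑ k ∈ Finset.range (n + 1), (coeff (k + 1) P' * hPow θ t ((n - k : ℕ) : ℤ)
          + (∑ i, θ i * t i ^ (k + 1)) * coeff (n - k) D)) (t i) := by
      simp only [hPow_recursion]
      refine HasDerivAt.fun_sum fun k _ => ?_
      simpa using (hp k).fun_mul (hDn (n - k))
    have e3 := e1.unique e2
    rw [coeff_succ_X_mul, coeff_derivative, mul_comm, e3, map_add, coeff_mul, coeff_mul,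
      Finset.Nat.sum_antidiagonal_succ, Finset.Nat.sum_antidiagonal_succ, Finset.sum_add_distrib,
      Finset.Nat.sum_antidiagonal_eq_sum_range_succ_mk, Finset.Nat.sum_antidiagonal_eq_sum_range_succ_mk]
    simp only [hPow_natCast]
    simp [pSeries, hP']
  set G := hSeries (θ + unitV i) t with hG
  have hP2 : (1 - C (t i) * X) ^ 2 * P' = C (θ i) * X := by
    have e : (1 - C (t i) * X) * P' = C (θ i) * PowerSeries.mk (fun k => if k = 0 then 0 else t i ^ (k - 1)) := by
      ext k
      rcases k with _ | _ | k
      · simp [hP', sub_mul, mul_assoc]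
      · simp [hP', sub_mul, mul_assoc, coeff_succ_X_mul]
      · simp [hP', sub_mul, mul_assoc, coeff_succ_X_mul]
        ring
    rw [sq, mul_assoc, e, mul_left_comm]
    congr 1
    ext k
    rcases k with _ | _ | k
    · simp [sub_mul, mul_assoc]
    · simp [sub_mul, mul_assoc, coeff_succ_X_mul]
    · simp [sub_mul, mul_assoc, coeff_succ_X_mul, coeff_X]
      ring
  have hne : (1 - C (t i) * X : PowerSeries ℂ) ≠ 0 := by
    intro h
    simpa using congrArg constantCoeff h
  -- The candidate solves the same inhomogeneous equation as `D`, so their difference solves the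
  -- homogeneous one with zero constant term.
  have h2 : X * d⁄dX ℂ (C (θ i) * (X * G)) = P' * hSeries θ t + pSeries θ t * (C (θ i) * (X * G)) := by
    apply mul_left_cancel₀ hne
    have e1 := X_mul_derivative_hSeries (θ + unitV i) t
    have e2 := pSeries_add_unitV θ t i
    rw [hSeries_add_unitV θ t i]
    simp only [Derivation.leibniz, derivative_X, derivative_C, smul_eq_mul, mul_zero, add_zero]
    rw [← hG] at e1 ⊢
    linear_combination (1 - C (t i) * X) * C (θ i) * X * e1 - G * hP2 + C (θ i) * X * G * e2
  have h3 : D - C (θ i) * (X * G) = 0 := by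
    refine eq_zero_of_X_mul_derivative_eq (P := pSeries θ t) ?_ (constantCoeff_pSeries θ t) ?_
    · rw [map_sub, mul_sub, h1, h2]
      ring
    · simp [hD, hPow_zero]
  convert hDn n using 1
  rw [sub_eq_zero.1 h3, coeff_C_mul]
  congr 1
  rcases n with _ | n
  · rw [hPow_of_neg _ _ (by simp)]
    simp
  · rw [coeff_succ_X_mul, hG, ← hPow_natCast]
    congr 1
    simp

end powerSumsCalculus

/-! ### Determinants of lists of rows -/

section rowDet

variable {R : Type*} [CommRing R]

/-- The determinant whose rows are the initial segments of a list of sequences. -/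
def rowDet (l : List (ℕ → R)) : R :=
  Matrix.det (Matrix.of fun i j : Fin l.length => l.getD i 0 j)

theorem rowDet_eq {l : List (ℕ → R)} {n : ℕ} (h : l.length = n) :
    rowDet l = Matrix.det (Matrix.of fun i j : Fin n => l.getD i 0 j) := by
  subst h
  rfl

theorem rowDet_swap (P Q : List (ℕ → R)) (a b : ℕ → R) :
    rowDet (P ++ a :: b :: Q) = -rowDet (P ++ b :: a :: Q) := by
  have h1 : (P ++ a :: b :: Q).length = P.length + Q.length + 2 := by simp; omega
  have h2 : (P ++ b :: a :: Q).length = P.length + Q.length + 2 := by simp; omega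
  rw [rowDet_eq h1, rowDet_eq h2]
  set p : Fin (P.length + Q.length + 2) := ⟨P.length, by omega⟩ with hp
  set q : Fin (P.length + Q.length + 2) := ⟨P.length + 1, by omega⟩ with hq
  have hpq : p ≠ q := by simp [hp, hq]
  have := Matrix.det_permute (Equiv.swap p q)
    (Matrix.of fun i j : Fin (P.length + Q.length + 2) => (P ++ b :: a :: Q).getD i 0 j)
  rw [Equiv.Perm.sign_swap hpq] at this
  simp only [Units.val_neg, Units.val_one, Int.cast_neg, Int.cast_one, neg_mul, one_mul] at this
  rw [← this]
  congr 1
  ext i j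
  simp only [Matrix.submatrix_apply, Matrix.of_apply, id]
  rcases eq_or_ne i p with rfl | hip
  · rw [Equiv.swap_apply_left]
    simp [hp, hq]
  rcases eq_or_ne i q with rfl | hiq
  · rw [Equiv.swap_apply_right]
    simp [hp, hq]
  rw [Equiv.swap_apply_of_ne_of_ne hip hiq]
  have h3 : (i : ℕ) ≠ P.length := fun h => hip (Fin.ext h)
  have h4 : (i : ℕ) ≠ P.length + 1 := fun h => hiq (Fin.ext h)
  rcases lt_or_ge (i : ℕ) P.length with h | h
  · simp [List.getElem?_append_left h]
  · obtain ⟨k, hk⟩ : ∃ k, (i : ℕ) = P.length + (k + 2) := ⟨i - P.length - 2, by omega⟩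
    simp [hk, List.getElem?_append_right]

-- Let `B` have rows `a`, `b` at `p`, `q`. Cramer's rule writes `det B • c` as a combination of the
-- rows of `B`. Apply the linear form `x ↦ det` with `x` at `p` and `d` at `q`: every row other than
-- `p`, `q` contributes a determinant with a repeated row, and two terms survive.
open Matrix in
theorem Matrix.det_updateRow_updateRow_plucker {n : Type*} [Fintype n] [DecidableEq n]
    (A : Matrix n n R) {p q : n} (hpq : p ≠ q) (a b c d : n → R) :
    ((A.updateRow p a).updateRow q b).det * ((A.updateRow p c).updateRow q d).det =
      ((A.updateRow p c).updateRow q b).det * ((A.updateRow p a).updateRow q d).det +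
        ((A.updateRow p a).updateRow q c).det * ((A.updateRow p b).updateRow q d).det := by
  set B := (A.updateRow p a).updateRow q b with hB
  have hlin : ∀ x, ((A.updateRow p x).updateRow q d).det = cramer (A.updateRow q d)ᵀ x p := by
    intro x
    rw [cramer_transpose_apply, updateRow_comm _ hpq]
  have h := mulVec_cramer Bᵀ c
  have h2 := congrArg (fun x => cramer (A.updateRow q d)ᵀ x p) h
  have hsum : Bᵀ *ᵥ cramer Bᵀ c = ∑ i, (B.updateRow i c).det • B i := by
    ext j
    simp only [mulVec, dotProduct, transpose_apply, Finset.sum_apply, Pi.smul_apply, smul_eq_mul,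
      cramer_transpose_apply]
    exact Finset.sum_congr rfl fun i _ => mul_comm _ _
  simp only [hsum, map_sum, Finset.sum_apply, map_smul, Pi.smul_apply, smul_eq_mul,
    det_transpose] at h2
  simp only [← hlin] at h2
  rw [← h2, ← Finset.add_sum_erase _ _ (Finset.mem_univ p),
    ← Finset.add_sum_erase _ _ (Finset.mem_erase.2 ⟨hpq.symm, Finset.mem_univ q⟩),
    Finset.sum_eq_zero, add_zero]
  · have e1 : B p = a := by simp [hB, updateRow_ne hpq]
    have e2 : B q = b := by simp [hB]
    have e3 : B.updateRow p c = (A.updateRow p c).updateRow q b := by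
      rw [hB, updateRow_comm _ hpq.symm, updateRow_idem]
    have e4 : B.updateRow q c = (A.updateRow p a).updateRow q c := by
      rw [hB, updateRow_idem]
    rw [e1, e2, e3, e4]
  · intro i hi
    simp only [Finset.mem_erase, Finset.mem_univ, and_true] at hi
    have e1 : B i = A i := by
      rw [hB, updateRow_ne hi.1, updateRow_ne hi.2]
    have e2 : ((A.updateRow p (A i)).updateRow q d).det = 0 :=
      det_zero_of_row_eq hi.2 (by
        rw [updateRow_ne hpq, updateRow_self, updateRow_ne hi.1, updateRow_ne hi.2])
    rw [e1, e2, mul_zero]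

/-- The single algebraic identity behind all three bilinear equations. -/
theorem rowDet_plucker (P Q : List (ℕ → R)) (a b c d : ℕ → R) :
    rowDet (P ++ a :: b :: Q) * rowDet (P ++ c :: d :: Q)
      - rowDet (P ++ a :: c :: Q) * rowDet (P ++ b :: d :: Q)
      + rowDet (P ++ a :: d :: Q) * rowDet (P ++ b :: c :: Q) = 0 := by
  have hlen : ∀ a b : ℕ → R, (P ++ a :: b :: Q).length = P.length + Q.length + 2 := by
    intro a b; simp; omega
  set n := P.length + Q.length + 2 with hn
  set p : Fin n := ⟨P.length, by omega⟩ with hp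
  set q : Fin n := ⟨P.length + 1, by omega⟩ with hq
  have hpq : p ≠ q := by simp [hp, hq]
  set A : Matrix (Fin n) (Fin n) R :=
    Matrix.of fun i j : Fin n => (P ++ 0 :: 0 :: Q).getD i 0 j with hA
  have key : ∀ a b : ℕ → R, rowDet (P ++ a :: b :: Q) =
      ((A.updateRow p fun j => a j).updateRow q fun j => b j).det := by
    intro a b
    rw [rowDet_eq (hlen a b)]
    congr 1
    ext i j
    rcases eq_or_ne i q with rfl | hiq
    · simp [hq]
    rcases eq_or_ne i p with rfl | hip
    · rw [Matrix.updateRow_ne hiq, Matrix.updateRow_self]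
      simp [hp]
    rw [Matrix.updateRow_ne hiq, Matrix.updateRow_ne hip]
    simp only [hA, Matrix.of_apply]
    have h3 : (i : ℕ) ≠ P.length := fun h => hip (Fin.ext h)
    have h4 : (i : ℕ) ≠ P.length + 1 := fun h => hiq (Fin.ext h)
    rcases lt_or_ge (i : ℕ) P.length with h | h
    · simp [List.getElem?_append_left h]
    · obtain ⟨k, hk⟩ : ∃ k, (i : ℕ) = P.length + (k + 2) := ⟨i - P.length - 2, by omega⟩
      simp [hk, List.getElem?_append_right]
  have h := A.det_updateRow_updateRow_plucker hpq (fun j => a j) (fun j => b j) (fun j => c j)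
    (fun j => d j)
  simp only [← key] at h
  rw [h, rowDet_swap P Q c b]
  ring

theorem rowDet_move (X P Q : List (ℕ → R)) (a : ℕ → R) :
    rowDet (X ++ (P ++ a :: Q)) = (-1) ^ P.length * rowDet (X ++ a :: (P ++ Q)) := by
  induction P generalizing X with
  | nil => simp
  | cons p P ih =>
    have := ih (X ++ [p])
    simp only [List.append_assoc, List.cons_append, List.nil_append] at this ⊢
    rw [this, rowDet_swap, List.length_cons, pow_succ]
    ring

theorem rowDet_smul_append (c : R) (P Q : List (ℕ → R)) :
    rowDet (P.map (c • ·) ++ Q) = c ^ P.length * rowDet (P ++ Q) := by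
  have h1 : (P.map (c • ·) ++ Q).length = P.length + Q.length := by simp
  have h2 : (P ++ Q).length = P.length + Q.length := by simp
  rw [rowDet_eq h1, rowDet_eq h2]
  have := Matrix.det_mul_column (fun i : Fin (P.length + Q.length) => if (i : ℕ) < P.length then c else 1)
    (Matrix.of fun i j => (P ++ Q).getD i 0 j)
  convert this using 2
  · ext i j
    simp only [Matrix.of_apply]
    split_ifs with h
    · simp [h]
    · rw [not_lt] at h
      simp [h]
  · rw [Finset.prod_ite]
    simp only [Finset.prod_const, one_pow, mul_one]
    congr 1
    rw [← Fintype.card_subtype, Fintype.card_congr (Fin.castLEquiv (n := P.length) (by omega)).symm]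
    simp

/-- Rows that agree up to order give determinants that agree up to sign. -/
theorem List.Perm.exists_rowDet_eq {α : Type*} {l l' : List α} (h : l.Perm l') :
    ∃ ε : R, ε * ε = 1 ∧ ∀ (P Q : List (ℕ → R)) (row : α → ℕ → R),
      rowDet (P ++ (l.map row ++ Q)) = ε * rowDet (P ++ (l'.map row ++ Q)) := by
  induction h with
  | nil => exact ⟨1, by simp, by simp⟩
  | cons x _ ih =>
    obtain ⟨ε, h1, h2⟩ := ih
    refine ⟨ε, h1, fun P Q row => ?_⟩
    simpa using h2 (P ++ [row x]) Q row
  | swap x y l =>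
    refine ⟨-1, by simp, fun P Q row => ?_⟩
    simp only [List.map_cons, List.cons_append]
    rw [rowDet_swap]
    ring
  | trans _ _ ih1 ih2 =>
    obtain ⟨ε, h1, h2⟩ := ih1
    obtain ⟨ε', h1', h2'⟩ := ih2
    refine ⟨ε * ε', by linear_combination ε' * ε' * h1 + h1', fun P Q row => ?_⟩
    rw [h2, h2', mul_assoc]

/-- The geometric sequence. -/
def geomRow (t : R) (j : ℕ) : R := t ^ j

/-- The derivative of the geometric sequence in its parameter. -/
def geomRow' (t : R) (j : ℕ) : R := j * t ^ (j - 1)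

/-- The twisted difference operator on sequences. -/
def twistDiff (t : R) (f : ℕ → R) (j : ℕ) : R := f (j + 1) - t * f j

/-- Subtracting `t` times each column from the next turns the geometric row into `(1, 0, …, 0)` and
the other rows, past the first column, into their twisted differences; then expand along the first
row. -/
theorem rowDet_geomRow_cons (t : R) (l : List (ℕ → R)) :
    rowDet (geomRow t :: l) = rowDet (l.map (twistDiff t)) := by
  have h1 : (geomRow t :: l).length = l.length + 1 := by simp
  have h2 : (l.map (twistDiff t)).length = l.length := by simp
  rw [rowDet_eq h1, rowDet_eq h2]
  rw [Matrix.det_eq_of_forall_col_eq_smul_add_pred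
    (B := Matrix.of fun i j : Fin (l.length + 1) => Fin.cases ((geomRow t :: l).getD i 0 0)
      (fun k => twistDiff t ((geomRow t :: l).getD i 0) k) j) (c := fun _ => t)]
  · rw [Matrix.det_succ_row_zero, Finset.sum_eq_single 0]
    · simp only [Fin.val_zero, pow_zero, one_mul, Matrix.of_apply, List.getD_cons_zero, Fin.cases_zero,
        geomRow]
      congr 1
      ext i j
      simp [Fin.succAbove_zero]
    · intro j _ hj
      obtain ⟨k, rfl⟩ := Fin.exists_succ_eq.2 hj
      simp [twistDiff, geomRow, pow_succ, mul_comm]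
    · simp
  · intro i
    simp
  · intro i j
    simp [twistDiff]

theorem rowDet_append_geomRow_cons (t : R) (P Q : List (ℕ → R)) :
    rowDet (P ++ geomRow t :: Q) =
      (-1) ^ P.length * rowDet (P.map (twistDiff t) ++ Q.map (twistDiff t)) := by
  have := rowDet_move [] P Q (geomRow t)
  simp only [List.nil_append] at this
  rw [this, rowDet_geomRow_cons, List.map_append]

theorem twistDiff_geomRow (t s : R) : twistDiff t (geomRow s) = (s - t) • geomRow s := by
  ext j
  simp only [twistDiff, geomRow, Pi.smul_apply, smul_eq_mul, pow_succ]
  ring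

/-- The `s`-derivative of `twistDiff_geomRow`. At `s = t` only the geometric row survives, which is
what makes the confluent Plücker relations usable. -/
theorem twistDiff_geomRow' (t s : R) :
    twistDiff t (geomRow' s) = geomRow s + (s - t) • geomRow' s := by
  ext j
  rcases j with _ | j
  · simp [twistDiff, geomRow, geomRow']
  · simp [twistDiff, geomRow, geomRow', pow_succ]
    ring

/-- If the last row is `0, …, 0, 1`, then the last row and column may be deleted. -/
theorem rowDet_concat (l : List (ℕ → R)) (r : ℕ → R) (h0 : ∀ j < l.length, r j = 0)
    (h1 : r l.length = 1) : rowDet (l ++ [r]) = rowDet l := by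
  have hl : (l ++ [r]).length = l.length + 1 := by simp
  rw [rowDet_eq hl, rowDet, Matrix.det_succ_row _ (Fin.last _), Finset.sum_eq_single (Fin.last _)]
  · simp only [Matrix.of_apply, Fin.val_last]
    rw [← two_mul, pow_mul]
    simp only [even_two, Even.neg_pow, one_pow, one_mul]
    rw [show (l ++ [r]).getD l.length 0 = r by simp, h1, one_mul]
    congr 1
    ext i j
    simp
  · intro j _ hj
    have hj' : (j : ℕ) < l.length := Fin.val_lt_last hj
    simp [h0 j hj']
  · simp

end rowDet

/-! ### Universal characters with any number of rows -/

section charDet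

variable {R : Type*} [CommRing R]

def kRow (k : ℤ → R) (b : ℤ) (j : ℕ) : R := k (b - j)

def hRow (h : ℤ → R) (a : ℤ) (j : ℕ) : R := h (a + j)

/-- The twisted Jacobi-Trudi determinant with row indices `B` (for `k`) and `A` (for `h`). -/
def charDet (h k : ℤ → R) (A B : List ℤ) : R := rowDet (B.map (kRow k) ++ A.map (hRow h))

/-- The appended index puts `h 0 = 1` in the last column and negative indices before it. This is
what appending a zero part to the first partition does. -/
theorem charDet_concat {h : ℤ → R} (k : ℤ → R) (h0 : h 0 = 1) (hneg : ∀ n < 0, h n = 0)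
    (A B : List ℤ) : charDet h k (A ++ [-((A.length : ℤ) + B.length)]) B = charDet h k A B := by
  rw [charDet, List.map_append, ← List.append_assoc, List.map_singleton, rowDet_concat, charDet]
  · intro j hj
    simp only [List.length_append, List.length_map] at hj
    exact hneg _ (by omega)
  · rw [hRow, ← h0]
    congr 1
    simp only [List.length_append, List.length_map]
    push_cast
    ring

/-- With index `0` the row is `(1, 0, 0, …)`, a geometric row of ratio `0`, and the twisted
difference for ratio `0` is the plain shift. This is what a zero part of the second partition does.
-/
theorem charDet_cons (h : ℤ → R) {k : ℤ → R} (k0 : k 0 = 1) (kneg : ∀ n < 0, k n = 0)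
    (A B : List ℤ) :
    charDet h k A (0 :: B) = charDet h k (A.map (· + 1)) (B.map (· - 1)) := by
  have h1 : kRow k 0 = geomRow 0 := by
    ext j
    rcases j with _ | j
    · simp [kRow, geomRow, k0]
    · simp only [kRow, geomRow]
      rw [kneg _ (by omega)]
      simp
  rw [charDet, List.map_cons, List.cons_append, h1, rowDet_geomRow_cons, charDet, List.map_append]
  congr 2
  · simp only [List.map_map]
    refine List.map_congr_left fun b _ => ?_
    ext j
    simp only [Function.comp_apply, twistDiff, kRow, zero_mul, sub_zero]
    congr 1
    push_cast
    ring
  · simp only [List.map_map]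
    refine List.map_congr_left fun b _ => ?_
    ext j
    simp only [Function.comp_apply, twistDiff, hRow, zero_mul, sub_zero]
    congr 1
    push_cast
    ring

end charDet

theorem YoungDiagram.rowLen_eq_zero (lam : YoungDiagram) {r : ℕ} (h : lam.colLen 0 ≤ r) :
    lam.rowLen r = 0 := by
  by_contra h0
  have h1 : (r, 0) ∈ lam := YoungDiagram.mem_iff_lt_rowLen.2 (Nat.pos_of_ne_zero h0)
  exact absurd (YoungDiagram.mem_iff_lt_colLen.1 h1) (not_lt.2 h)

theorem YoungDiagram.colLen_zero_le (lam : YoungDiagram) {r : ℕ} (h : lam.rowLen r = 0) :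
    lam.colLen 0 ≤ r := by
  by_contra! h0
  have h1 := YoungDiagram.mem_iff_lt_rowLen.1 (YoungDiagram.mem_iff_lt_colLen.2 h0)
  omega

section universalCharacter

variable (lam mu : YoungDiagram) (x y : ℕ → ℂ)

theorem universalCharacter_eq_charDet_colLen :
    universalCharacter lam mu x y = charDet (completeH x) (completeH y)
      ((List.range (lam.colLen 0)).map fun r => (lam.rowLen r : ℤ) - r - mu.colLen 0)
      ((List.range (mu.colLen 0)).reverse.map fun r => (mu.rowLen r : ℤ) - r + mu.colLen 0 - 1) := by
  rw [charDet, rowDet_eq (n := mu.colLen 0 + lam.colLen 0) (by simp), universalCharacter]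
  congr 1
  ext i j
  simp only [Matrix.of_apply]
  split_ifs with h
  · simp only [List.getD_eq_getElem?_getD, List.map_map]
    rw [List.getElem?_append_left (by simpa using h), List.getElem?_map, List.getElem?_reverse
      (by simpa using h)]
    simp only [List.length_range]
    rw [List.getElem?_range (by omega)]
    simp only [Option.map_some, Function.comp_apply, Option.getD_some, kRow]
    congr 1
    omega
  · rw [not_lt] at h
    have hi := i.2
    simp only [List.getD_eq_getElem?_getD, List.map_map]
    rw [List.getElem?_append_right (by simpa using h), List.getElem?_map]
    simp only [List.length_map, List.length_reverse, List.length_range]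
    rw [List.getElem?_range (by omega)]
    simp only [Option.map_some, Function.comp_apply, Option.getD_some, hRow]
    congr 1
    omega

/-- Padding by zero parts lets characters of partitions of different lengths be compared as
determinants with common rows. -/
theorem universalCharacter_eq_charDet {p q : ℕ} (hp : lam.colLen 0 ≤ p) (hq : mu.colLen 0 ≤ q) :
    universalCharacter lam mu x y = charDet (completeH x) (completeH y)
      ((List.range p).map fun r => (lam.rowLen r : ℤ) - r - q)
      ((List.range q).reverse.map fun r => (mu.rowLen r : ℤ) - r + q - 1) := by
  induction q, hq using Nat.le_induction with
  | base =>
    induction p, hp using Nat.le_induction with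
    | base => exact universalCharacter_eq_charDet_colLen lam mu x y
    | succ p hp ih =>
      rw [ih, List.range_succ, List.map_append, List.map_singleton, lam.rowLen_eq_zero hp]
      rw [← charDet_concat (completeH y) (completeH_zero x) fun n hn => completeH_of_neg x hn]
      congr 3
      simp
      ring
  | succ q hq ih =>
    rw [ih, List.range_succ, List.reverse_append, List.reverse_singleton, List.singleton_append,
      List.map_cons, mu.rowLen_eq_zero hq]
    rw [show ((0 : ℕ) : ℤ) - q + (q + 1 : ℕ) - 1 = 0 by push_cast; ring,
      charDet_cons _ (completeH_zero y) fun n hn => completeH_of_neg y hn]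
    simp only [List.map_map]
    congr 1
    · refine List.map_congr_left fun r _ => ?_
      simp only [Function.comp_apply]
      push_cast
      ring
    · refine List.map_congr_left fun r _ => ?_
      simp only [Function.comp_apply]
      push_cast
      ring

end universalCharacter

/-! ### Adding an element to a Maya diagram -/

namespace MayaDiagram

/-- The charge of a Maya diagram. -/
noncomputable def charge (m : MayaDiagram) : ℤ := m.elt 0 - m.part 0

theorem elt_eq (m : MayaDiagram) (r : ℕ) : m.elt r = m.part r - r + m.charge := by
  induction r with
  | zero => simp [charge]
  | succ r ih =>
    have := m.elt_sub_elt r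
    push_cast
    omega

theorem mem_iff_exists_elt (m : MayaDiagram) {k : ℤ} : k ∈ m.carrier ↔ ∃ i, m.elt i = k :=
  ⟨m.exists_elt_eq, fun ⟨i, hi⟩ => hi ▸ m.elt_mem i⟩

theorem mem_map_elt (m : MayaDiagram) {p : ℕ} {k : ℤ} :
    k ∈ (List.range p).map m.elt ↔ k ∈ m.carrier ∧ m.elt p < k := by
  simp only [List.mem_map, List.mem_range, mem_iff_exists_elt]
  constructor
  · rintro ⟨i, hi, rfl⟩
    exact ⟨⟨i, rfl⟩, m.elt_strictAnti hi⟩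
  · rintro ⟨⟨i, rfl⟩, h⟩
    exact ⟨i, m.elt_strictAnti.lt_iff_gt.1 h, rfl⟩

theorem nodup_map_elt (m : MayaDiagram) (p : ℕ) : ((List.range p).map m.elt).Nodup :=
  List.nodup_range.map m.elt_strictAnti.injective

theorem exists_elt_lt (m : MayaDiagram) (k : ℤ) : ∃ p, ∀ r ≥ p, m.elt r < k := by
  refine ⟨(m.elt 0 - k + 1).toNat, fun r hr => ?_⟩
  have := m.elt_le r
  omega

variable {m m' : MayaDiagram} {e : ℤ}

/-- The element `m.elt p` lies below `e`, so it also belongs to `m'`. The elements of `m'` above it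
are those of `m` together with `e`, and counting them locates its index in `m'`. -/
theorem perm_of_carrier_eq_insert (h : m'.carrier = insert e m.carrier) (he : e ∉ m.carrier) {p : ℕ}
    (hp : m.elt p < e) :
    ((List.range (p + 1)).map m'.elt).Perm (e :: (List.range p).map m.elt) ∧
      m'.elt (p + 1) = m.elt p := by
  obtain ⟨p', hp'⟩ : ∃ p', m'.elt p' = m.elt p :=
    m'.exists_elt_eq (by rw [h]; exact Set.mem_insert_of_mem _ (m.elt_mem p))
  have hperm : ((List.range p').map m'.elt).Perm (e :: (List.range p).map m.elt) := by
    refine (List.perm_ext_iff_of_nodup (m'.nodup_map_elt p') ?_).2 fun k => ?_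
    · refine List.nodup_cons.2 ⟨fun h' => he (m.mem_map_elt.1 h').1, m.nodup_map_elt p⟩
    · rw [mem_map_elt, List.mem_cons, mem_map_elt, hp', h, Set.mem_insert_iff]
      constructor
      · rintro ⟨rfl | h1, h2⟩
        · exact Or.inl rfl
        · exact Or.inr ⟨h1, h2⟩
      · rintro (rfl | ⟨h1, h2⟩)
        · exact ⟨Or.inl rfl, hp⟩
        · exact ⟨Or.inr h1, h2⟩
  have hlen := hperm.length_eq
  simp only [List.length_map, List.length_range, List.length_cons] at hlen
  subst hlen
  exact ⟨hperm, hp'⟩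

theorem exists_forall_perm (h : m'.carrier = insert e m.carrier) (he : e ∉ m.carrier) :
    ∃ p : ℕ, m.part p = 0 ∧ m'.part (p + 1) = 0 ∧
      ((List.range (p + 1)).map m'.elt).Perm (e :: (List.range p).map m.elt) ∧
      m'.elt (p + 1) = m.elt p := by
  obtain ⟨p1, h1⟩ := m.part_eventually_zero
  obtain ⟨p2, h2⟩ := m'.part_eventually_zero
  obtain ⟨p3, h3⟩ := m.exists_elt_lt e
  exact ⟨max p1 (max p2 p3), h1 _ (by omega), h2 _ (by omega),
    perm_of_carrier_eq_insert h he (h3 _ (by omega))⟩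

theorem charge_of_carrier_eq_insert (h : m'.carrier = insert e m.carrier) (he : e ∉ m.carrier) :
    m'.charge = m.charge + 1 := by
  obtain ⟨p, h1, h2, -, h3⟩ := exists_forall_perm h he
  have h4 := m.elt_eq p
  have h5 := m'.elt_eq (p + 1)
  rw [h1] at h4
  rw [h2] at h5
  push_cast at h4 h5
  omega

theorem colLen_toYoungDiagram_le {p : ℕ} (h : m.part p = 0) : m.toYoungDiagram.colLen 0 ≤ p :=
  YoungDiagram.colLen_zero_le _ (by rw [rowLen_toYoungDiagram, h])

theorem universalCharacter_eq {m₁ m₂ : MayaDiagram} {p q : ℕ} (hp : m₁.part p = 0)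
    (hq : m₂.part q = 0) (x y : ℕ → ℂ) :
    universalCharacter m₁.toYoungDiagram m₂.toYoungDiagram x y =
      charDet (completeH x) (completeH y)
        (((List.range p).map m₁.elt).map fun e => e - m₁.charge - q)
        (((List.range q).map m₂.elt).reverse.map fun e => e - m₂.charge + q - 1) := by
  rw [universalCharacter_eq_charDet _ _ x y (colLen_toYoungDiagram_le hp)
    (colLen_toYoungDiagram_le hq), ← List.map_reverse]
  simp only [List.map_map]
  congr 1
  · refine List.map_congr_left fun r _ => ?_
    simp only [Function.comp_apply, elt_eq, rowLen_toYoungDiagram]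
    ring
  · refine List.map_congr_left fun r _ => ?_
    simp only [Function.comp_apply, elt_eq, rowLen_toYoungDiagram]
    ring

/-- The universal characters of two pairs of Maya diagrams, each related by adding one element,
as determinants with common rows. -/
theorem exists_charDet_frame {m₁ m₁' m₂ m₂' : MayaDiagram} {e₁ e₂ : ℤ}
    (h₁ : m₁'.carrier = insert e₁ m₁.carrier) (he₁ : e₁ ∉ m₁.carrier)
    (h₂ : m₂'.carrier = insert e₂ m₂.carrier) (he₂ : e₂ ∉ m₂.carrier) :
    ∃ (A B : List ℤ) (a b : ℤ) (ε ε' : ℂ), ε * ε = 1 ∧ ε' * ε' = 1 ∧ ∀ x y : ℕ → ℂ,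
      universalCharacter m₁.toYoungDiagram m₂.toYoungDiagram x y =
        charDet (completeH x) (completeH y) (A.map (· + 2)) B ∧
      universalCharacter m₁'.toYoungDiagram m₂.toYoungDiagram x y =
        ε * charDet (completeH x) (completeH y) ((a :: A).map (· + 1)) B ∧
      universalCharacter m₁.toYoungDiagram m₂'.toYoungDiagram x y =
        ε' * charDet (completeH x) (completeH y) (A.map (· + 1)) (B ++ [b]) ∧
      universalCharacter m₁'.toYoungDiagram m₂'.toYoungDiagram x y =
        ε * ε' * charDet (completeH x) (completeH y) (a :: A) (B ++ [b]) := by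
  obtain ⟨p, hp, hp', hperm₁, -⟩ := exists_forall_perm h₁ he₁
  obtain ⟨q, hq, hq', hperm₂, -⟩ := exists_forall_perm h₂ he₂
  -- The sign depends only on the reordering, not on the surrounding rows, so the same `ε` serves
  -- with `m₂` and with `m₂'`.
  obtain ⟨ε, hε, H₁⟩ := hperm₁.exists_rowDet_eq (R := ℂ)
  -- The `k`-rows are listed in reverse, so the new one can be placed last, next to the new first
  -- `h`-row, as the Plücker relation requires.
  have hperm₂' : (((List.range (q + 1)).map m₂'.elt).reverse).Perm
      (((List.range q).map m₂.elt).reverse ++ [e₂]) := by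
    rw [← List.reverse_cons]
    exact ((List.reverse_perm _).trans hperm₂).trans (List.reverse_perm _).symm
  obtain ⟨ε', hε', H₂⟩ := hperm₂'.exists_rowDet_eq (R := ℂ)
  have c₁ := charge_of_carrier_eq_insert h₁ he₁
  have c₂ := charge_of_carrier_eq_insert h₂ he₂
  have K₁ : ∀ (h k : ℤ → ℂ) (B : List ℤ) (f : ℤ → ℤ),
      charDet h k (((List.range (p + 1)).map m₁'.elt).map f) B =
        ε * charDet h k ((e₁ :: (List.range p).map m₁.elt).map f) B := by
    intro h k B f
    have := H₁ (B.map (kRow k)) [] (fun z => hRow h (f z))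
    simp only [List.append_nil] at this
    simpa only [charDet, List.map_map, Function.comp_def] using this
  have K₂ : ∀ (h k : ℤ → ℂ) (A : List ℤ) (f : ℤ → ℤ),
      charDet h k A (((List.range (q + 1)).map m₂'.elt).reverse.map f) =
        ε' * charDet h k A ((((List.range q).map m₂.elt).reverse ++ [e₂]).map f) := by
    intro h k A f
    have := H₂ [] (A.map (hRow h)) (fun z => kRow k (f z))
    simp only [List.nil_append] at this
    simpa only [charDet, List.map_map, Function.comp_def] using this
  have hB : (((List.range q).map m₂.elt).reverse ++ [e₂]).map
      (fun e => e - m₂'.charge + (q + 1 : ℕ) - 1) =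
      ((List.range q).map m₂.elt).reverse.map (fun e => e - m₂.charge + q - 1) ++
        [e₂ - m₂.charge + q - 1] := by
    rw [List.map_append, List.map_singleton, c₂]
    congr 1
    · refine List.map_congr_left fun r _ => ?_
      push_cast
      ring
    · push_cast
      congr 1
      ring
  -- Adding `e₁` raises the charge of `m₁` and adding `e₂` raises `q`; each lowers the `h`-indices
  -- by one. Normalizing by `-2` makes the shifts `2, 1, 1, 0`. In the `k`-indices the changes of
  -- charge and of `q` cancel.
  refine ⟨((List.range p).map m₁.elt).map fun e => e - m₁.charge - q - 2,
    ((List.range q).map m₂.elt).reverse.map fun e => e - m₂.charge + q - 1,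
    e₁ - m₁.charge - q - 2, e₂ - m₂.charge + q - 1, ε, ε', hε, hε', fun x y => ⟨?_, ?_, ?_, ?_⟩⟩
  · rw [universalCharacter_eq hp hq, List.map_map (f := fun e => e - m₁.charge - q - 2)]
    congr 1
    refine List.map_congr_left fun r _ => ?_
    simp
  · rw [universalCharacter_eq hp' hq, K₁, ← List.map_cons (f := fun e => e - m₁.charge - q - 2),
      List.map_map (f := fun e => e - m₁.charge - q - 2)]
    congr 2
    refine List.map_congr_left fun r _ => ?_
    simp only [Function.comp_apply, c₁]
    ring
  · rw [universalCharacter_eq hp hq', K₂, List.map_map (f := fun e => e - m₁.charge - q - 2), hB]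
    congr 2
    refine List.map_congr_left fun r _ => ?_
    simp only [Function.comp_apply]
    push_cast
    ring
  · rw [universalCharacter_eq hp' hq', K₂, K₁, hB, ← mul_assoc, mul_comm ε' ε,
      ← List.map_cons (f := fun e => e - m₁.charge - q - 2)]
    congr 2
    refine List.map_congr_left fun r _ => ?_
    simp only [c₁]
    push_cast
    ring

end MayaDiagram

/-! ### Core partitions -/

theorem YoungDiagram.card_eq_sum_rowLen (lam : YoungDiagram) {p : ℕ} (hp : lam.colLen 0 ≤ p) :
    lam.card = ∑ r ∈ Finset.range p, lam.rowLen r := by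
  rw [YoungDiagram.card, Finset.card_eq_sum_card_fiberwise (f := Prod.fst) (t := Finset.range p)]
  · refine Finset.sum_congr rfl fun r _ => ?_
    rw [YoungDiagram.rowLen_eq_card, YoungDiagram.row]
  · intro c hc
    rw [Finset.mem_coe, Finset.mem_range]
    by_contra! h
    have h2 := YoungDiagram.mem_iff_lt_rowLen.1 ((YoungDiagram.mem_cells c).1 hc)
    rw [lam.rowLen_eq_zero (hp.trans h)] at h2
    exact absurd h2 (Nat.not_lt_zero _)

namespace MayaDiagram

variable {m m' : MayaDiagram} {e : ℤ}

theorem card_toYoungDiagram {p : ℕ} (hp : m.part p = 0) :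
    (m.toYoungDiagram.card : ℤ) = ((List.range p).map m.elt).sum + ∑ r ∈ Finset.range p, (r : ℤ)
      - p * m.charge := by
  have h1 : m.toYoungDiagram.card = ∑ r ∈ Finset.range p, m.part r := by
    simp only [YoungDiagram.card_eq_sum_rowLen _ (colLen_toYoungDiagram_le hp), rowLen_toYoungDiagram]
  have h2 : ((List.range p).map m.elt).sum = ∑ r ∈ Finset.range p, m.elt r := by
    rw [← List.sum_toFinset _ List.nodup_range, List.toFinset_range]
  rw [h1, h2, Nat.cast_sum, ← Finset.sum_add_distrib]
  have : ∀ r, (m.part r : ℤ) = m.elt r + r - m.charge := fun r => by rw [m.elt_eq r]; ring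
  simp only [this, Finset.sum_sub_distrib, Finset.sum_const, Finset.card_range, nsmul_eq_mul]

/-- In the formula for the size, the sum of elements gains `e`, the triangular sum gains `p`, and
the charge term changes from `p c` to `(p + 1)(c + 1)`. -/
theorem card_of_carrier_eq_insert (h : m'.carrier = insert e m.carrier) (he : e ∉ m.carrier) :
    (m'.toYoungDiagram.card : ℤ) = m.toYoungDiagram.card + (e - m.charge - 1) := by
  obtain ⟨p, h1, h2, hperm, -⟩ := exists_forall_perm h he
  rw [card_toYoungDiagram h1, card_toYoungDiagram h2, hperm.sum_eq, List.sum_cons,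
    charge_of_carrier_eq_insert h he, Finset.sum_range_succ]
  push_cast
  ring

/-- Translation moves all elements and the charge by `c`, and parts measure elements relative to the
charge; the change of charge is read off far down, where both parts vanish. This gives
`L`-periodicity, since adding `(1, …, 1)` to `ν` translates the diagram by `L`. -/
theorem toYoungDiagram_eq_of_translate {c : ℤ} (h : ∀ k, k ∈ m'.carrier ↔ k - c ∈ m.carrier) :
    m'.toYoungDiagram = m.toYoungDiagram := by
  have helt : ∀ i, m'.elt i = m.elt i + c := by
    have h1 : StrictMono fun i => -m'.elt i := fun i j hij => neg_lt_neg (m'.elt_strictAnti hij)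
    have h2 : StrictMono fun i => -(m.elt i + c) := fun i j hij =>
      neg_lt_neg (by simpa using m.elt_strictAnti hij)
    have h3 := (StrictMono.range_inj h1 h2).1 (by
      ext k
      simp only [Set.mem_range]
      have e1 : (∃ i, -m'.elt i = k) ↔ -k ∈ m'.carrier := by
        rw [mem_iff_exists_elt]
        exact exists_congr fun i => ⟨fun h => by omega, fun h => by omega⟩
      have e2 : (∃ i, -(m.elt i + c) = k) ↔ -k - c ∈ m.carrier := by
        rw [mem_iff_exists_elt]
        exact exists_congr fun i => ⟨fun h => by omega, fun h => by omega⟩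
      rw [e1, e2, h])
    intro i
    have := congrFun h3 i
    omega
  have hpart : ∀ i, m'.part i = m.part i := by
    obtain ⟨p, hp⟩ := m.part_eventually_zero
    obtain ⟨q, hq⟩ := m'.part_eventually_zero
    have e1 := m.elt_eq (max p q)
    have e2 := m'.elt_eq (max p q)
    rw [hp _ (le_max_left _ _)] at e1
    rw [hq _ (le_max_right _ _)] at e2
    have e3 := helt (max p q)
    intro i
    have e4 := m.elt_eq i
    have e5 := m'.elt_eq i
    have e6 := helt i
    omega
  ext ⟨i, j⟩
  rw [YoungDiagram.mem_cells, YoungDiagram.mem_cells, YoungDiagram.mem_iff_lt_rowLen,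
    YoungDiagram.mem_iff_lt_rowLen, rowLen_toYoungDiagram, rowLen_toYoungDiagram, hpart]

end MayaDiagram

section coreMaya

variable {L : ℕ}

theorem eq_and_eq_of_mul_add_eq {L : ℕ} {k k' : Fin L} {q q' : ℤ}
    (h : (L : ℤ) * q + ((k : ℕ) + 1) = L * q' + ((k' : ℕ) + 1)) : k = k' ∧ q = q' := by
  have hk := k.2
  have hk' := k'.2
  have h1 : ((L : ℤ) * q + (k : ℕ)) % L = (L * q' + (k' : ℕ)) % L := by congr 1; omega
  rw [Int.mul_add_emod_self_left, Int.mul_add_emod_self_left, Int.emod_eq_of_lt (by omega) (by omega),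
    Int.emod_eq_of_lt (by omega) (by omega)] at h1
  have h2 : (k : ℕ) = k' := by omega
  refine ⟨Fin.ext h2, ?_⟩
  rw [h2] at h
  exact mul_left_cancel₀ (show (L : ℤ) ≠ 0 by omega) (by omega)

theorem mul_add_mem_coreMaya (hL : 2 ≤ L) (ν : Fin L → ℤ) (k : Fin L) (q : ℤ) :
    (L : ℤ) * q + ((k : ℕ) + 1) ∈ (coreMaya hL ν).carrier ↔ q < ν k := by
  constructor
  · rintro ⟨k', q', h1, h2⟩
    obtain ⟨rfl, rfl⟩ := eq_and_eq_of_mul_add_eq h2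
    exact h1
  · exact fun h => ⟨k, q, h, rfl⟩

theorem exists_eq_mul_add (hL : 2 ≤ L) (p : ℤ) : ∃ (k : Fin L) (q : ℤ), p = L * q + ((k : ℕ) + 1) := by
  have hL0 : (0 : ℤ) < L := by omega
  have h1 := Int.emod_nonneg (p - 1) hL0.ne'
  have h2 := Int.emod_lt_of_pos (p - 1) hL0
  have h3 := Int.mul_ediv_add_emod (p - 1) L
  refine ⟨⟨((p - 1) % L).toNat, by omega⟩, (p - 1) / L, ?_⟩
  simp only [Int.toNat_of_nonneg h1]
  omega

theorem coreMaya_update_carrier (hL : 2 ≤ L) (ν : Fin L → ℤ) (k : Fin L) :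
    (coreMaya hL (Function.update ν k (ν k + 1))).carrier =
      insert (L * ν k + ((k : ℕ) + 1)) (coreMaya hL ν).carrier := by
  ext p
  obtain ⟨k', q, rfl⟩ := exists_eq_mul_add hL p
  rw [Set.mem_insert_iff, mul_add_mem_coreMaya, mul_add_mem_coreMaya]
  rcases eq_or_ne k' k with rfl | hk
  · rw [Function.update_self, Int.lt_add_one_iff, le_iff_eq_or_lt]
    exact or_congr ⟨fun h => by rw [h], fun h => (eq_and_eq_of_mul_add_eq h).2⟩ Iff.rfl
  · rw [Function.update_of_ne hk]
    exact ⟨Or.inr, fun h => h.resolve_left fun h => hk (eq_and_eq_of_mul_add_eq h).1⟩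

theorem notMem_coreMaya (hL : 2 ≤ L) (ν : Fin L → ℤ) (k : Fin L) :
    (L : ℤ) * ν k + ((k : ℕ) + 1) ∉ (coreMaya hL ν).carrier := by
  rw [mul_add_mem_coreMaya]
  exact lt_irrefl _

/-- Charge minus `∑ ν_k` is unchanged when one entry is raised (`h1`), hence when one entry is
replaced by any integer (`h2`), hence when all entries are set to zero (`h3`). For `ν = 0` the
diagram is the set of integers `≤ 0`, of charge zero. -/
theorem charge_coreMaya (hL : 2 ≤ L) (ν : Fin L → ℤ) : (coreMaya hL ν).charge = ∑ k, ν k := by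
  have h1 : ∀ (ν : Fin L → ℤ) (k : Fin L),
      (coreMaya hL (Function.update ν k (ν k + 1))).charge - ∑ l, Function.update ν k (ν k + 1) l =
        (coreMaya hL ν).charge - ∑ l, ν l := by
    intro ν k
    rw [MayaDiagram.charge_of_carrier_eq_insert (coreMaya_update_carrier hL ν k)
      (notMem_coreMaya hL ν k), Finset.sum_update_of_mem (Finset.mem_univ k),
      ← Finset.add_sum_erase _ ν (Finset.mem_univ k), Finset.sdiff_singleton_eq_erase]
    ring
  have h2 : ∀ (ν : Fin L → ℤ) (k : Fin L) (z : ℤ),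
      (coreMaya hL (Function.update ν k z)).charge - ∑ l, Function.update ν k z l =
        (coreMaya hL (Function.update ν k 0)).charge - ∑ l, Function.update ν k 0 l := by
    intro ν k z
    induction z using Int.induction_on with
    | zero => rfl
    | succ i ih =>
      have := h1 (Function.update ν k i) k
      rwa [Function.update_self, Function.update_idem, ih] at this
    | pred i ih =>
      have := h1 (Function.update ν k (-i - 1)) k
      rw [Function.update_self, Function.update_idem, sub_add_cancel, ih] at this
      exact this.symm
  have h3 : ∀ s : Finset (Fin L),
      (coreMaya hL (fun k => if k ∈ s then ν k else 0)).charge - ∑ k, (if k ∈ s then ν k else 0) =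
        (coreMaya hL 0).charge := by
    intro s
    induction s using Finset.induction_on with
    | empty => simp [Pi.zero_def]
    | insert k s hk ih =>
      have e1 : (fun l => if l ∈ insert k s then ν l else 0) =
          Function.update (fun l => if l ∈ s then ν l else 0) k (ν k) := by
        ext l
        rcases eq_or_ne l k with rfl | h
        · simp
        · simp [h]
      have e2 : Function.update (fun l => if l ∈ s then ν l else 0) k 0 =
          fun l => if l ∈ s then ν l else 0 := by
        rw [Function.update_eq_self_iff]
        simp [hk]
      have := h2 (fun l => if l ∈ s then ν l else 0) k (ν k)
      rw [e2, ih, ← e1] at this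
      exact this
  have h4 : (coreMaya hL (0 : Fin L → ℤ)).charge = 0 := by
    have hc : (coreMaya hL (0 : Fin L → ℤ)).carrier = Set.Iic 0 := by
      ext p
      obtain ⟨k, q, rfl⟩ := exists_eq_mul_add hL p
      have hk := k.2
      rw [mul_add_mem_coreMaya, Set.mem_Iic, Pi.zero_apply]
      constructor
      · intro h
        have : (L : ℤ) * q ≤ L * (-1) := mul_le_mul_of_nonneg_left (by omega) (by omega)
        omega
      · intro h
        by_contra! h'
        have : 0 ≤ (L : ℤ) * q := by positivity
        omega
    have e1 : (coreMaya hL (0 : Fin L → ℤ)).elt 0 = 0 := by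
      rw [MayaDiagram.elt, hc, csSup_Iic]
    have e2 : (coreMaya hL (0 : Fin L → ℤ)).part 0 = 0 := by
      have : (coreMaya hL (0 : Fin L → ℤ)).holes 0 = ∅ := by
        ext k
        simp only [MayaDiagram.holes, e1, hc, Set.mem_Iic, Set.mem_ofPred_eq, Set.mem_empty_iff_false,
          iff_false]
        omega
      rw [MayaDiagram.part, this, Set.ncard_empty]
    rw [MayaDiagram.charge, e1, e2]
    rfl
  have h5 := h3 Finset.univ
  simp only [Finset.mem_univ, if_true, h4] at h5
  exact sub_eq_zero.1 h5

/-- The position of the entry that is increased in the step from `ν(m)` to `ν(m + 1)`. -/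
def shiftIndex (hL : 2 ≤ L) (m : ℤ) : Fin L :=
  ⟨(m % L).toNat, by
    have h1 := Int.emod_nonneg m (b := (L : ℤ)) (by omega)
    have h2 := Int.emod_lt_of_pos m (b := (L : ℤ)) (by omega)
    omega⟩

theorem shiftIndex_coe (hL : 2 ≤ L) (m : ℤ) : ((shiftIndex hL m : ℕ) : ℤ) = m % L :=
  Int.toNat_of_nonneg (Int.emod_nonneg m (by omega))

theorem shiftSeq_shiftIndex (hL : 2 ≤ L) (ν : Fin L → ℤ) (m : ℤ) :
    shiftSeq ν m (shiftIndex hL m) = ν (shiftIndex hL m) + m / L := by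
  simp [shiftSeq, shiftIndex_coe]

theorem shiftSeq_add_one (hL : 2 ≤ L) (ν : Fin L → ℤ) (m : ℤ) :
    shiftSeq ν (m + 1) = Function.update (shiftSeq ν m) (shiftIndex hL m)
      (shiftSeq ν m (shiftIndex hL m) + 1) := by
  have hL0 : (0 : ℤ) < L := by omega
  have e0 := Int.emod_nonneg m hL0.ne'
  have e1 := Int.emod_lt_of_pos m hL0
  have e2 := Int.mul_ediv_add_emod m L
  ext k
  have hk := k.2
  -- Either the remainder grows, or it wraps from `L - 1` to `0` while the quotient grows; in both
  -- cases only the entry at position `m % L` gains one.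
  have hdm : (m % L + 1 < L ∧ (m + 1) / L = m / L ∧ (m + 1) % L = m % L + 1) ∨
      (m % L + 1 = L ∧ (m + 1) / L = m / L + 1 ∧ (m + 1) % L = 0) := by
    rcases lt_or_ge (m % L + 1) L with h | h
    · refine Or.inl ⟨h, ?_⟩
      exact (Int.ediv_emod_unique hL0).2 ⟨by omega, by omega, by omega⟩
    · refine Or.inr ⟨by omega, ?_⟩
      refine (Int.ediv_emod_unique hL0).2 ⟨?_, le_rfl, hL0⟩
      rw [mul_add]
      omega
  rcases eq_or_ne k (shiftIndex hL m) with rfl | h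
  · rw [Function.update_self]
    simp only [shiftSeq, shiftIndex_coe]
    rcases hdm with ⟨h1, h2, h3⟩ | ⟨h1, h2, h3⟩ <;> rw [h2, h3]
    · simp
    · simp
      omega
  · rw [Function.update_of_ne h]
    have h' : ((k : ℕ) : ℤ) ≠ m % L := by
      rw [← shiftIndex_coe hL]
      exact fun h' => h (Fin.ext (by exact_mod_cast h'))
    simp only [shiftSeq]
    rcases hdm with ⟨h1, h2, h3⟩ | ⟨h1, h2, h3⟩ <;> rw [h2, h3]
    · congr 1
      exact if_congr (by omega) rfl rfl
    · rw [if_neg (by omega), if_pos (by omega)]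
      ring

theorem cyclicEntry_add_one (hL : 2 ≤ L) (ν : Fin L → ℤ) (m : ℤ) : cyclicEntry hL ν (m + 1) = ν (shiftIndex hL m) := by
  simp only [cyclicEntry, add_sub_cancel_right]
  rfl

/-- The raised entry sits at position `m % L` and contains the summand `m / L`; in the new element
these recombine to `m`. -/
theorem coreMaya_shiftSeq_add_one (hL : 2 ≤ L) (ν : Fin L → ℤ) (m : ℤ) :
    (coreMaya hL (shiftSeq ν (m + 1))).carrier =
      insert (L * cyclicEntry hL ν (m + 1) + m + 1) (coreMaya hL (shiftSeq ν m)).carrier ∧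
    (L : ℤ) * cyclicEntry hL ν (m + 1) + m + 1 ∉ (coreMaya hL (shiftSeq ν m)).carrier := by
  have h : (L : ℤ) * cyclicEntry hL ν (m + 1) + m + 1 =
      L * shiftSeq ν m (shiftIndex hL m) + ((shiftIndex hL m : ℕ) + 1) := by
    rw [shiftSeq_shiftIndex, cyclicEntry_add_one, shiftIndex_coe]
    have := Int.mul_ediv_add_emod m L
    rw [mul_add]
    omega
  rw [h, shiftSeq_add_one hL ν, coreMaya_update_carrier]
  exact ⟨rfl, notMem_coreMaya hL _ _⟩

theorem sum_shiftSeq (hL : 2 ≤ L) (ν : Fin L → ℤ) (m : ℤ) : ∑ k, shiftSeq ν m k = ∑ k, ν k + m := by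
  have h : ∀ m, ∑ k, shiftSeq ν (m + 1) k = ∑ k, shiftSeq ν m k + 1 := by
    intro m
    rw [shiftSeq_add_one hL ν, Finset.sum_update_of_mem (Finset.mem_univ _),
      ← Finset.add_sum_erase _ (shiftSeq ν m) (Finset.mem_univ (shiftIndex hL m)),
      Finset.sdiff_singleton_eq_erase]
    ring
  induction m using Int.induction_on with
  | zero =>
    refine (Finset.sum_congr rfl fun k _ => ?_).trans (add_zero _).symm
    rw [shiftSeq, if_neg (by rw [Int.zero_emod]; omega), Int.zero_ediv, add_zero, add_zero]
  | succ i ih => rw [h, ih]; ring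
  | pred i ih =>
    have := h (-i - 1)
    rw [sub_add_cancel, ih] at this
    omega

theorem card_corePartition_shiftSeq (hL : 2 ≤ L) (ν : Fin L → ℤ) (m : ℤ) :
    ((corePartition hL (shiftSeq ν (m + 1))).card : ℤ) = (corePartition hL (shiftSeq ν m)).card +
      (L * cyclicEntry hL ν (m + 1) - ∑ k, ν k) := by
  obtain ⟨h1, h2⟩ := coreMaya_shiftSeq_add_one hL ν m
  rw [corePartition, corePartition, MayaDiagram.card_of_carrier_eq_insert h1 h2, charge_coreMaya,
    sum_shiftSeq hL]
  ring

theorem corePartition_shiftSeq_add (hL : 2 ≤ L) (ν : Fin L → ℤ) (m : ℤ) :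
    corePartition hL (shiftSeq ν (m + L)) = corePartition hL (shiftSeq ν m) := by
  refine MayaDiagram.toYoungDiagram_eq_of_translate (c := L) fun p => ?_
  obtain ⟨k, q, rfl⟩ := exists_eq_mul_add hL p
  rw [show (L : ℤ) * q + ((k : ℕ) + 1) - L = L * (q - 1) + ((k : ℕ) + 1) by ring,
    mul_add_mem_coreMaya, mul_add_mem_coreMaya]
  simp only [shiftSeq, Int.add_emod_right]
  rw [Int.add_ediv_of_dvd_right (dvd_refl _), Int.ediv_self (by omega)]
  constructor <;> intro h <;> omega

end coreMaya

/-! ### Degree differences and periodicity. -/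

section degrees

variable {L : ℕ} (hL : 2 ≤ L) (ν ν' : Fin L → ℤ)

theorem degreeUC_sub_left (m n : ℤ) : degreeUC hL ν ν' m n - degreeUC hL ν ν' (m - 1) n =
    L * cyclicEntry hL ν m - ∑ k, ν k := by
  have := card_corePartition_shiftSeq hL ν (m - 1)
  rw [sub_add_cancel] at this
  rw [degreeUC, degreeUC, this]
  ring

theorem degreeUC_sub_right (m n : ℤ) : degreeUC hL ν ν' m n - degreeUC hL ν ν' m (n - 1) =
    -(L * cyclicEntry hL ν' n) + ∑ k, ν' k := by
  have := card_corePartition_shiftSeq hL ν' (n - 1)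
  rw [sub_add_cancel] at this
  rw [degreeUC, degreeUC, this]
  ring

theorem sigmaUC_periodic {N : ℕ} (m n : ℤ) (θ t : Fin (N + 1) → ℂ) :
    sigmaUC hL ν ν' (m + L) n θ t = sigmaUC hL ν ν' m n θ t ∧
      sigmaUC hL ν ν' m (n + L) θ t = sigmaUC hL ν ν' m n θ t := by
  simp only [sigmaUC, corePartition_shiftSeq_add, and_self]

end degrees

/-! ### Bilinear equations for twisted Jacobi-Trudi determinants -/

section rowLinear

variable {R : Type*} [CommRing R]

/-- Cofactor expansion along one row: linearity and differentiability in that row both follow from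
it. -/
theorem exists_rowDet_eq_sum (P Q : List (ℕ → R)) :
    ∃ c : Fin (P.length + Q.length + 1) → R, ∀ a : ℕ → R,
      rowDet (P ++ a :: Q) = ∑ j : Fin (P.length + Q.length + 1), a j * c j := by
  set n := P.length + Q.length + 1 with hn
  set p : Fin n := ⟨P.length, by omega⟩ with hp
  set A : Matrix (Fin n) (Fin n) R :=
    Matrix.of fun i j : Fin n => (P ++ 0 :: Q).getD i 0 j with hA
  have key : ∀ a : ℕ → R, rowDet (P ++ a :: Q) = (A.updateRow p fun j => a j).det := by
    intro a
    rw [rowDet_eq (n := n) (by simp; omega)]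
    congr 1
    ext i j
    rcases eq_or_ne i p with rfl | hip
    · simp [hp]
    rw [Matrix.updateRow_ne hip]
    simp only [hA, Matrix.of_apply]
    have h3 : (i : ℕ) ≠ P.length := fun h => hip (Fin.ext h)
    rcases lt_or_ge (i : ℕ) P.length with h | h
    · simp [List.getElem?_append_left h]
    · obtain ⟨k, hk⟩ : ∃ k, (i : ℕ) = P.length + (k + 1) := ⟨i - P.length - 1, by omega⟩
      simp [hk, List.getElem?_append_right]
  refine ⟨fun j => Matrix.cramer A.transpose (Pi.single j 1) p, fun a => ?_⟩
  rw [key, ← Matrix.cramer_transpose_apply]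
  have h := congrArg (fun x => Matrix.cramer A.transpose x p)
    (pi_eq_sum_univ' fun j : Fin n => a j)
  simp only [map_sum, map_smul, Finset.sum_apply, Pi.smul_apply, smul_eq_mul] at h
  rw [h]

theorem rowDet_smul_row (P Q : List (ℕ → R)) (c : R) (a : ℕ → R) :
    rowDet (P ++ (c • a) :: Q) = c * rowDet (P ++ a :: Q) := by
  obtain ⟨w, hw⟩ := exists_rowDet_eq_sum P Q
  rw [hw, hw, Finset.mul_sum]
  exact Finset.sum_congr rfl fun j _ => by simp [mul_assoc]

theorem rowDet_add_row (P Q : List (ℕ → R)) (a b : ℕ → R) :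
    rowDet (P ++ (a + b) :: Q) = rowDet (P ++ a :: Q) + rowDet (P ++ b :: Q) := by
  obtain ⟨w, hw⟩ := exists_rowDet_eq_sum P Q
  rw [hw, hw, hw, ← Finset.sum_add_distrib]
  exact Finset.sum_congr rfl fun j _ => by simp [add_mul]

theorem hasDerivAt_rowDet_geomRow (P Q : List (ℕ → ℂ)) (s : ℂ) :
    HasDerivAt (fun s => rowDet (P ++ geomRow s :: Q)) (rowDet (P ++ geomRow' s :: Q)) s := by
  obtain ⟨w, hw⟩ := exists_rowDet_eq_sum P Q
  simp only [hw]
  exact HasDerivAt.fun_sum fun j _ => (hasDerivAt_pow _ s).mul_const _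

end rowLinear

/-! ### Derivatives of determinants. -/

section detDeriv

theorem Matrix.hasDerivAt_det {n : Type*} [Fintype n] [DecidableEq n] {M : ℂ → Matrix n n ℂ}
    {M' : Matrix n n ℂ} {s : ℂ} (hM : ∀ i j, HasDerivAt (fun z => M z i j) (M' i j) s) :
    HasDerivAt (fun z => (M z).det) (∑ i, ((M s).updateRow i (M' i)).det) s := by
  have h1 : HasDerivAt (fun z => (M z : n → n → ℂ)) M' s :=
    hasDerivAt_pi.2 fun i => hasDerivAt_pi.2 fun j => hM i j
  let f : ContinuousMultilinearMap ℂ (fun _ : n => n → ℂ) ℂ :=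
    { (Matrix.detRowAlternating (R := ℂ) (n := n)).toMultilinearMap with
      cont := by
        change Continuous fun M : Matrix n n ℂ => M.det
        exact continuous_id.matrix_det }
  have h2 := (f.hasFDerivAt (M s)).comp_hasDerivAt s h1
  exact h2.congr_deriv (f.linearDeriv_apply (M s : n → n → ℂ) M')

/-- Two families of determinants that agree at a point, with proportional derivatives of the
sequences there, have proportional derivatives. -/
theorem exists_hasDerivAt_charDet {h k h₂ k₂ : ℂ → ℤ → ℂ} {h' k' : ℤ → ℂ} {c s : ℂ}
    (hh : ∀ n, HasDerivAt (fun z => h z n) (h' n) s) (hk : ∀ n, HasDerivAt (fun z => k z n) (k' n) s)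
    (hh₂ : ∀ n, HasDerivAt (fun z => h₂ z n) (c * h' n) s)
    (hk₂ : ∀ n, HasDerivAt (fun z => k₂ z n) (c * k' n) s)
    (eh : ∀ n, h₂ s n = h s n) (ek : ∀ n, k₂ s n = k s n) (A B : List ℤ) :
    ∃ d, HasDerivAt (fun z => charDet (h z) (k z) A B) d s ∧
      HasDerivAt (fun z => charDet (h₂ z) (k₂ z) A B) (c * d) s := by
  have hlen : ∀ h k : ℤ → ℂ, (B.map (kRow k) ++ A.map (hRow h)).length = B.length + A.length := by
    simp
  have key : ∀ h k : ℤ → ℂ, charDet h k A B = Matrix.det (Matrix.of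
      fun i j : Fin (B.length + A.length) => (B.map (kRow k) ++ A.map (hRow h)).getD i 0 j) :=
    fun h k => rowDet_eq (hlen h k)
  simp only [key]
  set M' : Matrix (Fin (B.length + A.length)) (Fin (B.length + A.length)) ℂ :=
    Matrix.of fun i j => (B.map (kRow k') ++ A.map (hRow h')).getD i 0 j with hM'
  have hget : ∀ (h k : ℤ → ℂ) (i j : Fin (B.length + A.length)),
      (B.map (kRow k) ++ A.map (hRow h)).getD i 0 j =
        if (i : ℕ) < B.length then k (B.getD i 0 - (j : ℕ)) else
          h (A.getD (i - B.length) 0 + (j : ℕ)) := by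
    intro h k i j
    have hi := i.2
    split_ifs with hlt
    · simp [hlt, kRow]
    · have h2 : (i : ℕ) - B.length < A.length := by omega
      rw [not_lt] at hlt
      simp [hlt, h2, hRow]
  refine ⟨_, Matrix.hasDerivAt_det (M' := M') fun i j => ?_, ?_⟩
  · simp only [hM', Matrix.of_apply, hget]
    split_ifs
    · exact hk _
    · exact hh _
  · convert Matrix.hasDerivAt_det (M' := c • M') (s := s) (M := fun z => Matrix.of
      fun i j : Fin (B.length + A.length) =>
        (B.map (kRow (k₂ z)) ++ A.map (hRow (h₂ z))).getD i 0 j) fun i j => ?_ using 1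
    · rw [Finset.mul_sum]
      refine Finset.sum_congr rfl fun i _ => ?_
      rw [show (c • M') i = c • M' i from rfl, Matrix.det_updateRow_smul]
      congr 4
      ext i j
      simp only [hget, eh, ek]
    · simp only [hM', Matrix.of_apply, hget, Matrix.smul_apply, smul_eq_mul]
      split_ifs
      · exact hk₂ _
      · exact hh₂ _

end detDeriv

/-! ### The twisted difference on Jacobi-Trudi rows. -/

section bilinear

variable {R : Type*} [Field R]

theorem twistDiff_hRow (t : R) (h : ℤ → R) (a : ℤ) :
    twistDiff t (hRow h a) = hRow (fun n => h n - t * h (n - 1)) (a + 1) := by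
  ext j
  simp only [twistDiff, hRow]
  congr 2
  · push_cast; ring
  · congr 1; ring

/-- The `k`-rows run backwards and belong to the inverse variables, so the operator that lowers
`θ_i` in `h`-rows lowers it here too, at the cost of a scalar and with no shift of index. -/
theorem twistDiff_kRow {t : R} (ht : t ≠ 0) (k : ℤ → R) (b : ℤ) :
    twistDiff t (kRow k b) = (-t) • kRow (fun n => k n - t⁻¹ * k (n - 1)) b := by
  ext j
  simp only [twistDiff, kRow, Pi.smul_apply, smul_eq_mul]
  rw [show b - ((j + 1 : ℕ) : ℤ) = b - j - 1 by push_cast; ring]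
  field_simp
  ring

/-- The sign from moving the geometric row past the `k`-rows cancels the signs in the factors `-t`
that these rows produce. -/
theorem rowDet_geomRow_charDet {t : R} (ht : t ≠ 0) (h k : ℤ → R) (A B : List ℤ)
    (X : List (ℕ → R)) :
    rowDet (B.map (kRow k) ++ geomRow t :: (X ++ A.map (hRow h))) =
      t ^ B.length * rowDet (B.map (kRow fun n => k n - t⁻¹ * k (n - 1)) ++
        (X.map (twistDiff t) ++ (A.map (· + 1)).map (hRow fun n => h n - t * h (n - 1)))) := by
  rw [rowDet_append_geomRow_cons, List.map_map, List.map_append, List.map_map, List.map_map]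
  have h1 : twistDiff t ∘ kRow k = (fun r => (-t) • r) ∘ kRow fun n => k n - t⁻¹ * k (n - 1) := by
    ext b : 1
    exact twistDiff_kRow ht k b
  have h2 : twistDiff t ∘ hRow h = (hRow fun n => h n - t * h (n - 1)) ∘ (· + 1) := by
    ext a : 1
    exact twistDiff_hRow t h a
  rw [h1, h2, ← List.map_map, rowDet_smul_append, ← mul_assoc, List.length_map, List.length_map,
    ← mul_pow]
  congr 2
  ring

end bilinear

/-! ### Plücker relations under the power-sum substitution. -/

section powerSumBilinear

variable {N : ℕ} (θ t : Fin (N + 1) → ℂ)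

/-- `h_n` under the inverse power-sum substitution. -/
noncomputable def kPow (n : ℤ) : ℂ := hPow θ (fun i => (t i)⁻¹) n

/-- A determinant with the rows of a twisted Jacobi-Trudi determinant and additional rows `X`. -/
noncomputable def extDet (X : List (ℕ → ℂ)) (A B : List ℤ) : ℂ :=
  rowDet (B.map (kRow (kPow θ t)) ++ (X ++ A.map (hRow (hPow θ t))))

noncomputable def sDet (A B : List ℤ) : ℂ := charDet (hPow θ t) (kPow θ t) A B

theorem extDet_nil (A B : List ℤ) : extDet θ t [] A B = sDet θ t A B := rfl

theorem extDet_hRow (X : List (ℕ → ℂ)) (a : ℤ) (A B : List ℤ) :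
    extDet θ t (X ++ [hRow (hPow θ t) a]) A B = extDet θ t X (a :: A) B := by
  simp [extDet]

theorem extDet_kRow (X : List (ℕ → ℂ)) (b : ℤ) (A B : List ℤ) :
    extDet θ t (kRow (kPow θ t) b :: X) A B = extDet θ t X A (B ++ [b]) := by
  simp [extDet]

theorem extDet_swap (x y : ℕ → ℂ) (A B : List ℤ) :
    extDet θ t [x, y] A B = -extDet θ t [y, x] A B := rowDet_swap _ _ _ _

theorem extDet_plucker (a b c d : ℕ → ℂ) (A B : List ℤ) :
    extDet θ t [a, b] A B * extDet θ t [c, d] A B - extDet θ t [a, c] A B * extDet θ t [b, d] A B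
      + extDet θ t [a, d] A B * extDet θ t [b, c] A B = 0 := rowDet_plucker _ _ _ _ _ _

theorem extDet_smul (c : ℂ) (x : ℕ → ℂ) (A B : List ℤ) :
    extDet θ t [c • x] A B = c * extDet θ t [x] A B := rowDet_smul_row _ _ _ _

theorem extDet_add (x y : ℕ → ℂ) (A B : List ℤ) :
    extDet θ t [x + y] A B = extDet θ t [x] A B + extDet θ t [y] A B := rowDet_add_row _ _ _ _

variable {t} {i j : Fin (N + 1)}

theorem extDet_geomRow (hi : t i ≠ 0) (X : List (ℕ → ℂ)) (A B : List ℤ) :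
    extDet (θ + unitV i) t (geomRow (t i) :: X) A B =
      t i ^ B.length * extDet θ t (X.map (twistDiff (t i))) (A.map (· + 1)) B := by
  have := rowDet_geomRow_charDet hi (hPow (θ + unitV i) t) (kPow (θ + unitV i) t) A B X
  have e1 : (fun n => kPow (θ + unitV i) t n - (t i)⁻¹ * kPow (θ + unitV i) t (n - 1)) = kPow θ t := by
    ext n
    exact (hPow_add_unitV θ (fun i => (t i)⁻¹) i n).symm
  have e2 : (fun n => hPow (θ + unitV i) t n - t i * hPow (θ + unitV i) t (n - 1)) = hPow θ t := by
    ext n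
    exact (hPow_add_unitV θ t i n).symm
  rw [e1, e2] at this
  exact this

theorem hasDerivAt_kPow (hi : t i ≠ 0) (n : ℤ) :
    HasDerivAt (fun s => kPow θ (Function.update t i s) n)
      (-θ i * (((t i) ^ 2)⁻¹ * kPow (θ + unitV i) t (n - 1))) (t i) := by
  have h1 := hasDerivAt_hPow θ (fun i => (t i)⁻¹) i n
  have h2 := HasDerivAt.comp (t i) h1 (hasDerivAt_inv hi)
  have h3 : (fun s => kPow θ (Function.update t i s) n) =
      (fun s => hPow θ (Function.update (fun i => (t i)⁻¹) i s) n) ∘ Inv.inv := by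
    ext s
    simp only [kPow, Function.comp_apply]
    congr 1
    ext l
    rcases eq_or_ne l i with rfl | h
    · simp
    · simp [Function.update_of_ne h]
  rw [h3]
  refine h2.congr_deriv ?_
  rw [kPow]
  ring

/-- Freeze the sequences `H`, `K` at `θ + e_i` and form the determinant of `H_n - s H_{n-1}`, `K_n -
s⁻¹ K_{n-1}`. At `s = t_i` it is the determinant at `θ`, and its entries have derivatives that
become the true ones after multiplication by `-θ_i`. Times `s^|B|` it is also the determinant with a
geometric row, whose derivative has the row `geomRow'`; the product rule relates the two. -/
theorem hasDerivAt_sDet (hi : t i ≠ 0) (A B : List ℤ) :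
    ∃ d, HasDerivAt (fun s => sDet θ (Function.update t i s) (A.map (· + 1)) B) (-θ i * d) (t i) ∧
      extDet (θ + unitV i) t [geomRow' (t i)] A B =
        B.length * t i ^ (B.length - 1) * sDet θ t (A.map (· + 1)) B + t i ^ B.length * d := by
  set H := hPow (θ + unitV i) t with hH
  set K := kPow (θ + unitV i) t with hK
  obtain ⟨d, h1, h2⟩ := exists_hasDerivAt_charDet (s := t i) (c := -θ i)
    (h := fun s n => H n - s * H (n - 1)) (k := fun s n => K n - s⁻¹ * K (n - 1))
    (h' := fun n => -H (n - 1)) (k' := fun n => ((t i) ^ 2)⁻¹ * K (n - 1))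
    (h₂ := fun s => hPow θ (Function.update t i s)) (k₂ := fun s => kPow θ (Function.update t i s))
    (fun n => by simpa using ((hasDerivAt_id (t i)).mul_const (H (n - 1))).const_sub (H n))
    (fun n => by simpa using ((hasDerivAt_inv hi).mul_const (K (n - 1))).const_sub (K n))
    (fun n => by simpa using hasDerivAt_hPow θ t i n)
    (fun n => hasDerivAt_kPow θ hi n)
    (fun n => by rw [Function.update_eq_self]; exact hPow_add_unitV θ t i n)
    (fun n => by rw [Function.update_eq_self]; exact hPow_add_unitV θ (fun i => (t i)⁻¹) i n)
    (A.map (· + 1)) B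
  refine ⟨d, h2, ?_⟩
  have h3 : HasDerivAt (fun s => rowDet (B.map (kRow K) ++ geomRow s :: A.map (hRow H)))
      (extDet (θ + unitV i) t [geomRow' (t i)] A B) (t i) := hasDerivAt_rowDet_geomRow _ _ _
  have h4 := (hasDerivAt_pow B.length (t i)).mul h1
  have h5 : (fun s => rowDet (B.map (kRow K) ++ geomRow s :: A.map (hRow H))) =ᶠ[nhds (t i)]
      ((fun s => s ^ B.length) * fun s => charDet (fun n => H n - s * H (n - 1))
        (fun n => K n - s⁻¹ * K (n - 1)) (A.map (· + 1)) B) := by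
    filter_upwards [isOpen_ne.mem_nhds hi] with s hs
    exact rowDet_geomRow_charDet hs H K A B []
  have h6 := h3.unique (h4.congr_of_eventuallyEq h5)
  rw [h6, sDet]
  congr 3
  · ext n
    exact (hPow_add_unitV θ t i n).symm
  · ext n
    exact (hPow_add_unitV θ (fun i => (t i)⁻¹) i n).symm

theorem extDet_geomRow_geomRow (hi : t i ≠ 0) (hj : t j ≠ 0) (A B : List ℤ) :
    extDet (θ + unitV i + unitV j) t [geomRow (t i), geomRow (t j)] A B =
      t i ^ B.length * t j ^ B.length * (t j - t i) * sDet θ t (A.map (· + 2)) B := by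
  rw [add_right_comm, extDet_geomRow _ hi, List.map_singleton, twistDiff_geomRow, extDet_smul,
    extDet_geomRow _ hj, List.map_nil, extDet_nil, List.map_map]
  simp only [Function.comp_def, add_assoc]
  norm_num
  ring

/-- The Plücker relation at `θ + e_i + e_j` for the rows `t_i^j`, `t_j^j`, `k_b`, `h_a`. -/
theorem sDet_bilinear_one (hi : t i ≠ 0) (hj : t j ≠ 0) (a b : ℤ) (A B : List ℤ) :
    (t i - t j) * (sDet θ t (A.map (· + 2)) B *
        sDet (θ + unitV i + unitV j) t (a :: A) (B ++ [b])) =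
      t i * (sDet (θ + unitV i) t ((a :: A).map (· + 1)) B *
        sDet (θ + unitV j) t (A.map (· + 1)) (B ++ [b]))
      - t j * (sDet (θ + unitV j) t ((a :: A).map (· + 1)) B *
        sDet (θ + unitV i) t (A.map (· + 1)) (B ++ [b])) := by
  set η := θ + unitV i + unitV j with hη
  have hη' : η = θ + unitV j + unitV i := add_right_comm _ _ _
  have h := extDet_plucker η t (geomRow (t i)) (geomRow (t j)) (kRow (kPow η t) b)
    (hRow (hPow η t) a) A B
  have e0 : extDet η t [kRow (kPow η t) b, hRow (hPow η t) a] A B = sDet η t (a :: A) (B ++ [b]) := by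
    rw [extDet_kRow, ← List.nil_append [hRow _ _], extDet_hRow, extDet_nil]
  have e1 : extDet η t [geomRow (t i), hRow (hPow η t) a] A B =
      t i ^ B.length * sDet (θ + unitV j) t ((a :: A).map (· + 1)) B := by
    rw [← List.singleton_append, extDet_hRow, hη', extDet_geomRow _ hi, List.map_nil, extDet_nil]
  have e2 : extDet η t [geomRow (t j), hRow (hPow η t) a] A B =
      t j ^ B.length * sDet (θ + unitV i) t ((a :: A).map (· + 1)) B := by
    rw [← List.singleton_append, extDet_hRow, hη, extDet_geomRow _ hj, List.map_nil, extDet_nil]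
  -- Here the geometric row passes one more `k`-row; the resulting extra factor `t i` becomes a
  -- coefficient of the bilinear equation.
  have e3 : extDet η t [geomRow (t i), kRow (kPow η t) b] A B =
      -(t i ^ (B.length + 1) * sDet (θ + unitV j) t (A.map (· + 1)) (B ++ [b])) := by
    rw [extDet_swap, extDet_kRow, hη', extDet_geomRow _ hi, List.map_nil, extDet_nil]
    simp
  have e4 : extDet η t [geomRow (t j), kRow (kPow η t) b] A B =
      -(t j ^ (B.length + 1) * sDet (θ + unitV i) t (A.map (· + 1)) (B ++ [b])) := by
    rw [extDet_swap, extDet_kRow, hη, extDet_geomRow _ hj, List.map_nil, extDet_nil]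
    simp
  rw [extDet_geomRow_geomRow θ hi hj, e0, e1, e2, e3, e4] at h
  have hne : t i ^ B.length * t j ^ B.length ≠ 0 := by positivity
  apply mul_left_cancel₀ hne
  linear_combination -h

/-- The geometric row lowers `θ_i` once and turns the derivative row into another geometric row,
which lowers it again. -/
theorem extDet_geomRow_geomRow' (hi : t i ≠ 0) (A B : List ℤ) :
    extDet (θ + unitV i) t [geomRow (t i), geomRow' (t i)] A B =
      t i ^ B.length * t i ^ B.length * sDet (θ - unitV i) t (A.map (· + 2)) B := by
  have h1 := extDet_geomRow (θ - unitV i) hi [] (A.map (· + 1)) B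
  rw [sub_add_cancel] at h1
  rw [extDet_geomRow _ hi, List.map_singleton, twistDiff_geomRow', sub_self, zero_smul, add_zero, h1,
    List.map_nil, extDet_nil, List.map_map]
  simp only [Function.comp_def, add_assoc]
  norm_num
  ring

/-- The Plücker relation at `θ + e_i` for `t_i^j`, its derivative, `k_b` and `h_a`. The product-rule
terms have coefficients `|B|` and `|B| + 1`; their difference leaves the undifferentiated term. -/
theorem sDet_bilinear_two (hi : t i ≠ 0) (a b : ℤ) (A B : List ℤ) :
    ∃ p₁ p₂, HasDerivAt (fun s => sDet θ (Function.update t i s) ((a :: A).map (· + 1)) B) p₁ (t i) ∧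
      HasDerivAt (fun s => sDet θ (Function.update t i s) (A.map (· + 1)) (B ++ [b])) p₂ (t i) ∧
      t i * (p₁ * sDet θ t (A.map (· + 1)) (B ++ [b]) - sDet θ t ((a :: A).map (· + 1)) B * p₂)
        + θ i * (sDet θ t ((a :: A).map (· + 1)) B * sDet θ t (A.map (· + 1)) (B ++ [b])) =
      θ i * (sDet (θ - unitV i) t (A.map (· + 2)) B * sDet (θ + unitV i) t (a :: A) (B ++ [b])) := by
  obtain ⟨d₁, h1, h1'⟩ := hasDerivAt_sDet θ hi (a :: A) B
  obtain ⟨d₂, h2, h2'⟩ := hasDerivAt_sDet θ hi A (B ++ [b])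
  refine ⟨_, _, h1, h2, ?_⟩
  set η := θ + unitV i with hη
  have h := extDet_plucker η t (geomRow (t i)) (geomRow' (t i)) (kRow (kPow η t) b)
    (hRow (hPow η t) a) A B
  have e0 : extDet η t [kRow (kPow η t) b, hRow (hPow η t) a] A B = sDet η t (a :: A) (B ++ [b]) := by
    rw [extDet_kRow, ← List.nil_append [hRow _ _], extDet_hRow, extDet_nil]
  have e1 : extDet η t [geomRow (t i), hRow (hPow η t) a] A B =
      t i ^ B.length * sDet θ t ((a :: A).map (· + 1)) B := by
    rw [← List.singleton_append, extDet_hRow, hη, extDet_geomRow _ hi, List.map_nil, extDet_nil]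
  have e2 : extDet η t [geomRow' (t i), hRow (hPow η t) a] A B =
      extDet η t [geomRow' (t i)] (a :: A) B := by
    rw [← List.singleton_append, extDet_hRow]
  have e3 : extDet η t [geomRow (t i), kRow (kPow η t) b] A B =
      -(t i ^ (B.length + 1) * sDet θ t (A.map (· + 1)) (B ++ [b])) := by
    rw [extDet_swap, extDet_kRow, hη, extDet_geomRow _ hi, List.map_nil, extDet_nil]
    simp
  have e4 : extDet η t [geomRow' (t i), kRow (kPow η t) b] A B =
      -extDet η t [geomRow' (t i)] A (B ++ [b]) := by
    rw [extDet_swap, extDet_kRow]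
  rw [extDet_geomRow_geomRow' θ hi, e0, e1, e2, e3, e4, h1', h2'] at h
  simp only [List.length_append, List.length_singleton, Nat.add_sub_cancel] at h
  have hne : t i ^ B.length * t i ^ B.length ≠ 0 := by positivity
  apply mul_left_cancel₀ hne
  -- For empty `B` the truncated exponent is harmless because its coefficient is zero.
  have hpow : (B.length : ℂ) * t i ^ (B.length - 1) * t i = B.length * t i ^ B.length := by
    rcases hB : B.length with _ | l
    · simp
    · simp [pow_succ, mul_assoc]
  push_cast at h
  linear_combination -θ i * h + θ i * t i ^ B.length * sDet θ t (A.map (· + 1)) (B ++ [b])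
    * sDet θ t ((a :: A).map (· + 1)) B * hpow

/-- The Plücker relation at `θ + e_i` for `t_i^j`, its derivative, `t_j^j` and `h_a`. Both
derivative terms carry the coefficient `|B|` and cancel; the undifferentiated term comes from
`twistDiff_geomRow'`. -/
theorem sDet_bilinear_three (hi : t i ≠ 0) (hj : t j ≠ 0) (hij : i ≠ j) (a : ℤ) (A B : List ℤ) :
    ∃ p₁ p₂,
      HasDerivAt (fun s => sDet (θ - unitV j) (Function.update t i s) (A.map (· + 2)) B) p₁ (t i) ∧
      HasDerivAt (fun s => sDet θ (Function.update t i s) ((a :: A).map (· + 1)) B) p₂ (t i) ∧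
      (t j - t i) * (p₁ * sDet θ t ((a :: A).map (· + 1)) B
          - sDet (θ - unitV j) t (A.map (· + 2)) B * p₂)
        + θ i * (sDet (θ - unitV j) t (A.map (· + 2)) B * sDet θ t ((a :: A).map (· + 1)) B) =
      θ i * (sDet (θ - unitV i) t (A.map (· + 2)) B *
        sDet (θ + unitV i - unitV j) t ((a :: A).map (· + 1)) B) := by
  obtain ⟨d₁, h1, h1'⟩ := hasDerivAt_sDet (θ - unitV j) hi (A.map (· + 1)) B
  obtain ⟨d₂, h2, h2'⟩ := hasDerivAt_sDet θ hi (a :: A) B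
  have hA : (A.map (· + 1)).map (· + 1) = A.map fun z : ℤ => z + 2 := by
    rw [List.map_map]
    exact List.map_congr_left fun z _ => by simp [add_assoc]
  rw [hA] at h1 h1'
  have hθ : (θ - unitV j) i = θ i := by simp [unitV, hij]
  rw [hθ] at h1
  refine ⟨_, _, h1, h2, ?_⟩
  set η := θ + unitV i with hη
  have hη' : η = η - unitV j + unitV j := (sub_add_cancel _ _).symm
  have hη₂ : η - unitV j = θ - unitV j + unitV i := (sub_add_eq_add_sub _ _ _).symm
  have h := extDet_plucker η t (geomRow (t i)) (geomRow' (t i)) (geomRow (t j))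
    (hRow (hPow η t) a) A B
  have e0 : extDet η t [geomRow (t i), geomRow (t j)] A B =
      t i ^ B.length * t j ^ B.length * (t j - t i) * sDet (θ - unitV j) t (A.map (· + 2)) B := by
    rw [hη', hη₂, extDet_geomRow_geomRow _ hi hj]
  have e1 : extDet η t [geomRow (t i), hRow (hPow η t) a] A B =
      t i ^ B.length * sDet θ t ((a :: A).map (· + 1)) B := by
    rw [← List.singleton_append, extDet_hRow, hη, extDet_geomRow _ hi, List.map_nil, extDet_nil]
  have e2 : extDet η t [geomRow' (t i), hRow (hPow η t) a] A B =
      extDet η t [geomRow' (t i)] (a :: A) B := by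
    rw [← List.singleton_append, extDet_hRow]
  have e3 : extDet η t [geomRow (t j), hRow (hPow η t) a] A B =
      t j ^ B.length * sDet (η - unitV j) t ((a :: A).map (· + 1)) B := by
    rw [← List.singleton_append, extDet_hRow]
    conv_lhs => rw [hη']
    rw [extDet_geomRow _ hj, List.map_nil, extDet_nil]
  have e4 : extDet η t [geomRow' (t i), geomRow (t j)] A B =
      -(t j ^ B.length * (t i ^ B.length * sDet (θ - unitV j) t (A.map (· + 2)) B +
        (t i - t j) * (B.length * t i ^ (B.length - 1) * sDet (θ - unitV j) t (A.map (· + 2)) B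
          + t i ^ B.length * d₁))) := by
    rw [extDet_swap, hη', extDet_geomRow _ hj, List.map_singleton, twistDiff_geomRow', extDet_add,
      extDet_smul, hη₂, h1', extDet_geomRow _ hi, List.map_nil, extDet_nil, hA]
  rw [extDet_geomRow_geomRow' θ hi, e0, e1, e2, e3, e4, h2'] at h
  have hne : t i ^ B.length * t i ^ B.length * t j ^ B.length ≠ 0 := by positivity
  apply mul_left_cancel₀ hne
  linear_combination -θ i * h

end powerSumBilinear

/-! ### Partial derivatives -/

section partialD

variable {N : ℕ} {F G : (Fin (N + 1) → ℂ) → ℂ} {t : Fin (N + 1) → ℂ}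

theorem partialD_eq_fderiv (hF : DifferentiableAt ℂ F t) (i : Fin (N + 1)) :
    partialD i F t = fderiv ℂ F t (Pi.single i 1) := by
  have h1 : HasFDerivAt F (fderiv ℂ F t) (Function.update t i (t i)) := by
    rw [Function.update_eq_self]
    exact hF.hasFDerivAt
  exact (h1.comp_hasDerivAt (t i) (hasDerivAt_update t i (t i))).deriv

theorem sum_mul_partialD (hF : DifferentiableAt ℂ F t) :
    ∑ i, t i * partialD i F t = fderiv ℂ F t t := by
  have h := congrArg (fderiv ℂ F t) (pi_eq_sum_univ' t)
  rw [map_sum] at h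
  rw [h]
  refine Finset.sum_congr rfl fun i _ => ?_
  rw [partialD_eq_fderiv hF, map_smul, smul_eq_mul]

/-- Euler's relation for homogeneous functions. -/
theorem sum_mul_partialD_of_homogeneous (hF : DifferentiableAt ℂ F t) {d : ℤ}
    (h : ∀ c : ℂ, c ≠ 0 → F (c • t) = c ^ d * F t) : ∑ i, t i * partialD i F t = d * F t := by
  have h1 : HasDerivAt (fun c : ℂ => c • t) t 1 := by
    simpa using (hasDerivAt_id (1 : ℂ)).smul_const t
  have h2 : HasFDerivAt F (fderiv ℂ F t) ((1 : ℂ) • t) := by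
    rw [one_smul]
    exact hF.hasFDerivAt
  have h3 := h2.comp_hasDerivAt 1 h1
  have h4 : HasDerivAt (fun c : ℂ => c ^ d * F t) (d * F t) 1 := by
    simpa using (hasDerivAt_zpow d (1 : ℂ) (Or.inl one_ne_zero)).mul_const (F t)
  rw [sum_mul_partialD hF]
  refine h3.unique (h4.congr_of_eventuallyEq ?_)
  filter_upwards [isOpen_ne.mem_nhds (one_ne_zero (α := ℂ))] with c hc
  exact h c hc

end partialD

/-! ### Differentiability, homogeneity and bilinear equations of `σ`. -/

section sigmaUC

variable {N : ℕ}

theorem differentiableAt_kPow (θ : Fin (N + 1) → ℂ) {t : Fin (N + 1) → ℂ} (ht : ∀ i, t i ≠ 0) (n : ℤ) :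
    DifferentiableAt ℂ (fun t => kPow θ t n) t := by
  have h1 : DifferentiableAt ℂ (fun t : Fin (N + 1) → ℂ => fun i => (t i)⁻¹) t :=
    differentiableAt_pi.2 fun i => (differentiableAt_apply i t).inv (ht i)
  exact DifferentiableAt.comp (g := fun u => hPow θ u n) t
    (differentiable_hPow θ n).differentiableAt h1

theorem kPow_smul_zpow (θ t : Fin (N + 1) → ℂ) {c : ℂ} (n : ℤ) :
    kPow θ (c • t) n = c ^ (-n) * kPow θ t n := by
  have h : (fun i => ((c • t) i)⁻¹) = c⁻¹ • fun i => (t i)⁻¹ := by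
    ext i
    simp [mul_comm]
  rw [kPow, h, hPow_smul_zpow, inv_zpow', kPow]

theorem differentiableAt_universalCharacter (lam mu : YoungDiagram) (θ : Fin (N + 1) → ℂ)
    {t : Fin (N + 1) → ℂ} (ht : ∀ i, t i ≠ 0) :
    DifferentiableAt ℂ (fun t => universalCharacter lam mu (powerSumX θ t) (powerSumY θ t)) t := by
  simp only [universalCharacter, Matrix.det_apply']
  refine DifferentiableAt.fun_sum fun s _ => DifferentiableAt.const_mul ?_ _
  refine (HasFDerivAt.finsetProd fun i _ => DifferentiableAt.hasFDerivAt ?_).differentiableAt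
  simp only [Matrix.of_apply]
  split_ifs
  · exact differentiableAt_kPow θ ht _
  · exact (differentiable_hPow θ _).differentiableAt

theorem prod_zpow_eq_zpow_sum {ι : Type*} (s : Finset ι) {c : ℂ} (hc : c ≠ 0) (f : ι → ℤ) :
    ∏ i ∈ s, c ^ f i = c ^ ∑ i ∈ s, f i := by
  classical
  induction s using Finset.induction_on with
  | empty => simp
  | insert a s ha ih => rw [Finset.prod_insert ha, Finset.sum_insert ha, ih, zpow_add₀ hc]

theorem universalCharacter_smul (lam mu : YoungDiagram) (θ t : Fin (N + 1) → ℂ) {c : ℂ}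
    (hc : c ≠ 0) : universalCharacter lam mu (powerSumX θ (c • t)) (powerSumY θ (c • t)) =
      c ^ ((lam.card : ℤ) - mu.card) * universalCharacter lam mu (powerSumX θ t) (powerSumY θ t) := by
  -- The entry at `(i, j)` is homogeneous in `t` of degree `w i + j`, so the determinant has degree
  -- `∑ w i + ∑ j`; the position terms cancel in this sum.
  let w : Fin (mu.colLen 0 + lam.colLen 0) → ℤ := fun i =>
    (if (i : ℕ) < mu.colLen 0 then -(mu.rowLen (mu.colLen 0 - 1 - i) : ℤ)
      else lam.rowLen (i - mu.colLen 0)) - (i : ℕ)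
  have hw : ∑ i, w i + ∑ j : Fin (mu.colLen 0 + lam.colLen 0), ((j : ℕ) : ℤ) =
      (lam.card : ℤ) - mu.card := by
    rw [← Finset.sum_add_distrib]
    simp only [w, sub_add_cancel]
    rw [Fin.sum_univ_add, lam.card_eq_sum_rowLen le_rfl,
      mu.card_eq_sum_rowLen le_rfl, Finset.sum_range, Finset.sum_range]
    simp only [Fin.val_castAdd, Fin.is_lt, if_true, Fin.val_natAdd, Nat.add_sub_cancel_left]
    rw [← Equiv.sum_comp Fin.revPerm (fun r : Fin (mu.colLen 0) => mu.rowLen r)]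
    simp [Fin.val_rev, Nat.sub_sub, add_comm, sub_eq_add_neg]
  rw [universalCharacter, universalCharacter, ← hw, zpow_add₀ hc, ← prod_zpow_eq_zpow_sum _ hc,
    ← prod_zpow_eq_zpow_sum _ hc, mul_assoc, ← Matrix.det_mul_row, ← Matrix.det_mul_column]
  congr 1
  ext i j
  simp only [Matrix.of_apply, w]
  split_ifs
  · change kPow θ (c • t) _ = _ * (_ * kPow θ t _)
    rw [kPow_smul_zpow, ← mul_assoc, ← zpow_add₀ hc]
    congr 2
    ring
  · change hPow θ (c • t) _ = _ * (_ * hPow θ t _)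
    rw [hPow_smul_zpow, ← mul_assoc, ← zpow_add₀ hc]

variable {L : ℕ} (hL : 2 ≤ L) (ν ν' : Fin L → ℤ)

theorem differentiableAt_sigmaUC (m n : ℤ) (θ : Fin (N + 1) → ℂ) {t : Fin (N + 1) → ℂ}
    (ht : ∀ i, t i ≠ 0) : DifferentiableAt ℂ (fun t => sigmaUC hL ν ν' m n θ t) t :=
  differentiableAt_universalCharacter _ _ θ ht

theorem sigmaUC_euler (m n : ℤ) (θ : Fin (N + 1) → ℂ) {t : Fin (N + 1) → ℂ} (ht : ∀ i, t i ≠ 0) :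
    ∑ i, t i * partialD i (fun t => sigmaUC hL ν ν' m n θ t) t =
      (degreeUC hL ν ν' m n : ℂ) * sigmaUC hL ν ν' m n θ t :=
  sum_mul_partialD_of_homogeneous (differentiableAt_sigmaUC hL ν ν' m n θ ht) fun _ hc =>
    universalCharacter_smul _ _ θ t hc

theorem exists_sDet_frame (N : ℕ) (m n : ℤ) :
    ∃ (A B : List ℤ) (a b : ℤ) (ε ε' : ℂ), ε * ε = 1 ∧ ε' * ε' = 1 ∧
      ∀ θ t : Fin (N + 1) → ℂ,
        sigmaUC hL ν ν' m n θ t = sDet θ t (A.map (· + 2)) B ∧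
        sigmaUC hL ν ν' (m + 1) n θ t = ε * sDet θ t ((a :: A).map (· + 1)) B ∧
        sigmaUC hL ν ν' m (n + 1) θ t = ε' * sDet θ t (A.map (· + 1)) (B ++ [b]) ∧
        sigmaUC hL ν ν' (m + 1) (n + 1) θ t = ε * ε' * sDet θ t (a :: A) (B ++ [b]) := by
  obtain ⟨h1, h1'⟩ := coreMaya_shiftSeq_add_one hL ν m
  obtain ⟨h2, h2'⟩ := coreMaya_shiftSeq_add_one hL ν' n
  obtain ⟨A, B, a, b, ε, ε', hε, hε', H⟩ := MayaDiagram.exists_charDet_frame h1 h1' h2 h2'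
  exact ⟨A, B, a, b, ε, ε', hε, hε', fun θ t => H (powerSumX θ t) (powerSumY θ t)⟩

variable (m n : ℤ) (θ : Fin (N + 1) → ℂ) {t : Fin (N + 1) → ℂ}

/-- Each product contains one diagram with the added element on either side, so the sorting signs
enter only through the common factor `ε ε'`. -/
theorem sigmaUC_bilinear_one (ht : ∀ k, t k ≠ 0) (i j : Fin (N + 1)) :
    (t i - t j) * (sigmaUC hL ν ν' m n θ t *
        sigmaUC hL ν ν' (m + 1) (n + 1) (θ + unitV i + unitV j) t) =
      t i * (sigmaUC hL ν ν' (m + 1) n (θ + unitV i) t * sigmaUC hL ν ν' m (n + 1) (θ + unitV j) t)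
        - t j * (sigmaUC hL ν ν' (m + 1) n (θ + unitV j) t *
          sigmaUC hL ν ν' m (n + 1) (θ + unitV i) t) := by
  obtain ⟨A, B, a, b, ε, ε', -, -, H⟩ := exists_sDet_frame hL ν ν' N m n
  have h := sDet_bilinear_one θ (ht i) (ht j) a b A B
  simp only [(H _ _).1, (H _ _).2.1, (H _ _).2.2.1, (H _ _).2.2.2]
  linear_combination ε * ε' * h

theorem partialD_of_hasDerivAt {F : (Fin (N + 1) → ℂ) → ℂ} {i : Fin (N + 1)} {G : ℂ → ℂ} {c p : ℂ}
    (h : HasDerivAt G p (t i)) (hF : ∀ s, F (Function.update t i s) = c * G s) :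
    partialD i F t = c * p := by
  rw [partialD]
  simp only [hF]
  exact (h.const_mul c).deriv

theorem sigmaUC_bilinear_two (ht : ∀ k, t k ≠ 0) (i : Fin (N + 1)) :
    t i * hirotaD i (fun t => sigmaUC hL ν ν' (m + 1) n θ t)
        (fun t => sigmaUC hL ν ν' m (n + 1) θ t) t
      + θ i * (sigmaUC hL ν ν' (m + 1) n θ t * sigmaUC hL ν ν' m (n + 1) θ t) =
    θ i * (sigmaUC hL ν ν' m n (θ - unitV i) t *
      sigmaUC hL ν ν' (m + 1) (n + 1) (θ + unitV i) t) := by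
  obtain ⟨A, B, a, b, ε, ε', -, -, H⟩ := exists_sDet_frame hL ν ν' N m n
  obtain ⟨p₁, p₂, h1, h2, h⟩ := sDet_bilinear_two θ (ht i) a b A B
  rw [hirotaD, partialD_of_hasDerivAt h1 fun s => (H _ _).2.1,
    partialD_of_hasDerivAt h2 fun s => (H _ _).2.2.1]
  simp only [(H _ _).1, (H _ _).2.1, (H _ _).2.2.1, (H _ _).2.2.2]
  linear_combination ε * ε' * h

theorem sigmaUC_bilinear_three (ht : ∀ k, t k ≠ 0) (i j : Fin (N + 1)) :
    (t j - t i) * hirotaD i (fun t => sigmaUC hL ν ν' m n (θ - unitV j) t)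
        (fun t => sigmaUC hL ν ν' (m + 1) n θ t) t
      + θ i * (sigmaUC hL ν ν' m n (θ - unitV j) t * sigmaUC hL ν ν' (m + 1) n θ t) =
    θ i * (sigmaUC hL ν ν' m n (θ - unitV i) t *
      sigmaUC hL ν ν' (m + 1) n (θ + unitV i - unitV j) t) := by
  rcases eq_or_ne i j with rfl | hij
  · rw [sub_self, zero_mul, zero_add, add_sub_cancel_right]
  obtain ⟨A, B, a, b, ε, ε', -, -, H⟩ := exists_sDet_frame hL ν ν' N m n
  obtain ⟨p₁, p₂, h1, h2, h⟩ := sDet_bilinear_three θ (ht i) (ht j) hij a A B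
  rw [hirotaD, partialD_of_hasDerivAt h1 fun s => (H _ _).1.trans (one_mul _).symm,
    partialD_of_hasDerivAt h2 fun s => (H _ _).2.1]
  simp only [(H _ _).1, (H _ _).2.1]
  linear_combination ε * h

end sigmaUC

/-! ### Nonvanishing of universal characters -/

section nonvanishing

open Polynomial in
/-- A hypergeometric determinant does not vanish at distinct nodes. -/
theorem hypergeometric_det_ne_zero {n : ℕ} {Θ : ℂ} (hΘ : ∀ z : ℤ, Θ ≠ z) {x : Fin n → ℂ}
    (hx : Function.Injective x) (u : Fin n → ℕ → ℂ)
    (hrec : ∀ i j, (x i + 1 + (j : ℕ)) * u i (j + 1) = (Θ + x i + (j : ℕ)) * u i j)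
    (hu : ∀ i, (u i (n - 1) ≠ 0 ∧ ∀ j : ℕ, Θ + x i + j ≠ 0) ∨
      (u i 0 ≠ 0 ∧ ∀ j : ℕ, x i + 1 + j ≠ 0)) :
    Matrix.det (Matrix.of fun i j : Fin n => u i j) ≠ 0 := by
  -- Polynomials solving the same recursion in `j` for every node, with denominators cleared; all
  -- have degree `n - 1`.
  let p : ℕ → ℂ[X] := fun j =>
    (∏ l ∈ Finset.range j, (X + C (Θ + l))) * ∏ l ∈ Finset.Ico j (n - 1), (X + C (1 + (l : ℂ)))
  have hp : ∀ j y, (p j).eval y = (∏ l ∈ Finset.range j, (y + (Θ + l))) *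
      ∏ l ∈ Finset.Ico j (n - 1), (y + (1 + (l : ℂ))) := by
    intro j y
    simp [p, eval_prod]
  have hprec : ∀ j < n - 1, ∀ y, (y + 1 + j) * (p (j + 1)).eval y = (Θ + y + j) * (p j).eval y := by
    intro j hj y
    rw [hp, hp, Finset.prod_range_succ, Finset.prod_eq_prod_Ico_succ_bot hj]
    ring
  -- Each row is proportional to the values of the `p j`. The recursion is run down from the last
  -- entry or up from the first, whichever direction divides by nonzero factors.
  have hγ : ∀ i, ∃ γ : ℂ, γ ≠ 0 ∧ ∀ j ≤ n - 1, u i j = γ * (p j).eval (x i) := by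
    intro i
    rcases hu i with ⟨h1, h2⟩ | ⟨h1, h2⟩
    · have hne : (p (n - 1)).eval (x i) ≠ 0 := by
        rw [hp]
        simp only [Finset.Ico_self, Finset.prod_empty, mul_one]
        exact Finset.prod_ne_zero_iff.2 fun l _ => by
          have := h2 l
          rwa [← add_assoc, add_comm (x i)]
      refine ⟨u i (n - 1) / (p (n - 1)).eval (x i), div_ne_zero h1 hne, fun j hj => ?_⟩
      induction hj using Nat.decreasingInduction with
      | self => rw [div_mul_cancel₀ _ hne]
      | of_succ j hj ih =>
        apply mul_left_cancel₀ (h2 j)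
        rw [← hrec, ih, mul_left_comm, hprec j hj]
        ring
    · have hne : (p 0).eval (x i) ≠ 0 := by
        rw [hp]
        simp only [Finset.range_zero, Finset.prod_empty, one_mul]
        exact Finset.prod_ne_zero_iff.2 fun l _ => by
          have := h2 l
          rwa [← add_assoc]
      refine ⟨u i 0 / (p 0).eval (x i), div_ne_zero h1 hne, fun j hj => ?_⟩
      induction j with
      | zero => rw [div_mul_cancel₀ _ hne]
      | succ j ih =>
        apply mul_left_cancel₀ (h2 j)
        rw [hrec, ih (by omega), mul_left_comm (x i + 1 + (j : ℂ)), hprec j (by omega)]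
        ring
  choose γ hγ0 hγ1 using hγ
  have hmat : (Matrix.of fun i j : Fin n => u i j) =
      Matrix.of fun i j : Fin n => γ i * (Matrix.of fun i j : Fin n => (p j).eval (x i)) i j := by
    ext i j
    have := j.2
    exact hγ1 i j (by omega)
  rw [hmat, Matrix.det_mul_column]
  refine mul_ne_zero (Finset.prod_ne_zero_iff.2 fun i _ => hγ0 i) fun h0 => ?_
  obtain ⟨c, hc0, hc⟩ := Matrix.exists_mulVec_eq_zero_iff.2 h0
  -- A relation among the columns is a polynomial of degree at most `n - 1` with `n` distinct zeros.
  have hQ : ∑ j : Fin n, C (c j) * p j = 0 := by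
    refine eq_zero_of_natDegree_lt_card_of_eval_eq_zero _ hx (fun i => ?_) ?_
    · have := congrFun hc i
      simp only [Matrix.mulVec, dotProduct, Matrix.of_apply, Pi.zero_apply] at this
      rw [eval_finsetSum, ← this]
      exact Finset.sum_congr rfl fun j _ => by rw [eval_C_mul, mul_comm]
    · rw [Fintype.card_fin]
      have hn : 0 < n := by
        rcases Nat.eq_zero_or_pos n with rfl | h
        · exact absurd (Subsingleton.elim c 0) hc0
        · exact h
      refine (natDegree_sum_le_of_forall_le (n := n - 1) _ _ fun j _ => ?_).trans_lt (by omega)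
      refine (natDegree_C_mul_le _ _).trans (natDegree_mul_le.trans ?_)
      have hj := j.2
      have e1 := natDegree_prod_le (Finset.range j) fun l => (X + C (Θ + l) : ℂ[X])
      have e2 := natDegree_prod_le (Finset.Ico (j : ℕ) (n - 1)) fun l => (X + C (1 + (l : ℂ)) : ℂ[X])
      simp only [natDegree_X_add_C, Finset.sum_const, smul_eq_mul, mul_one, Finset.card_range,
        Nat.card_Ico] at e1 e2
      omega
  -- At `-Θ - i` all `p j` with `j > i` vanish, and `p i` does not because `Θ` is not an integer;
  -- the coefficients below `i` are gone by induction.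
  have hc' : ∀ i : ℕ, ∀ hi : i < n, c ⟨i, hi⟩ = 0 := by
    intro i
    induction i using Nat.strong_induction_on with
    | _ i ih =>
      intro hi
      have h1 := congrArg (eval (-Θ - i)) hQ
      rw [eval_finsetSum, eval_zero, Finset.sum_eq_single ⟨i, hi⟩, eval_C_mul, hp] at h1
      · refine (mul_eq_zero.1 h1).resolve_right (mul_ne_zero ?_ ?_)
        · refine Finset.prod_ne_zero_iff.2 fun l hl h => ?_
          have h2 : (l : ℂ) = i := by linear_combination h
          have h4 : l < i := Finset.mem_range.1 hl
          have h3 : l = i := by exact_mod_cast h2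
          omega
        · refine Finset.prod_ne_zero_iff.2 fun l _ h => ?_
          refine hΘ (1 + l - i) ?_
          push_cast
          linear_combination -h
      · intro j _ hj
        rw [eval_C_mul]
        rcases lt_or_gt_of_ne (fun h => hj (Fin.ext h) : (j : ℕ) ≠ i) with h | h
        · rw [ih j h j.2, zero_mul]
        · rw [hp, Finset.prod_eq_zero (Finset.mem_range.2 h), zero_mul, mul_zero]
          ring
      · simp
  exact hc0 (funext fun i => hc' i i.2)

variable {N : ℕ}

theorem hPow_one_ne_zero {θ : Fin (N + 1) → ℂ} (hΘ : ∀ z : ℤ, ∑ i, θ i ≠ z) {n : ℤ} (hn : 0 ≤ n) :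
    hPow θ 1 n ≠ 0 := by
  lift n to ℕ using hn
  induction n with
  | zero => simp [hPow_zero]
  | succ n ih =>
    intro h
    have h1 := hPow_one_recursion θ n
    push_cast at h h1
    rw [h, mul_zero] at h1
    refine (mul_ne_zero (fun h2 => hΘ (-n) ?_) ih) h1.symm
    push_cast
    linear_combination h2

theorem universalCharacter_ne_zero (lam mu : YoungDiagram) {θ : Fin (N + 1) → ℂ}
    (hΘ : ∀ z : ℤ, ∑ i, θ i ≠ z) :
    universalCharacter lam mu (powerSumX θ 1) (powerSumY θ 1) ≠ 0 := by
  have hY : powerSumY θ 1 = powerSumX θ 1 := by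
    rw [powerSumY_eq]
    congr 1
    ext i
    simp
  rw [hY, universalCharacter]
  set q := mu.colLen 0 with hq
  set n := q + lam.colLen 0 with hn
  let b : Fin n → ℤ := fun i => (mu.rowLen (q - 1 - i) : ℤ) + (i : ℕ)
  let a : Fin n → ℤ := fun i => (lam.rowLen (i - q) : ℤ) - (i : ℕ)
  have hmat : (Matrix.of fun i j : Fin n => if (i : ℕ) < q then
        completeH (powerSumX θ 1) ((mu.rowLen (q - 1 - i) : ℤ) + (i : ℕ) - (j : ℕ))
      else completeH (powerSumX θ 1) ((lam.rowLen (i - q) : ℤ) - (i : ℕ) + (j : ℕ))) =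
      Matrix.of fun i j : Fin n => (fun (i : Fin n) (j : ℕ) =>
        if (i : ℕ) < q then hPow θ 1 (b i - j) else hPow θ 1 (a i + j)) i j := rfl
  rw [hmat]
  -- The recursion of `h_n` runs forward along `h`-rows and backward along `k`-rows, giving the
  -- nodes `a i` and `-Θ - b i`. They are strictly monotone within each block, and non-integrality
  -- of `Θ` separates the blocks.
  refine hypergeometric_det_ne_zero hΘ
    (x := fun i => if (i : ℕ) < q then -∑ i, θ i - b i else a i) ?_
    (fun (i : Fin n) (j : ℕ) => if (i : ℕ) < q then hPow θ 1 (b i - j) else hPow θ 1 (a i + j)) ?_ ?_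
  · intro i j hij
    simp only at hij
    have hb : ∀ i j : Fin n, (i : ℕ) < j → b i < b j := by
      intro i j h
      have := mu.rowLen_anti (q - 1 - j) (q - 1 - i) (by omega)
      simp only [b]
      omega
    have ha : ∀ i j : Fin n, (i : ℕ) < j → a j < a i := by
      intro i j h
      have := lam.rowLen_anti (i - q) (j - q) (by omega)
      simp only [a]
      omega
    split_ifs at hij with h1 h2 h2
    · have h3 : b i = b j := by
        have : (b i : ℂ) = b j := by linear_combination -hij
        exact_mod_cast this
      rcases lt_trichotomy (i : ℕ) j with h | h | h
      · exact absurd h3 (hb _ _ h).ne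
      · exact Fin.ext h
      · exact absurd h3 (hb _ _ h).ne'
    · refine absurd ?_ (hΘ (-b i - a j))
      push_cast
      linear_combination -hij
    · refine absurd ?_ (hΘ (-b j - a i))
      push_cast
      linear_combination hij
    · have h3 : a i = a j := by exact_mod_cast hij
      rcases lt_trichotomy (i : ℕ) j with h | h | h
      · exact absurd h3 (ha _ _ h).ne'
      · exact Fin.ext h
      · exact absurd h3 (ha _ _ h).ne
  · intro i j
    split_ifs with h
    · have := hPow_one_recursion θ (b i - j - 1)
      rw [sub_add_cancel] at this
      rw [show b i - ((j + 1 : ℕ) : ℤ) = b i - j - 1 by push_cast; ring]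
      push_cast at this ⊢
      linear_combination this
    · have := hPow_one_recursion θ (a i + j)
      rw [show a i + ((j + 1 : ℕ) : ℤ) = a i + j + 1 by push_cast; ring]
      push_cast at this ⊢
      linear_combination this
  · intro i
    have hi := i.2
    split_ifs with h
    · refine Or.inr ⟨hPow_one_ne_zero hΘ ?_, fun j hj => hΘ (1 + j - b i) ?_⟩
      · simp only [b]
        omega
      · push_cast
        linear_combination -hj
    · refine Or.inl ⟨hPow_one_ne_zero hΘ ?_, fun j hj => hΘ (-a i - j) ?_⟩
      · simp only [a]
        omega
      · push_cast
        linear_combination hj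

end nonvanishing

/-! ### Rational functions -/

namespace IsRationalOn

variable {N : ℕ} {R : Set ((Fin (N + 1) → ℂ) × (Fin (N + 1) → ℂ))}
  {F G : (Fin (N + 1) → ℂ) → (Fin (N + 1) → ℂ) → ℂ}

theorem congr (hF : IsRationalOn R F) (h : ∀ p ∈ R, G p.1 p.2 = F p.1 p.2) : IsRationalOn R G := by
  obtain ⟨P, Q, hPQ⟩ := hF
  exact ⟨P, Q, fun p hp => ⟨(hPQ p hp).1, by rw [h p hp, (hPQ p hp).2]⟩⟩

theorem of_eval (P : MvPolynomial (Fin (N + 1) ⊕ Fin (N + 1)) ℂ) :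
    IsRationalOn R fun θ t => MvPolynomial.eval (Sum.elim θ t) P :=
  ⟨P, 1, fun p _ => by simp⟩

theorem const (c : ℂ) : IsRationalOn R fun _ _ => c := by
  simpa using of_eval (R := R) (MvPolynomial.C c)

theorem fst (i : Fin (N + 1)) : IsRationalOn R fun θ _ => θ i := by
  simpa using of_eval (R := R) (MvPolynomial.X (Sum.inl i))

theorem snd (i : Fin (N + 1)) : IsRationalOn R fun _ t => t i := by
  simpa using of_eval (R := R) (MvPolynomial.X (Sum.inr i))

theorem add (hF : IsRationalOn R F) (hG : IsRationalOn R G) :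
    IsRationalOn R fun θ t => F θ t + G θ t := by
  obtain ⟨P, Q, hPQ⟩ := hF
  obtain ⟨P', Q', hPQ'⟩ := hG
  refine ⟨P * Q' + Q * P', Q * Q', fun p hp => ⟨?_, ?_⟩⟩
  · rw [map_mul]
    exact mul_ne_zero (hPQ p hp).1 (hPQ' p hp).1
  · change F p.1 p.2 + G p.1 p.2 = _
    rw [map_add, map_mul, map_mul, map_mul, (hPQ p hp).2, (hPQ' p hp).2,
      div_add_div _ _ (hPQ p hp).1 (hPQ' p hp).1]

theorem mul (hF : IsRationalOn R F) (hG : IsRationalOn R G) :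
    IsRationalOn R fun θ t => F θ t * G θ t := by
  obtain ⟨P, Q, hPQ⟩ := hF
  obtain ⟨P', Q', hPQ'⟩ := hG
  refine ⟨P * P', Q * Q', fun p hp => ⟨?_, ?_⟩⟩
  · rw [map_mul]
    exact mul_ne_zero (hPQ p hp).1 (hPQ' p hp).1
  · change F p.1 p.2 * G p.1 p.2 = _
    rw [map_mul, map_mul, (hPQ p hp).2, (hPQ' p hp).2, div_mul_div_comm]

theorem inv (hF : IsRationalOn R F) (h0 : ∀ p ∈ R, F p.1 p.2 ≠ 0) :
    IsRationalOn R fun θ t => (F θ t)⁻¹ := by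
  obtain ⟨P, Q, hPQ⟩ := hF
  refine ⟨Q, P, fun p hp => ⟨fun h => h0 p hp ?_, ?_⟩⟩
  · rw [(hPQ p hp).2, h, zero_div]
  · change (F p.1 p.2)⁻¹ = _
    rw [(hPQ p hp).2, inv_div]

theorem div (hF : IsRationalOn R F) (hG : IsRationalOn R G) (h0 : ∀ p ∈ R, G p.1 p.2 ≠ 0) :
    IsRationalOn R fun θ t => F θ t / G θ t := by
  simpa only [div_eq_mul_inv] using hF.mul (hG.inv h0)

theorem sum {ι : Type*} (s : Finset ι) {F : ι → (Fin (N + 1) → ℂ) → (Fin (N + 1) → ℂ) → ℂ}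
    (hF : ∀ i ∈ s, IsRationalOn R (F i)) : IsRationalOn R fun θ t => ∑ i ∈ s, F i θ t := by
  classical
  induction s using Finset.induction_on with
  | empty => simpa using const (R := R) 0
  | insert a s ha ih =>
    simp only [Finset.sum_insert ha]
    exact (hF a (Finset.mem_insert_self a s)).add
      (ih fun i hi => hF i (Finset.mem_insert_of_mem hi))

theorem prod {ι : Type*} (s : Finset ι) {F : ι → (Fin (N + 1) → ℂ) → (Fin (N + 1) → ℂ) → ℂ}
    (hF : ∀ i ∈ s, IsRationalOn R (F i)) : IsRationalOn R fun θ t => ∏ i ∈ s, F i θ t := by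
  classical
  induction s using Finset.induction_on with
  | empty => simpa using const (R := R) 1
  | insert a s ha ih =>
    simp only [Finset.prod_insert ha]
    exact (hF a (Finset.mem_insert_self a s)).mul
      (ih fun i hi => hF i (Finset.mem_insert_of_mem hi))

theorem pow (hF : IsRationalOn R F) (n : ℕ) : IsRationalOn R fun θ t => F θ t ^ n := by
  simpa using prod (Finset.range n) fun _ _ => hF

theorem hPow {a b : Fin (N + 1) → (Fin (N + 1) → ℂ) → (Fin (N + 1) → ℂ) → ℂ}
    (ha : ∀ i, IsRationalOn R (a i)) (hb : ∀ i, IsRationalOn R (b i)) (n : ℤ) :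
    IsRationalOn R fun θ t => hPow (fun i => a i θ t) (fun i => b i θ t) n := by
  rcases lt_or_ge n 0 with hn | hn
  · simpa only [hPow_of_neg _ _ hn] using const (R := R) 0
  lift n to ℕ using hn
  induction n using Nat.strong_induction_on with
  | _ n ih =>
    rcases n with _ | n
    · simpa only [Nat.cast_zero, hPow_zero] using const (R := R) 1
    · have hn : (n : ℂ) + 1 ≠ 0 := by exact_mod_cast Nat.succ_ne_zero n
      refine ((const ((n : ℂ) + 1)⁻¹).mul (sum (Finset.range (n + 1)) fun k hk =>
        (sum Finset.univ fun i _ => (ha i).mul ((hb i).pow (k + 1))).mul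
          (ih (n - k) (by omega)))).congr fun p _ => ?_
      rw [← hPow_recursion, inv_mul_cancel_left₀ hn]

theorem universalCharacter (lam mu : YoungDiagram) (v : Fin (N + 1) → ℂ)
    (hR : ∀ p ∈ R, ∀ i, p.2 i ≠ 0) :
    IsRationalOn R fun θ t => universalCharacter lam mu (powerSumX (θ + v) t) (powerSumY (θ + v) t) := by
  have hθ : ∀ i, IsRationalOn R fun θ _ => (θ + v) i := fun i => (fst i).add (const (v i))
  simp only [_root_.universalCharacter, Matrix.det_apply']
  refine sum _ fun s _ => (const _).mul (prod _ fun i _ => ?_)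
  simp only [Matrix.of_apply]
  split_ifs
  · exact hPow hθ (fun i => (snd i).inv fun p hp => hR p hp i) _
  · exact hPow hθ snd _

end IsRationalOn

/-! ### Density -/

/-- A polynomial that vanishes on a product of infinite sets is zero, and balls for the sup metric
are such products. -/
theorem MvPolynomial.dense_eval_ne_zero {N : ℕ} {W : MvPolynomial (Fin (N + 1) ⊕ Fin (N + 1)) ℂ}
    (hW : W ≠ 0) :
    Dense {p : (Fin (N + 1) → ℂ) × (Fin (N + 1) → ℂ) | eval (Sum.elim p.1 p.2) W ≠ 0} := by
  rw [Metric.dense_iff]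
  intro p r hr
  by_contra hemp
  refine hW (funext_set (fun k => Metric.ball (Sum.elim p.1 p.2 k) r) (fun k => ?_) fun x hx => ?_)
  · exact infinite_of_mem_nhds _ (Metric.ball_mem_nhds _ hr)
  · rw [map_zero]
    by_contra hne
    refine hemp ⟨(fun i => x (Sum.inl i), fun i => x (Sum.inr i)), ?_, ?_⟩
    · rw [Metric.mem_ball, Prod.dist_eq, max_lt_iff, dist_pi_lt_iff hr, dist_pi_lt_iff hr]
      exact ⟨fun i => hx (Sum.inl i) trivial, fun i => hx (Sum.inr i) trivial⟩
    · have : Sum.elim (fun i => x (Sum.inl i)) (fun i => x (Sum.inr i)) = x := by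
        ext (i | i) <;> rfl
      rwa [Set.mem_ofPred_eq, this]

section density

variable {N L : ℕ} (hL : 2 ≤ L) (ν ν' : Fin L → ℤ)

theorem sigmaUC_antidiagonal (m n k : ℤ) (θ t : Fin (N + 1) → ℂ) :
    sigmaUC hL ν ν' (m + k * L) (n - k * L) θ t = sigmaUC hL ν ν' m n θ t := by
  have h1 : Function.Periodic (fun m => corePartition hL (shiftSeq ν m)) (L : ℤ) :=
    corePartition_shiftSeq_add hL ν
  have h2 : Function.Periodic (fun m => corePartition hL (shiftSeq ν' m)) (L : ℤ) :=
    corePartition_shiftSeq_add hL ν'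
  have h1' := h1.int_mul k m
  have h2' := (h2.int_mul k).sub_eq n
  simp only [Int.cast_id] at h1' h2'
  simp only [sigmaUC]
  rw [h1', h2']

theorem exists_sigmaUC_eq_zero_of_eval (m n : ℤ) (v : Fin (N + 1) → ℂ) :
    ∃ P : MvPolynomial (Fin (N + 1) ⊕ Fin (N + 1)) ℂ, P ≠ 0 ∧ ∀ θ t : Fin (N + 1) → ℂ,
      (∀ i, t i ≠ 0) → sigmaUC hL ν ν' m n (θ + v) t = 0 →
        MvPolynomial.eval (Sum.elim θ t) P = 0 := by
  obtain ⟨P, Q, hPQ⟩ := IsRationalOn.universalCharacter (R := {p | ∀ i, p.2 i ≠ 0})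
    (corePartition hL (shiftSeq ν m)) (corePartition hL (shiftSeq ν' n)) v fun _ hp => hp
  refine ⟨P, ?_, fun θ t ht h => ?_⟩
  · rintro rfl
    -- Any parameter with non-integral coordinate sum would do; evaluating at `θ - v` below undoes
    -- the shift by `v`.
    let θ : Fin (N + 1) → ℂ := Pi.single 0 (1 / 2)
    have hθ : ∀ z : ℤ, ∑ i, θ i ≠ z := by
      intro z hz
      simp only [θ, Finset.sum_pi_single', Finset.mem_univ, if_true] at hz
      have : (1 : ℂ) = ((2 * z : ℤ) : ℂ) := by
        push_cast
        rw [← hz]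
        norm_num
      have h2 : (1 : ℤ) = 2 * z := by exact_mod_cast this
      omega
    have h1 := (hPQ (θ - v, 1) (by simp)).2
    simp only [sub_add_cancel, map_zero, zero_div] at h1
    exact universalCharacter_ne_zero _ _ hθ h1
  · have h1 := hPQ (θ, t) ht
    have h2 := h1.2
    rw [eq_div_iff h1.1] at h2
    rw [← h2]
    exact mul_eq_zero_of_left h _

theorem dense_regularSet (c : ℤ) :
    Dense (regularSet (fun m n (θ t : Fin (N + 1) → ℂ) => sigmaUC hL ν ν' m n θ t) c) := by
  choose P hP0 hP using exists_sigmaUC_eq_zero_of_eval (N := N) hL ν ν'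
  let W : MvPolynomial (Fin (N + 1) ⊕ Fin (N + 1)) ℂ :=
    (∏ i : Fin (N + 1), MvPolynomial.X (Sum.inr i)) *
      (∏ i : Fin (N + 1), ∏ j ∈ Finset.univ.erase i,
        (MvPolynomial.X (Sum.inr i) - MvPolynomial.X (Sum.inr j))) *
      (∏ m ∈ Finset.range L, P m (c - 1 - m) 0) *
      ∏ i : Fin (N + 1), ∏ m ∈ Finset.range L, P m (c - m) (unitV i)
  have hW : W ≠ 0 := by
    refine mul_ne_zero (mul_ne_zero (mul_ne_zero ?_ ?_) ?_) ?_
    · exact Finset.prod_ne_zero_iff.2 fun i _ => MvPolynomial.X_ne_zero _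
    · refine Finset.prod_ne_zero_iff.2 fun i _ => Finset.prod_ne_zero_iff.2 fun j hj => ?_
      rw [sub_ne_zero]
      intro h
      exact (Finset.mem_erase.1 hj).1 (Sum.inr_injective (MvPolynomial.X_injective h)).symm
    · exact Finset.prod_ne_zero_iff.2 fun m _ => hP0 _ _ _
    · exact Finset.prod_ne_zero_iff.2 fun i _ => Finset.prod_ne_zero_iff.2 fun m _ => hP0 _ _ _
  have hL0 : (0 : ℤ) < L := by omega
  -- On a fixed antidiagonal `σ` repeats after `L` steps, so the finite product `W` controls all
  -- nonvanishing conditions.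
  have hred : ∀ m : ℤ, ∃ r ∈ Finset.range L, m = r + (m / L) * L := by
    intro m
    have h1 := Int.emod_nonneg m hL0.ne'
    have h2 := Int.emod_lt_of_pos m hL0
    refine ⟨(m % L).toNat, Finset.mem_range.2 (by omega), ?_⟩
    rw [Int.toNat_of_nonneg h1, mul_comm, Int.emod_add_mul_ediv]
  refine (MvPolynomial.dense_eval_ne_zero hW).mono fun p hp => ?_
  simp only [Set.mem_ofPred_eq, W, map_mul, map_prod, map_sub, MvPolynomial.eval_X, Sum.elim_inr,
    mul_ne_zero_iff, Finset.prod_ne_zero_iff] at hp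
  obtain ⟨⟨⟨h1, h2⟩, h3⟩, h4⟩ := hp
  have ht : ∀ i, p.2 i ≠ 0 := fun i => h1 i (Finset.mem_univ i)
  refine ⟨ht, fun i j hij => sub_ne_zero.1
    (h2 i (Finset.mem_univ i) j (Finset.mem_erase.2 ⟨hij.symm, Finset.mem_univ j⟩)),
    fun m n hmn h => ?_, fun i m n hmn h => ?_⟩
  · obtain ⟨r, hr, hm⟩ := hred m
    refine h3 r hr (hP _ _ _ _ _ ht ?_)
    have := sigmaUC_antidiagonal hL ν ν' r (c - 1 - r) (m / L) p.1 p.2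
    rw [← hm, show c - 1 - r - m / L * L = n by linarith] at this
    rw [add_zero, ← this]
    exact h
  · obtain ⟨r, hr, hm⟩ := hred m
    refine h4 i (Finset.mem_univ i) r hr (hP _ _ _ _ _ ht ?_)
    have := sigmaUC_antidiagonal hL ν ν' r (c - r) (m / L) (p.1 + unitV i) p.2
    rw [← hm, show c - r - m / L * L = n by linarith] at this
    rw [← this]
    exact h

end density

/-! ### From bilinear equations to the differential system -/

section partialDRules

variable {N : ℕ} {t : Fin (N + 1) → ℂ}

theorem hasDerivAt_update_partialD {F : (Fin (N + 1) → ℂ) → ℂ} (hF : DifferentiableAt ℂ F t)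
    (i : Fin (N + 1)) :
    HasDerivAt (fun s => F (Function.update t i s)) (partialD i F t) (t i) := by
  refine DifferentiableAt.hasDerivAt ?_
  refine DifferentiableAt.comp (g := F) (t i) ?_ (hasDerivAt_update t i (t i)).differentiableAt
  rwa [Function.update_eq_self]

theorem partialD_congr {F G : (Fin (N + 1) → ℂ) → ℂ} (h : F =ᶠ[nhds t] G) (i : Fin (N + 1)) :
    partialD i F t = partialD i G t := by
  refine Filter.EventuallyEq.deriv_eq ?_
  have hc : Filter.Tendsto (fun s => Function.update t i s) (nhds (t i)) (nhds t) := by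
    have := (hasDerivAt_update t i (t i)).continuousAt.tendsto
    rwa [Function.update_eq_self] at this
  exact hc.eventually h

theorem differentiableAt_quotient {A B C D : (Fin (N + 1) → ℂ) → ℂ} (hA : DifferentiableAt ℂ A t)
    (hB : DifferentiableAt ℂ B t) (hC : DifferentiableAt ℂ C t) (hD : DifferentiableAt ℂ D t)
    (hC0 : C t ≠ 0) (hD0 : D t ≠ 0) (k : ℂ) :
    DifferentiableAt ℂ (fun t => k * (A t * B t) / (C t * D t)) t := by
  have h0 : (fun t => C t * D t) t ≠ 0 := mul_ne_zero hC0 hD0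
  simp only [div_eq_mul_inv]
  exact ((hA.fun_mul hB).const_mul k).fun_mul ((hC.fun_mul hD).fun_inv h0)

theorem partialD_quotient {A B C D : (Fin (N + 1) → ℂ) → ℂ} (hA : DifferentiableAt ℂ A t)
    (hB : DifferentiableAt ℂ B t) (hC : DifferentiableAt ℂ C t) (hD : DifferentiableAt ℂ D t)
    (hC0 : C t ≠ 0) (hD0 : D t ≠ 0) (k : ℂ) (i : Fin (N + 1)) :
    partialD i (fun t => k * (A t * B t) / (C t * D t)) t =
      k * B t / (C t * D t) * partialD i A t + k * A t / (C t * D t) * partialD i B t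
        - k * A t * B t / (C t ^ 2 * D t) * partialD i C t
        - k * A t * B t / (C t * D t ^ 2) * partialD i D t := by
  have h := (((hasDerivAt_update_partialD hA i).fun_mul (hasDerivAt_update_partialD hB i)).const_mul
    k).fun_div ((hasDerivAt_update_partialD hC i).fun_mul (hasDerivAt_update_partialD hD i))
    (by simpa only [Function.update_eq_self] using mul_ne_zero hC0 hD0)
  simp only [Function.update_eq_self] at h
  rw [partialD, h.deriv]
  field_simp
  ring

end partialDRules

/-- A family of functions satisfying the bilinear equations, Euler's relation with degrees `d`, and
periodicity. -/
structure IsTauFamily {N : ℕ} (L : ℕ) (σ : ℤ → ℤ → (Fin (N + 1) → ℂ) → (Fin (N + 1) → ℂ) → ℂ)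
    (d : ℤ → ℤ → ℤ) : Prop where
  periodic : ∀ m n θ t, σ (m - L) (n + L) θ t = σ m n θ t
  differentiableAt : ∀ m n θ t, (∀ i, t i ≠ 0) → DifferentiableAt ℂ (σ m n θ) t
  bilinear_one : ∀ m n θ t i j, (∀ k, t k ≠ 0) →
    (t i - t j) * (σ m n θ t * σ (m + 1) (n + 1) (θ + unitV i + unitV j) t) =
      t i * (σ (m + 1) n (θ + unitV i) t * σ m (n + 1) (θ + unitV j) t)
        - t j * (σ (m + 1) n (θ + unitV j) t * σ m (n + 1) (θ + unitV i) t)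
  bilinear_two : ∀ m n θ t i, (∀ k, t k ≠ 0) →
    t i * hirotaD i (σ (m + 1) n θ) (σ m (n + 1) θ) t
        + θ i * (σ (m + 1) n θ t * σ m (n + 1) θ t) =
      θ i * (σ m n (θ - unitV i) t * σ (m + 1) (n + 1) (θ + unitV i) t)
  bilinear_three : ∀ m n θ t i j, (∀ k, t k ≠ 0) →
    (t j - t i) * hirotaD i (σ m n (θ - unitV j)) (σ (m + 1) n θ) t
        + θ i * (σ m n (θ - unitV j) t * σ (m + 1) n θ t) =
      θ i * (σ m n (θ - unitV i) t * σ (m + 1) n (θ + unitV i - unitV j) t)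
  euler : ∀ m n θ t, (∀ k, t k ≠ 0) → ∑ i, t i * partialD i (σ m n θ) t = (d m n : ℂ) * σ m n θ t
  degree : ∀ m n, d (m - 1) (n - 1) + d m n = d m (n - 1) + d (m - 1) n

namespace IsTauFamily

variable {N L : ℕ} {σ : ℤ → ℤ → (Fin (N + 1) → ℂ) → (Fin (N + 1) → ℂ) → ℂ} {d : ℤ → ℤ → ℤ}
  {θ t : Fin (N + 1) → ℂ} {m n : ℤ}

theorem gVar_eq (H : IsTauFamily L σ d) (ht : ∀ k, t k ≠ 0) (h1 : σ m (n - 1) θ t ≠ 0)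
    (h2 : σ (m - 1) n θ t ≠ 0) (i : Fin (N + 1)) :
    gVar σ θ i m n t = θ i * (σ (m - 1) (n - 1) (θ - unitV i) t * σ m n (θ + unitV i) t) /
      (σ m (n - 1) θ t * σ (m - 1) n θ t) := by
  have h := H.bilinear_two (m - 1) (n - 1) θ t i ht
  rw [sub_add_cancel, sub_add_cancel] at h
  rw [gVar, ← h]
  field_simp

/-- The product form is needed on a neighbourhood so that it can be differentiated. -/
theorem gVar_eventuallyEq (H : IsTauFamily L σ d) (ht : ∀ k, t k ≠ 0) (h1 : σ m (n - 1) θ t ≠ 0)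
    (h2 : σ (m - 1) n θ t ≠ 0) (i : Fin (N + 1)) :
    gVar σ θ i m n =ᶠ[nhds t] fun t =>
      θ i * (σ (m - 1) (n - 1) (θ - unitV i) t * σ m n (θ + unitV i) t) /
      (σ m (n - 1) θ t * σ (m - 1) n θ t) := by
  have e1 := (H.differentiableAt m (n - 1) θ t ht).continuousAt.eventually_ne h1
  have e2 := (H.differentiableAt (m - 1) n θ t ht).continuousAt.eventually_ne h2
  have e3 : ∀ᶠ s in nhds t, ∀ k, s k ≠ 0 :=
    Filter.eventually_all.2 fun k => (continuous_apply k).continuousAt.eventually_ne (ht k)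
  filter_upwards [e1, e2, e3] with s s1 s2 s3
  exact H.gVar_eq s3 s1 s2 i

theorem differentiableAt_gVar (H : IsTauFamily L σ d) (ht : ∀ k, t k ≠ 0)
    (h1 : σ m (n - 1) θ t ≠ 0) (h2 : σ (m - 1) n θ t ≠ 0) (i : Fin (N + 1)) :
    DifferentiableAt ℂ (gVar σ θ i m n) t := by
  refine DifferentiableAt.congr_of_eventuallyEq ?_ (H.gVar_eventuallyEq ht h1 h2 i)
  exact differentiableAt_quotient (H.differentiableAt _ _ _ t ht) (H.differentiableAt _ _ _ t ht)
    (H.differentiableAt _ _ _ t ht) (H.differentiableAt _ _ _ t ht) h1 h2 (θ i)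

theorem differentiableAt_fVar (H : IsTauFamily L σ d) (ht : ∀ k, t k ≠ 0) (i : Fin (N + 1))
    (h1 : σ (m - 1) n (θ + unitV i) t ≠ 0) (h2 : σ m (n - 2) θ t ≠ 0) :
    DifferentiableAt ℂ (fVar σ θ i m n) t := by
  have h := differentiableAt_quotient (H.differentiableAt m (n - 1) (θ + unitV i) t ht)
    (H.differentiableAt (m - 1) (n - 1) θ t ht) (H.differentiableAt (m - 1) n (θ + unitV i) t ht)
    (H.differentiableAt m (n - 2) θ t ht) h1 h2 1
  simp only [one_mul] at h
  exact h

theorem sum_gVar (H : IsTauFamily L σ d) (ht : ∀ k, t k ≠ 0) (h1 : σ m (n - 1) θ t ≠ 0)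
    (h2 : σ (m - 1) n θ t ≠ 0) :
    ∑ i, gVar σ θ i m n t = (d m (n - 1) : ℂ) - d (m - 1) n + ∑ i, θ i := by
  have e1 := H.euler m (n - 1) θ t ht
  have e2 := H.euler (m - 1) n θ t ht
  have h : ∀ i, gVar σ θ i m n t = (σ m (n - 1) θ t)⁻¹ * (t i * partialD i (σ m (n - 1) θ) t)
      - (σ (m - 1) n θ t)⁻¹ * (t i * partialD i (σ (m - 1) n θ) t) + θ i := by
    intro i
    rw [gVar, hirotaD]
    field_simp
  simp only [h, Finset.sum_add_distrib, Finset.sum_sub_distrib, ← Finset.mul_sum, e1, e2]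
  field_simp

/-- The logarithmic derivatives of `f`. -/
theorem partialD_fVar (H : IsTauFamily L σ d) (ht : ∀ k, t k ≠ 0) (i j : Fin (N + 1))
    (h1 : σ (m - 1) n (θ + unitV i) t ≠ 0) (h2 : σ m (n - 2) θ t ≠ 0)
    (h3 : σ m (n - 1) (θ + unitV i) t ≠ 0) (h4 : σ (m - 1) (n - 1) θ t ≠ 0) :
    t j * partialD j (fVar σ θ i m n) t =
      (gVar σ (θ + unitV i) j m n t - gVar σ θ j m (n - 1) t - unitV i j) * fVar σ θ i m n t := by
  -- The two factors of `f` at `θ + e_i` give a `g` at the shifted parameter, the two at `θ` an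
  -- unshifted one; `unitV i j` is the difference of the constants built into these `g`.
  have h := partialD_quotient (H.differentiableAt m (n - 1) (θ + unitV i) t ht)
    (H.differentiableAt (m - 1) (n - 1) θ t ht) (H.differentiableAt (m - 1) n (θ + unitV i) t ht)
    (H.differentiableAt m (n - 2) θ t ht) h1 h2 1 j
  simp only [one_mul] at h
  have hn : n - 1 - 1 = n - 2 := by ring
  have hf : partialD j (fVar σ θ i m n) t = partialD j (fun t =>
      (σ m (n - 1) (θ + unitV i) t * σ (m - 1) (n - 1) θ t) /
        (σ (m - 1) n (θ + unitV i) t * σ m (n - 2) θ t)) t := rfl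
  rw [hf, h, gVar, gVar, hn, hirotaD, hirotaD, fVar, Pi.add_apply]
  field_simp
  ring

/-- Removes the shifted parameter from the logarithmic derivative of `f`: the first bilinear
equation splits `σ_{m-1,n-1} σ_{m,n}(θ_i+1, θ_j+1)` in the product form of `g`. -/
theorem gVar_add_unitV (H : IsTauFamily L σ d) (ht : ∀ k, t k ≠ 0) {i j : Fin (N + 1)}
    (hij : i ≠ j) (htij : t i ≠ t j)
    (h1 : σ (m - 1) n (θ + unitV i) t ≠ 0) (h3 : σ m (n - 1) (θ + unitV i) t ≠ 0)
    (h4 : σ (m - 1) (n - 1) θ t ≠ 0) :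
    gVar σ (θ + unitV i) j m n t = -uVar σ θ j i (m - 1) n t + vVar σ θ j i m (n - 1) t := by
  have h := H.bilinear_one (m - 1) (n - 1) θ t j i ht
  rw [sub_add_cancel, sub_add_cancel] at h
  have hj : (θ + unitV i) j = θ j := by simp [unitV, hij.symm]
  have hs : t j - t i ≠ 0 := sub_ne_zero.2 htij.symm
  rw [H.gVar_eq ht h3 h1, hj, uVar, vVar, add_sub_right_comm θ (unitV i) (unitV j),
    add_right_comm θ (unitV i) (unitV j)]
  field_simp
  linear_combination θ j * σ (m - 1) (n - 1) (θ - unitV j + unitV i) t * h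

/-- The first bilinear equation at `θ - e_i`, applied to the product form of `g`. -/
theorem gVar_eq_vVar_sub_uVar (H : IsTauFamily L σ d) (ht : ∀ k, t k ≠ 0) {i j : Fin (N + 1)}
    (htij : t i ≠ t j) (h1 : σ m (n - 1) θ t ≠ 0) (h2 : σ (m - 1) n θ t ≠ 0)
    (h3 : σ m n (θ + unitV j) t ≠ 0) :
    gVar σ θ i m n t = vVar σ θ i j m n t - uVar σ θ i j m n t := by
  have h := H.bilinear_one (m - 1) (n - 1) (θ - unitV i) t i j ht
  rw [sub_add_cancel, sub_add_cancel, sub_add_cancel] at h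
  have hs : t i - t j ≠ 0 := sub_ne_zero.2 htij
  rw [H.gVar_eq ht h1 h2, uVar, vVar]
  field_simp
  linear_combination θ i * σ m n (θ + unitV i) t * h

theorem partialD_gVar (H : IsTauFamily L σ d) (ht : ∀ k, t k ≠ 0) (i j : Fin (N + 1))
    (h1 : σ m (n - 1) θ t ≠ 0) (h2 : σ (m - 1) n θ t ≠ 0) :
    partialD j (gVar σ θ i m n) t =
      θ i * σ m n (θ + unitV i) t / (σ m (n - 1) θ t * σ (m - 1) n θ t)
          * partialD j (σ (m - 1) (n - 1) (θ - unitV i)) t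
        + θ i * σ (m - 1) (n - 1) (θ - unitV i) t / (σ m (n - 1) θ t * σ (m - 1) n θ t)
          * partialD j (σ m n (θ + unitV i)) t
        - θ i * σ (m - 1) (n - 1) (θ - unitV i) t * σ m n (θ + unitV i) t /
          (σ m (n - 1) θ t ^ 2 * σ (m - 1) n θ t) * partialD j (σ m (n - 1) θ) t
        - θ i * σ (m - 1) (n - 1) (θ - unitV i) t * σ m n (θ + unitV i) t /
          (σ m (n - 1) θ t * σ (m - 1) n θ t ^ 2) * partialD j (σ (m - 1) n θ) t := by
  rw [partialD_congr (H.gVar_eventuallyEq ht h1 h2 i)]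
  exact partialD_quotient (H.differentiableAt _ _ _ t ht) (H.differentiableAt _ _ _ t ht)
    (H.differentiableAt _ _ _ t ht) (H.differentiableAt _ _ _ t ht) h1 h2 (θ i) j

/-- By `degree` the numerator and denominator of `g` have equal degree, so Euler's relation gives
zero. -/
theorem sum_partialD_gVar (H : IsTauFamily L σ d) (ht : ∀ k, t k ≠ 0) (i : Fin (N + 1))
    (h1 : σ m (n - 1) θ t ≠ 0) (h2 : σ (m - 1) n θ t ≠ 0) :
    ∑ j, t j * partialD j (gVar σ θ i m n) t = 0 := by
  have hd : (d (m - 1) (n - 1) : ℂ) + d m n = d m (n - 1) + d (m - 1) n := by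
    exact_mod_cast H.degree m n
  simp only [H.partialD_gVar ht i _ h1 h2, mul_sub, mul_add, mul_left_comm (t _),
    Finset.sum_add_distrib, Finset.sum_sub_distrib, ← Finset.mul_sum, H.euler _ _ _ t ht]
  field_simp
  linear_combination θ i * σ (m - 1) (n - 1) (θ - unitV i) t * σ m n (θ + unitV i) t * hd

/-- Two instances of the third bilinear equation pair each `σ` in the numerator of `g` with one in
the denominator; after substituting them, the remaining derivatives cancel. -/
theorem mul_partialD_gVar (H : IsTauFamily L σ d) (ht : ∀ k, t k ≠ 0) {i j : Fin (N + 1)}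
    (hij : i ≠ j) (htij : t i ≠ t j) (h1 : σ m (n - 1) θ t ≠ 0) (h2 : σ (m - 1) n θ t ≠ 0)
    (h3 : σ m n (θ + unitV i) t ≠ 0) (h4 : σ m n (θ + unitV j) t ≠ 0) :
    t j * partialD j (gVar σ θ i m n) t =
      uVar σ θ i j m n t * gVar σ θ j m n t + vVar σ θ j i m n t * gVar σ θ i m n t := by
  have e1 := H.bilinear_three (m - 1) (n - 1) θ t j i ht
  have e2 := H.bilinear_three (m - 1) n (θ + unitV i) t j i ht
  have hj : (θ + unitV i) j = θ j := by simp [unitV, hij.symm]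
  rw [sub_add_cancel, hirotaD, add_sub_right_comm θ (unitV j)] at e1
  rw [sub_add_cancel, add_sub_cancel_right, hj, add_right_comm, add_sub_cancel_right, hirotaD,
    add_sub_right_comm θ (unitV i)] at e2
  have hs : t i - t j ≠ 0 := sub_ne_zero.2 htij
  rw [H.partialD_gVar ht i j h1 h2, H.gVar_eq ht h1 h2, H.gVar_eq ht h1 h2, uVar, vVar,
    ← neg_sub (t i) (t j)]
  have x1 : partialD j (σ (m - 1) (n - 1) (θ - unitV i)) t =
      (θ j * (σ (m - 1) (n - 1) (θ - unitV j) t * σ m (n - 1) (θ - unitV i + unitV j) t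
        - σ (m - 1) (n - 1) (θ - unitV i) t * σ m (n - 1) θ t) / (t i - t j)
        + σ (m - 1) (n - 1) (θ - unitV i) t * partialD j (σ m (n - 1) θ) t) / σ m (n - 1) θ t := by
    field_simp
    linear_combination e1
  have x2 : partialD j (σ (m - 1) n θ) t =
      (θ j * (σ (m - 1) n (θ - unitV j + unitV i) t * σ m n (θ + unitV j) t
        - σ (m - 1) n θ t * σ m n (θ + unitV i) t) / (t i - t j)
        + σ (m - 1) n θ t * partialD j (σ m n (θ + unitV i)) t) / σ m n (θ + unitV i) t := by
    field_simp
    linear_combination e2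
  rw [x1, x2]
  field_simp
  ring

theorem fVar_div_fVar (i j : Fin (N + 1)) (h1 : σ m (n - 2) θ t ≠ 0)
    (h2 : σ (m - 1) (n - 1) θ t ≠ 0) :
    t i * fVar σ θ i m n t / (t j * fVar σ θ j m n t) =
      t i / t j * (σ m (n - 1) (θ + unitV i) t / σ m (n - 1) (θ + unitV j) t *
        (σ (m - 1) n (θ + unitV j) t / σ (m - 1) n (θ + unitV i) t)) := by
  rw [fVar, fVar, mul_div_mul_comm, div_div_div_eq]
  congr 1
  rw [div_mul_div_comm, show σ m (n - 1) (θ + unitV i) t * σ (m - 1) (n - 1) θ t *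
      (σ (m - 1) n (θ + unitV j) t * σ m (n - 2) θ t) = σ m (n - 1) (θ + unitV i) t *
      σ (m - 1) n (θ + unitV j) t * (σ (m - 1) (n - 1) θ t * σ m (n - 2) θ t) by ring,
    show σ (m - 1) n (θ + unitV i) t * σ m (n - 2) θ t *
      (σ m (n - 1) (θ + unitV j) t * σ (m - 1) (n - 1) θ t) = σ m (n - 1) (θ + unitV j) t *
      σ (m - 1) n (θ + unitV i) t * (σ (m - 1) (n - 1) θ t * σ m (n - 2) θ t) by ring,
    mul_div_mul_right _ _ (mul_ne_zero h2 h1)]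

variable {c : ℤ}

/-- In the ratio of two `f` the unshifted `σ` cancel, and what is left is the quotient of `V_{m,n}`
by `U_{m-1,n+1}`. -/
theorem vVar_eq_mul_uVar (hp : (θ, t) ∈ regularSet σ c) (hmn : m + n = c) {i j : Fin (N + 1)} :
    vVar σ θ i j m n t = t i * fVar σ θ i m (n + 1) t / (t j * fVar σ θ j m (n + 1) t) *
      uVar σ θ i j (m - 1) (n + 1) t := by
  obtain ⟨ht, -, h1, h2⟩ := hp
  simp only at ht h1 h2
  have e : n + 1 - 2 = n - 1 := by ring
  rw [fVar_div_fVar i j (by rw [e]; exact h1 _ _ (by omega))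
    (by rw [add_sub_cancel_right]; exact h1 _ _ (by omega)), add_sub_cancel_right, uVar, vVar,
    add_sub_cancel_right]
  have a1 := h2 j m n hmn
  have a2 := h2 i (m - 1) (n + 1) (by omega)
  have a3 := h2 j (m - 1) (n + 1) (by omega)
  have a4 := h1 (m - 1) n (by omega)
  have a5 := ht j
  field_simp

/-- The telescoping sum behind the closed expressions for `U` and `V`. -/
theorem sum_gVar_mul_prod (H : IsTauFamily L σ d) (hp : (θ, t) ∈ regularSet σ c) (hmn : m + n = c)
    {i j : Fin (N + 1)} (htij : t i ≠ t j) (K : ℕ) :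
    ∑ b ∈ Finset.Icc 1 K, gVar σ θ i (m - b + 1) (n + b - 1) t *
        ∏ a ∈ Finset.Icc 1 (b - 1), (t i * fVar σ θ i (m - a + 1) (n + a) t) /
          (t j * fVar σ θ j (m - a + 1) (n + a) t) =
      (∏ a ∈ Finset.Icc 1 K, (t i * fVar σ θ i (m - a + 1) (n + a) t) /
          (t j * fVar σ θ j (m - a + 1) (n + a) t)) * uVar σ θ i j (m - K) (n + K) t
        - uVar σ θ i j m n t := by
  induction K with
  | zero => simp
  | succ K ih =>
    rw [Finset.sum_Icc_succ_top (by omega), ih, Finset.prod_Icc_succ_top (by omega),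
      Nat.add_sub_cancel]
    have e1 : m - ((K + 1 : ℕ) : ℤ) + 1 = m - K := by push_cast; ring
    have e2 : n + ((K + 1 : ℕ) : ℤ) - 1 = n + K := by push_cast; ring
    have e3 : n + ((K + 1 : ℕ) : ℤ) = n + K + 1 := by push_cast; ring
    have e4 : m - ((K + 1 : ℕ) : ℤ) = m - K - 1 := by push_cast; ring
    have hc : m - K + (n + K) = c := by omega
    -- The new `g` is the next ratio times the next `U`, minus the current `U`; the latter cancels
    -- the boundary term from the induction hypothesis.
    rw [e1, e2, e3, e4, H.gVar_eq_vVar_sub_uVar hp.1 htij (hp.2.2.1 _ _ (by omega))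
      (hp.2.2.1 _ _ (by omega)) (hp.2.2.2 j _ _ hc), vVar_eq_mul_uVar hp hc]
    ring

theorem prod_fVar_div_fVar (hp : (θ, t) ∈ regularSet σ c) (hmn : m + n = c)
    (i j : Fin (N + 1)) (K : ℕ) :
    ∏ a ∈ Finset.Icc 1 K, (t i * fVar σ θ i (m - a + 1) (n + a) t) /
          (t j * fVar σ θ j (m - a + 1) (n + a) t) =
      (t i / t j) ^ K * (σ m n (θ + unitV i) t / σ m n (θ + unitV j) t *
        (σ (m - K) (n + K) (θ + unitV j) t / σ (m - K) (n + K) (θ + unitV i) t)) := by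
  have h0 := hp.2.2.2 i m n hmn
  have h0' := hp.2.2.2 j m n hmn
  simp only at h0 h0'
  induction K with
  | zero =>
    simp only [Nat.cast_zero, sub_zero, add_zero]
    field_simp
    simp
  | succ K ih =>
    have e1 : m - ((K + 1 : ℕ) : ℤ) + 1 = m - K := by push_cast; ring
    have e3 : n + ((K + 1 : ℕ) : ℤ) = n + K + 1 := by push_cast; ring
    have e4 : m - ((K + 1 : ℕ) : ℤ) = m - K - 1 := by push_cast; ring
    have e5 : n + (K : ℤ) + 1 - 2 = n + K - 1 := by ring
    have hc : m - K + (n + K) = c := by omega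
    rw [Finset.prod_Icc_succ_top (by omega), ih, e1, e3, e4,
      fVar_div_fVar i j (by rw [e5]; exact hp.2.2.1 _ _ (by omega))
        (by rw [add_sub_cancel_right]; exact hp.2.2.1 _ _ (by omega)), add_sub_cancel_right]
    have a1 := hp.2.2.2 i _ _ hc
    have a2 := hp.2.2.2 j _ _ hc
    simp only at a1 a2
    have htj := hp.1 j
    simp only at htj
    rw [pow_succ]
    field_simp

/-- After `L` steps `U` has returned to itself and the ratios of `σ` cancel by periodicity, so the
telescoping sum is `((t_i / t_j)^L - 1) U`. -/
theorem uVar_eq_closedU (H : IsTauFamily L σ d) (hp : (θ, t) ∈ regularSet σ c) (hmn : m + n = c)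
    {i j : Fin (N + 1)} (hL : t i ^ L ≠ t j ^ L) :
    uVar σ θ i j m n t = closedU L (fVar σ θ) (gVar σ θ) i j m n t := by
  have htij : t i ≠ t j := fun h => hL (by rw [h])
  have htj : t j ^ L ≠ 0 := pow_ne_zero _ (hp.1 j)
  have hne : (t i / t j) ^ L - 1 ≠ 0 := by
    rw [div_pow, sub_ne_zero]
    exact fun h => hL ((div_eq_one_iff_eq htj).1 h)
  have hu : uVar σ θ i j (m - L) (n + L) t = uVar σ θ i j m n t := by
    rw [uVar, uVar, add_sub_right_comm]
    simp only [H.periodic]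
  have h0 := hp.2.2.2 i m n hmn
  have h0' := hp.2.2.2 j m n hmn
  simp only at h0 h0'
  rw [closedU, H.sum_gVar_mul_prod hp hmn htij, prod_fVar_div_fVar hp hmn, hu, H.periodic, H.periodic]
  have h1 : σ m n (θ + unitV i) t / σ m n (θ + unitV j) t *
      (σ m n (θ + unitV j) t / σ m n (θ + unitV i) t) = 1 := by
    field_simp
  rw [h1, mul_one, ← sub_one_mul, ← mul_assoc, one_div_mul_cancel hne, one_mul]

theorem vVar_eq_closedV (H : IsTauFamily L σ d) (hp : (θ, t) ∈ regularSet σ c) (hmn : m + n = c)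
    {i j : Fin (N + 1)} (hL : t i ^ L ≠ t j ^ L) :
    vVar σ θ i j m n t = closedV L (fVar σ θ) (gVar σ θ) i j m n t := by
  rw [vVar_eq_mul_uVar hp hmn, H.uVar_eq_closedU hp (by omega) hL, closedU, closedV, mul_left_comm,
    Finset.mul_sum]
  congr 1
  refine Finset.sum_congr rfl fun b hb => ?_
  have hb1 := (Finset.mem_Icc.1 hb).1
  obtain ⟨b, rfl⟩ : ∃ b', b = b' + 1 := ⟨b - 1, by omega⟩
  have e1 : m - 1 - ((b + 1 : ℕ) : ℤ) + 1 = m - (b + 1 : ℕ) := by ring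
  have e2 : n + 1 + ((b + 1 : ℕ) : ℤ) - 1 = n + (b + 1 : ℕ) := by ring
  -- The ratio linking `V_{m,n}` to `U_{m-1,n+1}` is the factor `a = 0`; the remaining factors are
  -- those of `U` with the index moved by one.
  rw [e1, e2, mul_left_comm, Finset.prod_range_succ', Nat.add_sub_cancel,
    mul_comm (∏ k ∈ Finset.range b, _)]
  congr 2
  · simp
  · rw [Finset.range_eq_Ico, Finset.prod_Ico_add' (fun k : ℕ =>
      (t i * fVar σ θ i (m - (k : ℕ)) (n + (k : ℕ) + 1) t) /
        (t j * fVar σ θ j (m - (k : ℕ)) (n + (k : ℕ) + 1) t)) 0 b 1]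
    refine Finset.prod_congr (by ext; simp) fun k _ => ?_
    rw [show m - 1 - (k : ℤ) + 1 = m - k by ring, show n + 1 + (k : ℤ) = n + k + 1 by ring]

theorem solvesG (H : IsTauFamily L σ d) {κ : (Fin (N + 1) → ℂ) → ℤ → ℤ → ℂ}
    (hκ : ∀ θ m n, κ θ m n = (d m (n - 1) : ℂ) - d (m - 1) n + ∑ i, θ i)
    (θ : Fin (N + 1) → ℂ) (c : ℤ) :
    SolvesG (κ θ) c {t | (θ, t) ∈ regularSet σ c} (fVar σ θ) (gVar σ θ) (uVar σ θ) (vVar σ θ) where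
  differentiable_f i m n hmn t ht :=
    H.differentiableAt_fVar ht.1 i (ht.2.2.2 i _ _ (by omega)) (ht.2.2.1 _ _ (by omega))
  differentiable_g i m n hmn t ht :=
    H.differentiableAt_gVar ht.1 (ht.2.2.1 _ _ (by omega)) (ht.2.2.1 _ _ (by omega)) i
  sum_g m n hmn t ht := by
    rw [H.sum_gVar ht.1 (ht.2.2.1 _ _ (by omega)) (ht.2.2.1 _ _ (by omega)), hκ]
  eq_f_same i m n hmn t ht := by
    have h1 := ht.2.2.2 i (m - 1) n (by omega)
    have h3 := ht.2.2.2 i m (n - 1) (by omega)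
    have h4 := ht.2.2.1 (m - 1) (n - 1) (by omega)
    rw [H.partialD_fVar ht.1 i i h1 (ht.2.2.1 _ _ (by omega)) h3 h4]
    -- The sum rule at `θ + e_i` yields `κ + 1`; the extra one cancels against `unitV i i`.
    have hs := H.sum_gVar ht.1 h3 h1
    have hθ : ∑ k, (θ + unitV i) k = ∑ k, θ k + 1 := by
      simp [Finset.sum_add_distrib, unitV]
    rw [← Finset.add_sum_erase _ _ (Finset.mem_univ i), hθ] at hs
    have hsum : ∑ j ∈ Finset.univ.erase i, gVar σ (θ + unitV i) j m n t =
        -∑ j ∈ Finset.univ.erase i, (uVar σ θ j i (m - 1) n t - vVar σ θ j i m (n - 1) t) := by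
      rw [← Finset.sum_neg_distrib]
      refine Finset.sum_congr rfl fun j hj => ?_
      have hij := (Finset.mem_erase.1 hj).1.symm
      rw [H.gVar_add_unitV ht.1 hij (ht.2.1 i j hij) h1 h3 h4]
      ring
    rw [hsum] at hs
    have hu : (unitV i i : ℂ) = 1 := by simp [unitV]
    rw [hu, hκ]
    linear_combination fVar σ θ i m n t * hs
  eq_f_other i j m n hij hmn t ht := by
    have h1 := ht.2.2.2 i (m - 1) n (by omega)
    have h3 := ht.2.2.2 i m (n - 1) (by omega)
    have h4 := ht.2.2.1 (m - 1) (n - 1) (by omega)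
    have hu : (unitV i j : ℂ) = 0 := by simp [unitV, hij.symm]
    rw [H.partialD_fVar ht.1 i j h1 (ht.2.2.1 _ _ (by omega)) h3 h4,
      H.gVar_add_unitV ht.1 hij (ht.2.1 i j hij) h1 h3 h4, hu]
    ring
  eq_g_same i m n hmn t ht := by
    have h1 := ht.2.2.1 m (n - 1) (by omega)
    have h2 := ht.2.2.1 (m - 1) n (by omega)
    -- Homogeneity of degree zero determines the diagonal derivative from the off-diagonal ones.
    have hs := H.sum_partialD_gVar ht.1 i h1 h2
    rw [← Finset.add_sum_erase _ _ (Finset.mem_univ i)] at hs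
    rw [eq_neg_iff_add_eq_zero, ← hs]
    congr 1
    refine Finset.sum_congr rfl fun j hj => ?_
    have hij := (Finset.mem_erase.1 hj).1.symm
    exact (H.mul_partialD_gVar ht.1 hij (ht.2.1 i j hij) h1 h2 (ht.2.2.2 i _ _ hmn)
      (ht.2.2.2 j _ _ hmn)).symm
  eq_g_other i j m n hij hmn t ht :=
    H.mul_partialD_gVar ht.1 hij (ht.2.1 i j hij) (ht.2.2.1 _ _ (by omega))
      (ht.2.2.1 _ _ (by omega)) (ht.2.2.2 i _ _ hmn) (ht.2.2.2 j _ _ hmn)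

theorem solvesG_closed (H : IsTauFamily L σ d) {κ : (Fin (N + 1) → ℂ) → ℤ → ℤ → ℂ}
    (hκ : ∀ θ m n, κ θ m n = (d m (n - 1) : ℂ) - d (m - 1) n + ∑ i, θ i)
    (θ : Fin (N + 1) → ℂ) (c : ℤ) :
    SolvesG (κ θ) c {t | (θ, t) ∈ regularSet σ c ∧ ∀ i j, i ≠ j → t i ^ L ≠ t j ^ L}
      (fVar σ θ) (gVar σ θ) (closedU L (fVar σ θ) (gVar σ θ))
      (closedV L (fVar σ θ) (gVar σ θ)) where
  differentiable_f i m n hmn t ht := (H.solvesG hκ θ c).differentiable_f i m n hmn t ht.1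
  differentiable_g i m n hmn t ht := (H.solvesG hκ θ c).differentiable_g i m n hmn t ht.1
  sum_g m n hmn t ht := (H.solvesG hκ θ c).sum_g m n hmn t ht.1
  eq_f_same i m n hmn t ht := by
    rw [(H.solvesG hκ θ c).eq_f_same i m n hmn t ht.1]
    congr 2
    refine Finset.sum_congr rfl fun j hj => ?_
    have hj' := ht.2 j i (Finset.mem_erase.1 hj).1
    rw [H.uVar_eq_closedU ht.1 (by omega) hj', H.vVar_eq_closedV ht.1 (by omega) hj']
  eq_f_other i j m n hij hmn t ht := by
    rw [(H.solvesG hκ θ c).eq_f_other i j m n hij hmn t ht.1,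
      H.uVar_eq_closedU ht.1 (by omega) (ht.2 j i hij.symm),
      H.vVar_eq_closedV ht.1 (by omega) (ht.2 j i hij.symm)]
  eq_g_same i m n hmn t ht := by
    rw [(H.solvesG hκ θ c).eq_g_same i m n hmn t ht.1]
    congr 1
    refine Finset.sum_congr rfl fun j hj => ?_
    have hj' := (Finset.mem_erase.1 hj).1
    rw [H.uVar_eq_closedU ht.1 hmn (ht.2 i j hj'.symm), H.vVar_eq_closedV ht.1 hmn (ht.2 j i hj')]
  eq_g_other i j m n hij hmn t ht := by
    rw [(H.solvesG hκ θ c).eq_g_other i j m n hij hmn t ht.1,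
      H.uVar_eq_closedU ht.1 hmn (ht.2 i j hij), H.vVar_eq_closedV ht.1 hmn (ht.2 j i hij.symm)]

end IsTauFamily

/-! ### The universal characters as a tau family. -/

section Sigma

variable {L : ℕ} (hL : 2 ≤ L) (ν ν' : Fin L → ℤ) {N : ℕ}

theorem isTauFamily_sigmaUC :
    IsTauFamily L (fun m n (θ t : Fin (N + 1) → ℂ) => sigmaUC hL ν ν' m n θ t)
      (degreeUC hL ν ν') where
  periodic m n θ t := by
    have h := sigmaUC_antidiagonal hL ν ν' m n (-1) θ t
    rwa [neg_one_mul, ← sub_eq_add_neg, sub_neg_eq_add] at h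
  differentiableAt m n θ t ht := differentiableAt_sigmaUC hL ν ν' m n θ ht
  bilinear_one m n θ t i j ht := sigmaUC_bilinear_one hL ν ν' m n θ ht i j
  bilinear_two m n θ t i ht := sigmaUC_bilinear_two hL ν ν' m n θ ht i
  bilinear_three m n θ t i j ht := sigmaUC_bilinear_three hL ν ν' m n θ ht i j
  euler m n θ t ht := sigmaUC_euler hL ν ν' m n θ ht
  degree m n := by
    have h1 := degreeUC_sub_left hL ν ν' m n
    have h2 := degreeUC_sub_left hL ν ν' m (n - 1)
    omega

theorem degreeUC_sub_eq (θ : Fin (N + 1) → ℂ) (m n : ℤ) :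
    (L : ℂ) * ((cyclicEntry hL ν m : ℂ) + (cyclicEntry hL ν' n : ℂ))
        - ((∑ k, ν k : ℤ) : ℂ) - ((∑ k, ν' k : ℤ) : ℂ) + ∑ i, θ i =
      (degreeUC hL ν ν' m (n - 1) : ℂ) - degreeUC hL ν ν' (m - 1) n + ∑ i, θ i := by
  have h1 := congrArg (Int.cast : ℤ → ℂ) (degreeUC_sub_left hL ν ν' m (n - 1))
  have h2 := congrArg (Int.cast : ℤ → ℂ) (degreeUC_sub_right hL ν ν' (m - 1) n)
  simp only [Int.cast_sub, Int.cast_add, Int.cast_neg, Int.cast_mul, Int.cast_natCast] at h1 h2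
  linear_combination h2 - h1

theorem isRationalOn_sigmaUC {R : Set ((Fin (N + 1) → ℂ) × (Fin (N + 1) → ℂ))}
    (hR : ∀ p ∈ R, ∀ i, p.2 i ≠ 0) (m n : ℤ) (v : Fin (N + 1) → ℂ) :
    IsRationalOn R fun θ t => sigmaUC hL ν ν' m n (θ + v) t :=
  IsRationalOn.universalCharacter _ _ v hR

theorem isRationalOn_fVar_sigmaUC (i : Fin (N + 1)) (m n : ℤ) :
    IsRationalOn (regularSet (fun m n (θ t : Fin (N + 1) → ℂ) => sigmaUC hL ν ν' m n θ t)
      (m + n - 1)) fun θ t =>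
        fVar (fun m n (θ t : Fin (N + 1) → ℂ) => sigmaUC hL ν ν' m n θ t) θ i m n t := by
  have hs := isRationalOn_sigmaUC (N := N) hL ν ν'
    (R := regularSet (fun m n (θ t : Fin (N + 1) → ℂ) => sigmaUC hL ν ν' m n θ t) (m + n - 1))
    fun p hp => hp.1
  have hs0 := fun m n => hs m n 0
  simp only [add_zero] at hs0
  exact ((hs m (n - 1) (unitV i)).mul (hs0 (m - 1) (n - 1))).div
    ((hs (m - 1) n (unitV i)).mul (hs0 m (n - 2)))
    fun p hp => mul_ne_zero (hp.2.2.2 i _ _ (by ring)) (hp.2.2.1 _ _ (by ring))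

theorem isRationalOn_gVar_sigmaUC (i : Fin (N + 1)) (m n : ℤ) :
    IsRationalOn (regularSet (fun m n (θ t : Fin (N + 1) → ℂ) => sigmaUC hL ν ν' m n θ t)
      (m + n)) fun θ t =>
        gVar (fun m n (θ t : Fin (N + 1) → ℂ) => sigmaUC hL ν ν' m n θ t) θ i m n t := by
  have hs := isRationalOn_sigmaUC (N := N) hL ν ν'
    (R := regularSet (fun m n (θ t : Fin (N + 1) → ℂ) => sigmaUC hL ν ν' m n θ t) (m + n))
    fun p hp => hp.1
  have hs0 := fun m n => hs m n 0
  simp only [add_zero] at hs0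
  -- The product form makes rationality of `g` visible without differentiating a rational function.
  refine (((IsRationalOn.fst i).mul ((hs (m - 1) (n - 1) (-unitV i)).mul (hs m n (unitV i)))).div
    ((hs0 m (n - 1)).mul (hs0 (m - 1) n)) fun p hp =>
      mul_ne_zero (hp.2.2.1 _ _ (by ring)) (hp.2.2.1 _ _ (by ring))).congr fun p hp => ?_
  rw [(isTauFamily_sigmaUC hL ν ν').gVar_eq hp.1 (hp.2.2.1 _ _ (by ring))
    (hp.2.2.1 _ _ (by ring)) i, sub_eq_add_neg p.1]

end Sigma

theorem mainTheorem4 (L N : ℕ) (hL : 2 ≤ L) (hN : 1 ≤ N) (ν ν' : Fin L → ℤ)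
    (σ : ℤ → ℤ → (Fin (N + 1) → ℂ) → (Fin (N + 1) → ℂ) → ℂ)
    (hσ : σ = fun m n θ t => sigmaUC hL ν ν' m n θ t)
    (d : ℤ → ℤ → ℤ) (hd : d = degreeUC hL ν ν')
    (κ : (Fin (N + 1) → ℂ) → ℤ → ℤ → ℂ)
    (hκ : κ = fun θ m n =>
      (L : ℂ) * ((cyclicEntry hL ν m : ℂ) + (cyclicEntry hL ν' n : ℂ))
        - ((∑ k, ν k : ℤ) : ℂ) - ((∑ k, ν' k : ℤ) : ℂ) + ∑ i, θ i) :
    -- the `σ` are periodic and differentiable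
    (∀ m n θ t, σ (m + L) n θ t = σ m n θ t ∧ σ m (n + L) θ t = σ m n θ t) ∧
    (∀ m n θ t, (∀ i, t i ≠ 0) → DifferentiableAt ℂ (σ m n θ) t) ∧
    -- first bilinear equation
    (∀ m n θ t i j, (∀ k, t k ≠ 0) →
      (t i - t j) * (σ m n θ t * σ (m + 1) (n + 1) (θ + unitV i + unitV j) t) =
        t i * (σ (m + 1) n (θ + unitV i) t * σ m (n + 1) (θ + unitV j) t)
          - t j * (σ (m + 1) n (θ + unitV j) t * σ m (n + 1) (θ + unitV i) t)) ∧
    -- second bilinear equation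
    (∀ m n θ t i, (∀ k, t k ≠ 0) →
      t i * hirotaD i (σ (m + 1) n θ) (σ m (n + 1) θ) t
          + θ i * (σ (m + 1) n θ t * σ m (n + 1) θ t) =
        θ i * (σ m n (θ - unitV i) t * σ (m + 1) (n + 1) (θ + unitV i) t)) ∧
    -- third bilinear equation
    (∀ m n θ t i j, (∀ k, t k ≠ 0) →
      (t j - t i) * hirotaD i (σ m n (θ - unitV j)) (σ (m + 1) n θ) t
          + θ i * (σ m n (θ - unitV j) t * σ (m + 1) n θ t) =
        θ i * (σ m n (θ - unitV i) t * σ (m + 1) n (θ + unitV i - unitV j) t)) ∧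
    -- homogeneity, with the degrees
    (∀ m n θ t, (∀ k, t k ≠ 0) →
      ∑ i, t i * partialD i (σ m n θ) t = (d m n : ℂ) * σ m n θ t) ∧
    (∀ m n, d m n - d (m - 1) n = L * cyclicEntry hL ν m - ∑ k, ν k) ∧
    (∀ m n, d m n - d m (n - 1) = -(L * cyclicEntry hL ν' n) + ∑ k, ν' k) ∧
    -- `f` and `g` are well-defined rational functions
    (∀ c, Dense (regularSet σ c)) ∧
    (∀ i m n, IsRationalOn (regularSet σ (m + n - 1)) (fun θ t => fVar σ θ i m n t)) ∧
    (∀ i m n, IsRationalOn (regularSet σ (m + n)) (fun θ t => gVar σ θ i m n t)) ∧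
    -- the second expression for `g`
    (∀ c, ∀ p ∈ regularSet σ c, ∀ i m n, m + n = c →
      gVar σ p.1 i m n p.2 =
        p.1 i * (σ (m - 1) (n - 1) (p.1 - unitV i) p.2 * σ m n (p.1 + unitV i) p.2) /
          (σ m (n - 1) p.1 p.2 * σ (m - 1) n p.1 p.2)) ∧
    -- `f` and `g` solve the system, with `U` and `V` the ratios of `σ`
    (∀ θ c, SolvesG (κ θ) c {t | (θ, t) ∈ regularSet σ c}
      (fVar σ θ) (gVar σ θ) (uVar σ θ) (vVar σ θ)) ∧
    -- `U` and `V` are the expressions in `f` and `g`, so the system is closed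
    (∀ c, ∀ p ∈ regularSet σ c, ∀ i j m n, m + n = c → p.2 i ^ L ≠ p.2 j ^ L →
      uVar σ p.1 i j m n p.2 = closedU L (fVar σ p.1) (gVar σ p.1) i j m n p.2 ∧
      vVar σ p.1 i j m n p.2 = closedV L (fVar σ p.1) (gVar σ p.1) i j m n p.2) ∧
    (∀ θ c, SolvesG (κ θ) c
      {t | (θ, t) ∈ regularSet σ c ∧ ∀ i j, i ≠ j → t i ^ L ≠ t j ^ L}
      (fVar σ θ) (gVar σ θ)
      (closedU L (fVar σ θ) (gVar σ θ)) (closedV L (fVar σ θ) (gVar σ θ))) := by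

  subst hσ hd hκ
  have H := isTauFamily_sigmaUC (N := N) hL ν ν'
  exact ⟨fun m n θ t => sigmaUC_periodic hL ν ν' m n θ t, H.differentiableAt, H.bilinear_one,
    H.bilinear_two, H.bilinear_three, H.euler, degreeUC_sub_left hL ν ν',
    degreeUC_sub_right hL ν ν', dense_regularSet hL ν ν', isRationalOn_fVar_sigmaUC hL ν ν',
    isRationalOn_gVar_sigmaUC hL ν ν',
    fun c p hp i m n hmn => H.gVar_eq hp.1 (hp.2.2.1 _ _ (by omega)) (hp.2.2.1 _ _ (by omega)) i,
    H.solvesG (degreeUC_sub_eq hL ν ν'),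
    fun c p hp i j m n hmn h => ⟨H.uVar_eq_closedU hp hmn h, H.vVar_eq_closedV hp hmn h⟩,
    H.solvesG_closed (degreeUC_sub_eq hL ν ν')⟩
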